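/- **Theorem.** Let $S,A:\mathbb R\to\mathbb R$ with $S$ differentiable, and let $\alpha(x)=-\tfrac12S'(x)+iA(x)$. Assume: 1. $\alpha\in C^1(\mathbb R)$, $A>0$, $A(x)\to0$ as $x\to\pm\infty$, and $-\tfrac12S'(x)\to\mu_\pm$ as $x\to\pm\infty$ with $\mu_\pm\in\mathbb R$; 2. $\alpha'(x)\ne0$ for all $x$, and $\alpha$ is injective; 3. the inverse function $x(u)$ on the curve $\Sigma=\alpha(\mathbb R)$ satisfies $(u-\mu_+)x(u)\to0$ as $u\to\mu_+$ along $\Sigma$ (that is, $u=\alpha(y)$, $y\to+\infty$), and $(u-\mu_+)x'(u)\in L^1(\Sigma_{u_0})$ for every $u_0\in\Sigma$, where $\Sigma_{u_0}$ is the arc of $\Sigma$ from $u_0$ to $\mu_+$ and $x'$ is the derivative along $\Sigma$. For $u\in\Sigma$ let $\sqrt{(z-u)(z-\bar u)}$ denote the branch that is analytic in $z$ off $\Sigma_u\cup\{\mu_+\}\cup\overline{\Sigma_u}$ and satisfies $\sqrt{(z-u)(z-\bar u)}/z\to-1$ as $z\to\infty$. Such a branch exists. For a real constant $f_0(\mu_+)$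 put, for $z\in\Sigma$, $$f_0(z)=\int_z^{\mu_+}\Big[z-\mu_++\sqrt{(z-u)(z-\bar u)}\Big]x'(u)\,du+(z-\mu_+)x(z)+f_0(\mu_+),$$ the integral being taken along $\Sigma$, and $f_0(\bar z)=\overline{f_0(z)}$. Then: (a) The integral defining $f_0$ converges absolutely. The function $f_0$ is differentiable along $\Sigma\cup\overline\Sigma$, and for $z\in\Sigma$ $$f_0'(z)=\int_z^{\mu_+}\Big[1+\frac{z-\operatorname{Re}u}{\sqrt{(z-u)(z-\bar u)}}\Big]x'(u)\,du+x(z),$$ with an absolutely convergent integral. (b) For every $\alpha\in\Sigma$, let $\gamma_m=\overline{\Sigma_\alpha}\cup\{\mu_+\}\cup\Sigma_\alpha$, oriented from $\bar\alpha$ to $\alpha$. The boundary values $\sqrt{(\zeta-\alpha)(\zeta-\bar\alpha)}_+$ from the left of $\gamma_m$ exist at every $\zeta\in\gamma_m\setminus\{\alpha,\bar\alpha,\mu_+\}$, and $$x(\alpha)=\frac1{\pi i}\int_{\gamma_m}\frac{f_0'(\zeta)}{\sqrt{(\zeta-\alpha)(\zeta-\bar\alpha)}_+}\,d\zeta .$$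 Here the integrals over the two halves of $\gamma_m$ are improper at $\mu_+$. Each is the limit, as $v\to\mu_+$, of the integrals over the part of $\Sigma_\alpha$ from $\alpha$ to $v$, respectively over its conjugate, where $v\in\Sigma_\alpha$ runs through the points with $\Sigma_v\subset\{\zeta:|\zeta-\mu_+|\le|v-\mu_+|\}$ (such $v$ exist arbitrarily close to $\mu_+$). If $f_0(z)\to f_0(\mu_+)$ as $z\to\mu_+$ along $\Sigma$, the same limits exist when $v\to\mu_+$ through all of $\Sigma_\alpha$. That is, substituting $f_0$ into the transformation $f_0\mapsto\frac1{\pi i}\int_{\gamma_m}f_0'(\zeta)\,d\zeta/\sqrt{(\zeta-\alpha)(\zeta-\bar\alpha)}_+$ gives back $x(\alpha)$. -/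

import Mathlib

open Set Filter Topology MeasureTheory ComplexConjugate

noncomputable section

/-! Throughout, `α : ℝ → ℂ` parametrizes a curve `Σ = α(ℝ)` in the upper half-plane which tends to
the real point `μ` at `+∞`. For `u = α y` the arc `Σ_u` of `Σ` from `u` to `μ` is `α '' Ici y`
together with `μ`. -/

namespace AbelHilbert

/-- The Schwarz symmetric curve consisting of `Σ` and its complex conjugate. -/
def symCurve (α : ℝ → ℂ) : Set ℂ := range α ∪ conj '' range α

/-- The Schwarz symmetric cut joining `conj (α y)` to `α y` through `μ`, i.e. the arc of `Σ` from
`α y` to `μ` together with its complex conjugate. -/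
def cut (α : ℝ → ℂ) (μ : ℝ) (y : ℝ) : Set ℂ :=
  α '' Ici y ∪ {(μ : ℂ)} ∪ conj '' (α '' Ici y)

/-- `R` is the branch of `√((z - u)(z - ū))`, `u = α y`, which is analytic off `cut α μ y` and
satisfies `R z / z → -1` as `z → ∞`. (The cut is a simple arc, so its complement is connected and
these properties determine `R` off the cut.) -/
def IsRadicalBranch (α : ℝ → ℂ) (μ : ℝ) (y : ℝ) (R : ℂ → ℂ) : Prop :=
  DifferentiableOn ℂ R (cut α μ y)ᶜ ∧
  (∀ z ∈ (cut α μ y)ᶜ, R z ^ 2 = (z - α y) * (z - conj (α y))) ∧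
  Tendsto (fun z => R z / z) (Bornology.cobounded ℂ) (𝓝 (-1))

/-- `g` is the continuous square root of `s ↦ (z - α s)(z - conj (α s))` along the arc `s ≥ y` whose
limit at the end point `μ` of the arc is `-(z - μ)`. -/
def IsRadicalLift (α : ℝ → ℂ) (μ : ℝ) (z : ℂ) (y : ℝ) (g : ℝ → ℂ) : Prop :=
  ContinuousOn g (Ici y) ∧
  (∀ s ∈ Ici y, g s ^ 2 = (z - α s) * (z - conj (α s))) ∧
  Tendsto g atTop (𝓝 (-(z - μ)))

open Classical in
/-- The radical `√((z - u)(z - ū))`, `u = α y`, with cut `cut α μ y` and the normalization `∼ -z` at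
infinity. For `z` off the cut, the value is obtained by shrinking the cut to the point `μ`, where the
radical is `-(z - μ)`, and continuing along the arc back to `u`; the function of `z` obtained in this
way is the branch described by `IsRadicalBranch`. -/
def radical (α : ℝ → ℂ) (μ : ℝ) (y : ℝ) (z : ℂ) : ℂ :=
  if h : ∃ g, IsRadicalLift α μ z y g then h.choose y else 0

/-- The inverse function `x(u)` of `α`, defined on `Σ` (real valued, regarded as complex). -/
def xinv (α : ℝ → ℂ) (u : ℂ) : ℂ := ((Function.invFun α u : ℝ) : ℂ)

/-- The derivative `x'(u)` of the inverse function along the curve `Σ`. -/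
def xinv' (α : ℝ → ℂ) (u : ℂ) : ℂ := derivWithin (xinv α) (range α) u

/-- Integrand, at `u = α y`, of `∫_z^μ [z - μ + √((z - u)(z - ū))] x'(u) du` with `du = α'(y) dy`. -/
def f0Integrand (α : ℝ → ℂ) (μ : ℝ) (z : ℂ) (y : ℝ) : ℂ :=
  (z - μ + radical α μ y z) * xinv' α (α y) * deriv α y

/-- Integrand, at `u = α y`, of `∫_z^μ [1 + (z - Re u) / √((z - u)(z - ū))] x'(u) du`. -/
def df0Integrand (α : ℝ → ℂ) (μ : ℝ) (z : ℂ) (y : ℝ) : ℂ :=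
  (1 + (z - ((α y).re : ℂ)) / radical α μ y z) * xinv' α (α y) * deriv α y

/-- The formula for `f₀` on `Σ`; the integral runs along `Σ` from `z` to `μ`, and `c` is the free real
parameter `f₀(μ)`. -/
def f0Up (α : ℝ → ℂ) (μ c : ℝ) (z : ℂ) : ℂ :=
  (∫ y in Ioi (Function.invFun α z), f0Integrand α μ z y) + (z - μ) * xinv α z + c

/-- `f₀` on `Σ`, extended to the conjugate curve by Schwarz symmetry, and `f₀(μ) = c`. -/
def f0 (α : ℝ → ℂ) (μ c : ℝ) (z : ℂ) : ℂ :=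
  if 0 < z.im then f0Up α μ c z
  else if z.im < 0 then conj (f0Up α μ c (conj z))
  else c

/-- The derivative of `f₀` along the symmetric curve. -/
def f0' (α : ℝ → ℂ) (μ c : ℝ) (z : ℂ) : ℂ := derivWithin (f0 α μ c) (symCurve α) z

/-- Boundary value of `R` at `ζ` from the left of a curve passing through `ζ` with tangent `τ`. -/
def leftValue (R : ℂ → ℂ) (ζ τ : ℂ) : ℂ :=
  limUnder (𝓝[>] (0 : ℝ)) fun ε => R (ζ + ε * (Complex.I * τ))

/-- The boundary value from the left exists as a limit. -/
def HasLeftValue (R : ℂ → ℂ) (ζ τ : ℂ) : Prop :=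
  ∃ l, Tendsto (fun ε : ℝ => R (ζ + ε * (Complex.I * τ))) (𝓝[>] (0 : ℝ)) (𝓝 l)

/-- The contour `γ_m` runs from `conj (α ξ)` to `α ξ` through `μ`. Its upper half is traversed in the
direction of decreasing parameter `s`, with tangent `-α'(s)` at `α s`. This is the integrand
`φ(ζ) / √((ζ - α ξ)(ζ - conj (α ξ)))₊ · dζ/ds` there. -/
def upperIntegrand (α : ℝ → ℂ) (μ : ℝ) (φ : ℂ → ℂ) (ξ s : ℝ) : ℂ :=
  φ (α s) / leftValue (radical α μ ξ) (α s) (-deriv α s) * deriv α s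

/-- The integrand on the lower half of `γ_m`, which is traversed in the direction of increasing
parameter `s`, with tangent `conj (α'(s))` at `conj (α s)`. -/
def lowerIntegrand (α : ℝ → ℂ) (μ : ℝ) (φ : ℂ → ℂ) (ξ s : ℝ) : ℂ :=
  φ (conj (α s)) / leftValue (radical α μ ξ) (conj (α s)) (conj (deriv α s)) * conj (deriv α s)

/-- `v = (1 / πi) ∫_{γ_m} φ(ζ) / √((ζ - α ξ)(ζ - conj (α ξ)))₊ dζ`, where the integral over each of the
two halves of `γ_m` is improper at `μ`: it converges when the truncation parameter runs along `l`. -/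
def HasTransform (α : ℝ → ℂ) (μ : ℝ) (φ : ℂ → ℂ) (ξ : ℝ) (l : Filter ℝ) (v : ℂ) : Prop :=
  (∀ T, ξ < T → IntervalIntegrable (upperIntegrand α μ φ ξ) volume ξ T ∧
    IntervalIntegrable (lowerIntegrand α μ φ ξ) volume ξ T) ∧
  ∃ I J : ℂ,
    Tendsto (fun T : ℝ => ∫ s in T..ξ, upperIntegrand α μ φ ξ s) l (𝓝 I) ∧
    Tendsto (fun T : ℝ => ∫ s in ξ..T, lowerIntegrand α μ φ ξ s) l (𝓝 J) ∧
    v = 1 / (Real.pi * Complex.I) * (J + I)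

/-- `T → +∞` through those `T` at which the curve leaves the region outside a disc centred at `μ` for
the last time, i.e. such that the rest of the curve stays in the closed disc of radius `|α T - μ|`. -/
def lastEntrance (α : ℝ → ℂ) (μ : ℝ) : Filter ℝ :=
  atTop ⊓ 𝓟 {T | ∀ s ≥ T, ‖α s - μ‖ ≤ ‖α T - μ‖}

end AbelHilbert

end

/-! Since `x'(u) du = dy`, every integral along `Σ` is an integral in the parameter. Write `R_t` for
the radical with end point `α t`, `k_t(z) = z - μ + R_t(z)` (`kern`), `k_t'` for its derivative
(`dkern`), and `w = α'/(R_ξ)₊` for the density of the transform (`edgeWeight`). Then `f₀(α s) - c =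
∫_s^∞ k_t(α s) dt + (α s - μ) s`. Because `k_s(α s) = α s - μ`, the boundary terms cancel on
differentiation, and `f₀'(α s) = ∫_s^∞ k_t'(α s) dt + s` (`hasDerivAt_potential`). By Schwarz
symmetry the two halves of the contour contribute `conj K` and `-K`, where `K` is the limit of
`∫_ξ^T f₀'(α s) w(s) ds`. The inversion formula therefore says `Im K = -πξ/2`.

Put `W(t) = ∫_ξ^t w`, `D = lim W` and `V(t,T) = ∫_ξ^T w(s) k_t'(α s) ds` (`weightedKern`). Fubini,
and integration by parts of `s w(s)`, turn the truncated integral into `T (W(T) - D) + ξ D + ∫_ξ^T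
[V(t,t) - W(t) + D] dt + ∫_T^∞ V(t,T) dt` (`integral_upperIntegrand`).

The heart of the proof is the interaction identity `Im ∫_ξ^t (z - c)/(R_t (R_ξ)₊) dz = π/2` for real
`c` (`RegularArc.im_integral_eq`, `im_interaction`). In the product `R_ξ R_t` the cuts beyond `α t`
cancel (`radical_mul_radical`). What is left is `M(z) conj(M(conj z))`, where `M` is the root cut
along the arc from `α ξ` to `α t` alone. Adding to `(z - c)/(M(z) conj(M(conj z)))` the Cauchy
integrals that cancel its jumps on this arc and on its conjugate gives an entire function vanishing
at infinity, hence zero; its coefficient of `1/z` is the identity. The curve is only `C¹`, so the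
jumps come from Plemelj formulas with analytic density on nearly straight arcs (`exists_plemelj`),
and the end points are treated in a square root coordinate (`SqrtCurve`, `arcDefect_extends_left`).

With `c = Re (α t)` the identity reads `Im V(t,t) = Im W(t) + π/2`, and letting `t → ∞` gives `Im D
= -π/2`. The bracket above is then real, so `ξ D` is the only source of imaginary part once the
outer terms vanish in the limit.

The term `T (W(T) - D)` vanishes because `(α T - μ) T → 0`. For the tail, a Joukowski substitution
gives `|V(t,T)| ≤ C (|α t - μ| + |k_t(α T)|)` (`exists_dkern_integral_bound`), and `|α t - μ|` is
integrable. The number `k_t(α T)` lies within `4 |α t - μ|` of `0` or of `2 (α T - μ)`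
(`kern_near`). At a last entrance it is `O(|α t - μ|)` in either case (`kern_le_of_lastEntrance`).
If `f₀` is continuous at `μ`, then `∫_T^∞ k_t(α T) dt → 0`, and the two alternatives leave no room
for cancellation in this integral (`integral_norm_kern_le`). -/

namespace AbelHilbert

/-! ### Analyticity of integrals depending on a complex parameter. -/

theorem differentiableOn_integral_of_locally_dominated {ν : Measure ℝ} {U : Set ℂ} (hU : IsOpen U)
    {f : ℂ → ℝ → ℂ} (hm : ∀ z ∈ U, AEStronglyMeasurable (f z) ν)
    (hd : ∀ᵐ r ∂ν, DifferentiableOn ℂ (fun z => f z r) U)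
    (hb : ∀ z ∈ U, ∃ ε > 0, ∃ B : ℝ → ℝ, Integrable B ν ∧
      ∀ᵐ r ∂ν, ∀ w ∈ Metric.ball z ε, w ∈ U → ‖f w r‖ ≤ B r) :
    DifferentiableOn ℂ (fun z => ∫ r, f z r ∂ν) U := by
  intro z hz
  obtain ⟨ε, hε, B, hB, hfB⟩ := hb z hz
  obtain ⟨δ, hδ, hδU⟩ := Metric.isOpen_iff.1 hU z hz
  set η := min ε δ / 2 with hη
  have hη0 : 0 < η := by positivity
  have hηε : 2 * η ≤ ε := by rw [hη]; linarith [min_le_left ε δ]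
  have hηδ : 2 * η ≤ δ := by rw [hη]; linarith [min_le_right ε δ]
  have hball : ∀ w ∈ Metric.ball z η, Metric.closedBall w (η / 2) ⊆ Metric.ball z (2 * η) := by
    intro w hw x hx
    rw [Metric.mem_ball] at *
    rw [Metric.mem_closedBall] at hx
    linarith [dist_triangle x w z]
  have hsub : Metric.ball z (2 * η) ⊆ U := (Metric.ball_subset_ball hηδ).trans hδU
  have key := hasDerivAt_integral_of_dominated_loc_of_deriv_le (μ := ν) (F := f)
    (F' := fun w r => deriv (fun z => f z r) w) (x₀ := z) (s := Metric.ball z η)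
    (bound := fun r => B r / (η / 2)) (Metric.ball_mem_nhds z hη0)
    (by filter_upwards [hU.mem_nhds hz] with w hw using hm w hw)
    (Integrable.mono' hB (hm z hz) (by
      filter_upwards [hfB] with r hr using hr z (Metric.mem_ball_self hε) hz))
    (by
      -- The derivative at `z` is measurable in `r` as the almost everywhere limit of difference
      -- quotients along `z + 1/(n+1)`.
      have hlim : Tendsto (fun n : ℕ => z + ((1 / ((n : ℝ) + 1) : ℝ) : ℂ)) atTop (𝓝[≠] z) := by
        refine tendsto_nhdsWithin_iff.2 ⟨?_, Eventually.of_forall fun n => ?_⟩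
        · have := (Complex.continuous_ofReal.tendsto 0).comp
            (tendsto_one_div_add_atTop_nhds_zero_nat (𝕜 := ℝ))
          simpa using this.const_add z
        · have : (0 : ℝ) < 1 / ((n : ℝ) + 1) := by positivity
          simp only [mem_compl_iff, mem_singleton_iff, add_eq_left]
          exact_mod_cast this.ne'
      have hlimU := (tendsto_nhdsWithin_iff.1 hlim).1.eventually (hU.mem_nhds hz)
      obtain ⟨N, hN⟩ := eventually_atTop.1 hlimU
      refine aestronglyMeasurable_of_tendsto_ae atTop
        (f := fun n : ℕ => fun r => slope (fun z => f z r) z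
          (z + ((1 / (((n + N : ℕ) : ℝ) + 1) : ℝ) : ℂ))) (fun n => ?_) ?_
      · simp only [slope, vsub_eq_sub, smul_eq_mul]
        exact ((hm _ (hN (n + N) (by omega))).sub (hm z hz)).const_mul _
      · filter_upwards [hd] with r hr
        have h1 := hasDerivAt_iff_tendsto_slope.1
          ((hr.differentiableAt (hU.mem_nhds hz)).hasDerivAt)
        exact h1.comp (hlim.comp (tendsto_add_atTop_nat N)))
    (by
      filter_upwards [hfB, hd] with r hr hdr w hw
      -- Cauchy's estimate on a circle of radius `η / 2` inside the ball of radius `2 η`; this is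
      -- the source of the bound `B / (η / 2)`.
      refine Complex.norm_deriv_le_of_forall_mem_sphere_norm_le (by positivity) ?_ ?_
      · refine (hdr.mono ?_).diffContOnCl_ball (U := Metric.ball z (2 * η)) ?_
        · exact hsub
        · exact hball w hw
      · intro x hx
        have := hball w hw (Metric.sphere_subset_closedBall hx)
        exact hr x (Metric.ball_subset_ball hηε this) (hsub this))
    (hB.div_const _)
    (by
      filter_upwards [hd] with r hr w hw
      exact (hr.differentiableAt (hU.mem_nhds (hsub
        (Metric.ball_subset_ball (by linarith) hw)))).hasDerivAt)
  exact key.2.differentiableAt.differentiableWithinAt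

/-- Integrals of Cauchy type are analytic off the curve. -/
theorem differentiableOn_cauchyIntegral {c : ℝ → ℂ} {p : ℝ → ℂ} {a b : ℝ} (hab : a ≤ b)
    (hc : ContinuousOn c (Icc a b)) (hp : IntervalIntegrable p volume a b) :
    DifferentiableOn ℂ (fun z => ∫ s in a..b, p s / (c s - z)) (c '' Icc a b)ᶜ := by
  have hK : IsClosed (c '' Icc a b) := (isCompact_Icc.image_of_continuousOn hc).isClosed
  simp only [intervalIntegral.integral_of_le hab]
  have hp' := (intervalIntegrable_iff_integrableOn_Ioc_of_le hab).1 hp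
  refine differentiableOn_integral_of_locally_dominated hK.isOpen_compl ?_ ?_ ?_
  · intro z hz
    refine hp'.aestronglyMeasurable.mul ?_
    refine ContinuousOn.aestronglyMeasurable ?_ measurableSet_Ioc
    refine ContinuousOn.inv₀ ((hc.mono Ioc_subset_Icc_self).sub continuousOn_const) fun s hs h => ?_
    exact hz ⟨s, Ioc_subset_Icc_self hs, sub_eq_zero.1 h⟩
  · filter_upwards [ae_restrict_mem measurableSet_Ioc] with s hs
    intro z hz
    refine DifferentiableAt.differentiableWithinAt ?_
    refine DifferentiableAt.div (by fun_prop) (by fun_prop) fun h => ?_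
    exact hz ⟨s, Ioc_subset_Icc_self hs, sub_eq_zero.1 h⟩
  · intro z hz
    obtain ⟨δ, hδ, hδU⟩ := Metric.isOpen_iff.1 hK.isOpen_compl z hz
    refine ⟨δ / 2, by positivity, fun s => ‖p s‖ / (δ / 2), hp'.norm.div_const _, ?_⟩
    filter_upwards [ae_restrict_mem measurableSet_Ioc] with s hs w hw _
    rw [norm_div]
    have h1 : δ ≤ ‖c s - z‖ := by
      by_contra! h
      exact hδU (by rwa [Metric.mem_ball, dist_eq_norm])
        ⟨s, Ioc_subset_Icc_self hs, rfl⟩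
    have h2 : ‖w - z‖ < δ / 2 := by rwa [Metric.mem_ball, dist_eq_norm] at hw
    have h3 : ‖c s - z‖ ≤ ‖c s - w‖ + ‖w - z‖ := by
      simpa using norm_add_le (c s - w) (w - z)
    gcongr
    linarith

theorem dslope_symm (F : ℂ → ℂ) (z w : ℂ) : dslope F z w = dslope F w z := by
  rcases eq_or_ne z w with rfl | h
  · rfl
  · rw [dslope_of_ne _ h.symm, dslope_of_ne _ h, slope_comm]

/-- The regular part of a Cauchy integral with density `F`: the quotient `(F(c) - F(z))/(c - z)` has
a removable singularity and is symmetric in its two arguments, hence analytic in `z` even on the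
curve. -/
theorem differentiableOn_integral_dslope {F : ℂ → ℂ} {z₀ : ℂ} {R : ℝ}
    (hF : DifferentiableOn ℂ F (Metric.ball z₀ R)) {c : ℝ → ℂ} {p : ℝ → ℂ} {a b : ℝ} (hab : a ≤ b)
    (hc : ContinuousOn c (Icc a b)) (hcB : ∀ s ∈ Icc a b, c s ∈ Metric.ball z₀ R)
    (hp : IntervalIntegrable p volume a b) :
    DifferentiableOn ℂ (fun z => ∫ s in a..b, dslope F z (c s) * p s) (Metric.ball z₀ R) := by
  have hK : IsCompact (c '' Icc a b) := isCompact_Icc.image_of_continuousOn hc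
  simp only [intervalIntegral.integral_of_le hab]
  have hp' := (intervalIntegrable_iff_integrableOn_Ioc_of_le hab).1 hp
  have hds : ∀ z ∈ Metric.ball z₀ R, DifferentiableOn ℂ (dslope F z) (Metric.ball z₀ R) :=
    fun z hz => (Complex.differentiableOn_dslope (Metric.isOpen_ball.mem_nhds hz)).2 hF
  refine differentiableOn_integral_of_locally_dominated Metric.isOpen_ball ?_ ?_ ?_
  · intro z hz
    refine AEStronglyMeasurable.mul ?_ hp'.aestronglyMeasurable
    refine ContinuousOn.aestronglyMeasurable ?_ measurableSet_Ioc
    exact (hds z hz).continuousOn.comp (hc.mono Ioc_subset_Icc_self)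
      fun s hs => hcB s (Ioc_subset_Icc_self hs)
  · filter_upwards [ae_restrict_mem measurableSet_Ioc] with s hs
    simp only [fun z => dslope_symm F z (c s)]
    exact (hds _ (hcB s (Ioc_subset_Icc_self hs))).mul_const _
  · intro z hz
    obtain ⟨R₁, hR₁, hKR⟩ : ∃ R₁ < R, insert z (c '' Icc a b) ⊆ Metric.ball z₀ R₁ := by
      have hR : 0 < R := dist_nonneg.trans_lt hz
      have := exists_pos_lt_subset_ball hR (hK.insert z).isClosed
        (insert_subset hz (by rintro _ ⟨s, hs, rfl⟩; exact hcB s hs))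
      obtain ⟨r, hr, h⟩ := this
      exact ⟨r, hr.2, h⟩
    obtain ⟨C, hC⟩ : ∃ C, ∀ x ∈ Metric.closedBall z₀ R₁, ‖deriv F x‖ ≤ C := by
      refine (isCompact_closedBall z₀ R₁).exists_bound_of_continuousOn ?_
      exact ((hF.deriv Metric.isOpen_ball).continuousOn).mono
        (Metric.closedBall_subset_ball hR₁)
    have hz1 : z ∈ Metric.ball z₀ R₁ := hKR (mem_insert _ _)
    obtain ⟨ε, hε, hεb⟩ := Metric.isOpen_iff.1 Metric.isOpen_ball z hz1
    refine ⟨ε, hε, fun s => C * ‖p s‖, hp'.norm.const_mul _, ?_⟩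
    filter_upwards [ae_restrict_mem measurableSet_Ioc] with s hs w hw _
    rw [norm_mul]
    have hcs : c s ∈ Metric.ball z₀ R₁ := hKR (mem_insert_of_mem _ ⟨s, Ioc_subset_Icc_self hs, rfl⟩)
    have hw1 := hεb hw
    gcongr
    rcases eq_or_ne (c s) w with h | h
    · rw [h, dslope_same]
      exact hC w (Metric.ball_subset_closedBall hw1)
    · rw [dslope_of_ne _ h, slope_def_field, norm_div, div_le_iff₀ (norm_pos_iff.2 (sub_ne_zero.2 h))]
      refine (convex_ball z₀ R₁).norm_image_sub_le_of_norm_deriv_le (𝕜 := ℂ) (fun x hx => ?_)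
        (fun x hx => hC x (Metric.ball_subset_closedBall hx)) hw1 hcs
      exact hF.differentiableAt (Metric.isOpen_ball.mem_nhds (Metric.ball_subset_ball hR₁.le hx))

/-! ### Plemelj formulas on nearly straight arcs. -/

/-- The curve `c` on `[a, b]` is `C¹` and its tangent stays close to the direction `e`. -/
structure NearlyStraight (c c' : ℝ → ℂ) (e : ℂ) (a b : ℝ) : Prop where
  lt : a < b
  ne : e ≠ 0
  deriv : ∀ r ∈ Icc a b, HasDerivAt c (c' r) r
  cont : ContinuousOn c' (Icc a b)
  near : ∀ r ∈ Icc a b, ‖c' r / e - 1‖ ≤ 1 / 10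

/-- The point `z` lies to the right of the curve `c` whose direction is roughly `e`. -/
def OnRight (c : ℝ → ℂ) (e : ℂ) (a b : ℝ) (z : ℂ) : Prop :=
  ∃ r ∈ Icc a b, ∃ y : ℝ, 0 < y ∧ (c r - z) / e = Complex.I * y

/-- The point `z` lies to the left of the curve `c` whose direction is roughly `e`. -/
def OnLeft (c : ℝ → ℂ) (e : ℂ) (a b : ℝ) (z : ℂ) : Prop :=
  ∃ r ∈ Icc a b, ∃ y : ℝ, y < 0 ∧ (c r - z) / e = Complex.I * y

/-- The points whose projection to the direction `e` lies between those of `c a` and `c b`. -/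
def crossStrip (c : ℝ → ℂ) (e : ℂ) (a b : ℝ) : Set ℂ :=
  {z | ((c a - z) / e).re < 0 ∧ 0 < ((c b - z) / e).re}

/-- The analytic part of `∫ c'/(c - z)`. -/
noncomputable def logJump (c : ℝ → ℂ) (e : ℂ) (a b : ℝ) (z : ℂ) : ℂ :=
  Complex.log (-Complex.I * ((c b - z) / e)) - Complex.log (-Complex.I * ((c a - z) / e))
    + Real.pi * Complex.I

theorem isOpen_crossStrip (c : ℝ → ℂ) (e : ℂ) (a b : ℝ) : IsOpen (crossStrip c e a b) :=
  IsOpen.inter (s := {z | ((c a - z) / e).re < 0}) (t := {z | 0 < ((c b - z) / e).re})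
    (isOpen_lt (by fun_prop) continuous_const) (isOpen_lt continuous_const (by fun_prop))

theorem differentiableOn_logJump (c : ℝ → ℂ) (e : ℂ) (a b : ℝ) :
    DifferentiableOn ℂ (logJump c e a b) (crossStrip c e a b) := by
  intro z hz
  refine DifferentiableAt.differentiableWithinAt ?_
  unfold logJump
  refine DifferentiableAt.add (DifferentiableAt.sub ?_ ?_) (by fun_prop)
  · refine DifferentiableAt.clog (by fun_prop) ?_
    rw [Complex.mem_slitPlane_iff]
    right
    simpa using hz.2.ne'
  · refine DifferentiableAt.clog (by fun_prop) ?_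
    rw [Complex.mem_slitPlane_iff]
    right
    simpa using hz.1.ne

/-- The half turn from `-I x` to `I x` shifts the argument by `π` or by `-π`, according to the sign
of `x.re`. The two end points of a crossed arc fall under opposite cases, which produces the total
jump `2πi`. -/
theorem log_I_mul_of_re_pos {x : ℂ} (hx : 0 < x.re) :
    Complex.log (Complex.I * x) = Complex.log (-Complex.I * x) + Real.pi * Complex.I := by
  have h : Complex.I * x = -(-Complex.I * x) := by ring
  rw [h, Complex.log, Complex.log, norm_neg, Complex.arg_neg_eq_arg_add_pi_of_im_neg (by simpa)]
  push_cast; ring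

theorem log_I_mul_of_re_neg {x : ℂ} (hx : x.re < 0) :
    Complex.log (Complex.I * x) = Complex.log (-Complex.I * x) - Real.pi * Complex.I := by
  have h : Complex.I * x = -(-Complex.I * x) := by ring
  rw [h, Complex.log, Complex.log, norm_neg, Complex.arg_neg_eq_arg_sub_pi_of_im_pos (by simpa)]
  push_cast; ring

namespace NearlyStraight

variable {c c' : ℝ → ℂ} {e : ℂ} {a b : ℝ}

theorem reverse (h : NearlyStraight c c' e a b) :
    NearlyStraight (fun r => c (-r)) (fun r => -c' (-r)) (-e) (-b) (-a) where
  lt := neg_lt_neg h.lt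
  ne := neg_ne_zero.2 h.ne
  deriv r hr := by
    have := (h.deriv (-r) ⟨by linarith [hr.2], by linarith [hr.1]⟩).scomp r (hasDerivAt_neg r)
    simpa [Function.comp_def] using this
  cont := (h.cont.comp continuousOn_neg fun r hr => ⟨by linarith [hr.2], by linarith [hr.1]⟩).neg
  near r hr := by
    have := h.near (-r) ⟨by linarith [hr.2], by linarith [hr.1]⟩
    simpa [neg_div_neg_eq] using this

theorem onLeft_iff_reverse (z : ℂ) :
    OnLeft c e a b z ↔ OnRight (fun r => c (-r)) (-e) (-b) (-a) z := by
  constructor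
  · rintro ⟨r, hr, y, hy, h⟩
    refine ⟨-r, ⟨by linarith [hr.2], by linarith [hr.1]⟩, -y, by linarith, ?_⟩
    simp only [neg_neg, div_neg, h]; push_cast; ring
  · rintro ⟨r, hr, y, hy, h⟩
    refine ⟨-r, ⟨by linarith [hr.2], by linarith [hr.1]⟩, -y, by linarith, ?_⟩
    rw [div_neg] at h
    push_cast; linear_combination -h

theorem norm_sub_le (h : NearlyStraight c c' e a b) {r s : ℝ} (hr : r ∈ Icc a b)
    (hs : s ∈ Icc a b) : ‖(c r - c s) / e - ((r - s : ℝ) : ℂ)‖ ≤ 1 / 10 * |r - s| := by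
  have := (convex_Icc a b).norm_image_sub_le_of_norm_hasDerivWithin_le
    (f := fun r => c r / e - (r : ℂ)) (f' := fun r => c' r / e - 1) (C := 1 / 10) (x := s) (y := r)
    (fun x hx => (((h.deriv x hx).div_const e).sub Complex.ofRealCLM.hasDerivAt).hasDerivWithinAt)
    h.near hs hr
  rw [Real.norm_eq_abs] at this
  refine le_trans (le_of_eq ?_) this
  congr 1
  push_cast; ring

theorem re_sub (h : NearlyStraight c c' e a b) {r s : ℝ} (hr : r ∈ Icc a b) (hs : s ∈ Icc a b) :
    |((c r - c s) / e).re - (r - s)| ≤ 1 / 10 * |r - s| := by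
  have := (Complex.abs_re_le_norm _).trans (h.norm_sub_le hr hs)
  simpa using this

theorem im_sub (h : NearlyStraight c c' e a b) {r s : ℝ} (hr : r ∈ Icc a b) (hs : s ∈ Icc a b) :
    |((c r - c s) / e).im| ≤ 1 / 10 * |r - s| := by
  have := (Complex.abs_im_le_norm _).trans (h.norm_sub_le hr hs)
  simpa using this

theorem re_ne (h : NearlyStraight c c' e a b) {r s : ℝ} (hr : r ∈ Icc a b) (hs : s ∈ Icc a b)
    (hrs : r ≠ s) : ((c r - c s) / e).re ≠ 0 := by
  intro h0
  have h1 := h.re_sub hr hs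
  rw [h0, zero_sub, abs_neg] at h1
  have : 0 < |r - s| := abs_pos.2 (sub_ne_zero.2 hrs)
  linarith

theorem continuousOn (h : NearlyStraight c c' e a b) : ContinuousOn c (Icc a b) :=
  fun r hr => (h.deriv r hr).continuousAt.continuousWithinAt

/-- By the intermediate value theorem the line through `z` perpendicular to `e` meets the arc; the
order of the two points on that line decides the side. -/
theorem onRight_or_onLeft (h : NearlyStraight c c' e a b) {z : ℂ} (hz : z ∈ crossStrip c e a b)
    (hzc : z ∉ c '' Icc a b) : OnRight c e a b z ∨ OnLeft c e a b z := by
  have hcont : ContinuousOn (fun r => ((c r - z) / e).re) (Icc a b) :=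
    Complex.continuous_re.comp_continuousOn ((h.continuousOn.sub continuousOn_const).div_const e)
  obtain ⟨r, hr, h0⟩ := intermediate_value_Icc h.lt.le hcont ⟨hz.1.le, hz.2.le⟩
  have hrep : (c r - z) / e = Complex.I * (((c r - z) / e).im : ℝ) := by
    apply Complex.ext <;> simp_all
  rcases lt_trichotomy ((c r - z) / e).im 0 with h1 | h1 | h1
  · exact Or.inr ⟨r, hr, _, h1, hrep⟩
  · rw [h1] at hrep
    have : c r - z = 0 := by simpa [h.ne] using hrep
    exact absurd ⟨r, hr, sub_eq_zero.1 this⟩ hzc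
  · exact Or.inl ⟨r, hr, _, h1, hrep⟩

/-- The rotated difference is real only at the parameter facing `z`, and there it is positive. So
the principal logarithm is a primitive of `c'/(c - z)` along the whole arc. -/
theorem mem_slitPlane (h : NearlyStraight c c' e a b) {z : ℂ} (hz : OnRight c e a b z) {r : ℝ}
    (hr : r ∈ Icc a b) : -Complex.I * ((c r - z) / e) ∈ Complex.slitPlane := by
  obtain ⟨r₀, hr₀, y, hy, h0⟩ := hz
  rw [Complex.mem_slitPlane_iff]
  rcases eq_or_ne r r₀ with rfl | hne
  · left; rw [h0]; simpa using hy
  · right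
    have h1 : (c r - z) / e = (c r - c r₀) / e + Complex.I * y := by rw [← h0]; ring
    rw [h1]
    simpa using h.re_ne hr hr₀ hne

theorem integral_of_onRight (h : NearlyStraight c c' e a b) {z : ℂ} (hz : OnRight c e a b z) :
    IntervalIntegrable (fun r => c' r / (c r - z)) volume a b ∧
    ∫ r in a..b, c' r / (c r - z) = logJump c e a b z - Real.pi * Complex.I := by
  have hne : ∀ r ∈ Icc a b, c r - z ≠ 0 := fun r hr h0 => by
    have := Complex.slitPlane_ne_zero (h.mem_slitPlane hz hr)
    simp [h0] at this
  have hint : IntervalIntegrable (fun r => c' r / (c r - z)) volume a b := by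
    refine ContinuousOn.intervalIntegrable ?_
    rw [uIcc_of_le h.lt.le]
    exact h.cont.div (h.continuousOn.sub continuousOn_const) hne
  refine ⟨hint, ?_⟩
  rw [intervalIntegral.integral_eq_sub_of_hasDerivAt
    (f := fun r => Complex.log (-Complex.I * ((c r - z) / e))) ?_ hint, logJump]
  · ring
  · intro r hr
    rw [uIcc_of_le h.lt.le] at hr
    have h1 := (((h.deriv r hr).sub_const z).div_const e).const_mul (-Complex.I)
    have h2 := h1.clog_real (h.mem_slitPlane hz hr)
    rwa [mul_div_mul_left _ _ (neg_ne_zero.2 Complex.I_ne_zero),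
      div_div_div_cancel_right₀ h.ne] at h2

/-- Reversing the arc exchanges the sides. The logarithms at the two ends are then shifted by
opposite multiples of `πi`, which turns `-πi` into `+πi`. -/
theorem integral_of_onLeft (h : NearlyStraight c c' e a b) {z : ℂ} (hz : OnLeft c e a b z)
    (hzs : z ∈ crossStrip c e a b) :
    IntervalIntegrable (fun r => c' r / (c r - z)) volume a b ∧
    ∫ r in a..b, c' r / (c r - z) = logJump c e a b z + Real.pi * Complex.I := by
  have h1 := h.reverse.integral_of_onRight ((onLeft_iff_reverse z).1 hz)
  have h2 := (IntervalIntegrable.iff_comp_neg (f := fun r => -c' (-r) / (c (-r) - z))).1 h1.1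
  simp only [neg_neg] at h2
  have h3 : (fun r => c' r / (c r - z)) = -(fun r => -c' r / (c r - z)) := by
    ext r; simp only [Pi.neg_apply]; ring
  refine ⟨by rw [h3]; exact h2.symm.neg, ?_⟩
  have h4 := h1.2
  rw [intervalIntegral.integral_comp_neg (fun r => -c' r / (c r - z)), neg_neg, neg_neg] at h4
  have h5 : ∫ r in a..b, c' r / (c r - z) = -∫ r in a..b, -c' r / (c r - z) := by
    rw [← intervalIntegral.integral_neg]
    exact intervalIntegral.integral_congr fun r _ => by ring
  rw [h5, h4]
  simp only [logJump, neg_neg]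
  have e1 : ∀ x : ℂ, -Complex.I * (x / -e) = Complex.I * (x / e) := fun x => by
    rw [div_neg]; ring
  rw [e1, e1, log_I_mul_of_re_pos hzs.2, log_I_mul_of_re_neg hzs.1]
  ring

/-- A nearly straight arc cannot turn back into a sector of half-angle `π/4` about its normal, so
non-tangential approach to a point of the arc stays on one side of it. -/
theorem onRight_of_sector (h : NearlyStraight c c' e a b) {r₀ : ℝ} (hr₀ : r₀ ∈ Ioo a b) :
    ∃ η > 0, ∀ w : ℂ, ‖w‖ < η → w.im < 0 → |w.re| ≤ -w.im →
      OnRight c e a b (c r₀ + w * c' r₀) := by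
  refine ⟨min (b - r₀) (r₀ - a) / 2, by
    have := hr₀.1; have := hr₀.2; have : 0 < min (b - r₀) (r₀ - a) := lt_min (by linarith) (by linarith)
    positivity, fun w hw him hre => ?_⟩
  have hr₀' := Ioo_subset_Icc_self hr₀
  set y := -w.im with hy
  have hy0 : 0 < y := by linarith
  have hyw : y ≤ ‖w‖ := by
    have := Complex.abs_im_le_norm w
    rw [abs_of_neg him] at this; exact this
  have hwy : ‖w‖ ≤ 2 * y := by
    have := Complex.norm_le_abs_re_add_abs_im w
    rw [abs_of_neg him] at this; linarith
  have hb : y < (b - r₀) / 2 := by linarith [min_le_left (b - r₀) (r₀ - a)]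
  have ha : y < (r₀ - a) / 2 := by linarith [min_le_right (b - r₀) (r₀ - a)]
  set z := c r₀ + w * c' r₀ with hz
  set x := w * (c' r₀ / e - 1) with hx
  have hxn : ‖x‖ ≤ 1 / 5 * y := by
    rw [hx, norm_mul]
    calc ‖w‖ * ‖c' r₀ / e - 1‖ ≤ (2 * y) * (1 / 10) := by
          gcongr; exact h.near r₀ hr₀'
      _ = 1 / 5 * y := by ring
  have hdec : ∀ r, (c r - z) / e = (c r - c r₀) / e - w - x := fun r => by
    rw [hx, hz]; have := h.ne; field_simp; ring
  have hxr := abs_le.1 ((Complex.abs_re_le_norm x).trans hxn)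
  have hxi := abs_le.1 ((Complex.abs_im_le_norm x).trans hxn)
  have hwr := abs_le.1 hre
  -- At distance `1.4 y` the errors are `0.14 y` from the chord, `y` from `w.re` and `0.2 y` from
  -- `x`. They leave a margin `0.06 y`, so the real part changes sign on this interval; the
  -- imaginary part at the zero is at least `y - 0.14 y - 0.2 y`.
  have hcont : ContinuousOn (fun r => ((c r - z) / e).re) (Icc (r₀ - 1.4 * y) (r₀ + 1.4 * y)) :=
    (Complex.continuous_re.comp_continuousOn ((h.continuousOn.sub continuousOn_const).div_const e)).mono
      (Icc_subset_Icc (by linarith) (by linarith))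
  have hm1 : r₀ - 1.4 * y ∈ Icc a b := ⟨by linarith, by linarith⟩
  have hm2 : r₀ + 1.4 * y ∈ Icc a b := ⟨by linarith, by linarith⟩
  have h1 := abs_le.1 (h.re_sub hm1 hr₀')
  have h2 := abs_le.1 (h.re_sub hm2 hr₀')
  rw [show r₀ - 1.4 * y - r₀ = -(1.4 * y) by ring, abs_neg, abs_of_pos (by positivity)] at h1
  rw [show r₀ + 1.4 * y - r₀ = 1.4 * y by ring, abs_of_pos (by positivity)] at h2
  obtain ⟨r, hr, h0⟩ := intermediate_value_Icc (by linarith) hcont (by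
    constructor
    · simp only [hdec, Complex.sub_re]; linarith
    · simp only [hdec, Complex.sub_re]; linarith : (0 : ℝ) ∈ Icc _ _)
  have hrI : r ∈ Icc a b := ⟨by linarith [hr.1], by linarith [hr.2]⟩
  have h3 := abs_le.1 (h.im_sub hrI hr₀')
  have h4 : |r - r₀| ≤ 1.4 * y := abs_le.2 ⟨by linarith [hr.1], by linarith [hr.2]⟩
  refine ⟨r, hrI, ((c r - z) / e).im, ?_, ?_⟩
  · rw [hdec]; simp only [Complex.sub_im]; linarith
  · apply Complex.ext
    · simpa using h0
    · simp

theorem onLeft_of_sector (h : NearlyStraight c c' e a b) {r₀ : ℝ} (hr₀ : r₀ ∈ Ioo a b) :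
    ∃ η > 0, ∀ w : ℂ, ‖w‖ < η → 0 < w.im → |w.re| ≤ w.im →
      OnLeft c e a b (c r₀ + w * c' r₀) := by
  obtain ⟨η, hη, H⟩ := h.reverse.onRight_of_sector (r₀ := -r₀)
    ⟨neg_lt_neg hr₀.2, neg_lt_neg hr₀.1⟩
  refine ⟨η, hη, fun w h1 h2 h3 => ?_⟩
  have := H (-w) (by simpa) (by simpa) (by simpa)
  rw [onLeft_iff_reverse]
  simpa using this

/-- The Plemelj formulas for an analytic density. -/
theorem exists_plemelj (h : NearlyStraight c c' e a b) {F : ℂ → ℂ} {z₀ : ℂ} {R : ℝ}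
    (hF : DifferentiableOn ℂ F (Metric.ball z₀ R)) (hcB : ∀ s ∈ Icc a b, c s ∈ Metric.ball z₀ R) :
    ∃ G : ℂ → ℂ, DifferentiableOn ℂ G (Metric.ball z₀ R ∩ crossStrip c e a b) ∧
      ∀ z ∈ Metric.ball z₀ R ∩ crossStrip c e a b,
        (OnRight c e a b z → ∫ s in a..b, F (c s) * c' s / (c s - z) =
          G z - Real.pi * Complex.I * F z) ∧
        (OnLeft c e a b z → ∫ s in a..b, F (c s) * c' s / (c s - z) =
          G z + Real.pi * Complex.I * F z) := by
  have hc' : IntervalIntegrable c' volume a b := by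
    refine ContinuousOn.intervalIntegrable ?_
    rw [uIcc_of_le h.lt.le]; exact h.cont
  -- Writing `F(c) = F(z) + (c - z) · dslope F z c` confines the whole jump to `F(z) ∫ c'/(c - z)`,
  -- whose analytic part is `logJump`.
  refine ⟨fun z => (∫ s in a..b, dslope F z (c s) * c' s) + F z * logJump c e a b z,
    ((differentiableOn_integral_dslope hF h.lt.le h.continuousOn hcB hc').mono
      inter_subset_left).add ((hF.mono inter_subset_left).mul
      ((differentiableOn_logJump c e a b).mono inter_subset_right)), ?_⟩
  have key : ∀ z ∈ Metric.ball z₀ R, (∀ s ∈ Icc a b, c s ≠ z) →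
      IntervalIntegrable (fun r => c' r / (c r - z)) volume a b →
      ∫ s in a..b, F (c s) * c' s / (c s - z) =
      (∫ s in a..b, dslope F z (c s) * c' s) + F z * ∫ s in a..b, c' s / (c s - z) := by
    intro z hz hne hi
    have hd : IntervalIntegrable (fun s => dslope F z (c s) * c' s) volume a b := by
      refine ContinuousOn.intervalIntegrable ?_
      rw [uIcc_of_le h.lt.le]
      refine ContinuousOn.mul ?_ h.cont
      exact ((Complex.differentiableOn_dslope (Metric.isOpen_ball.mem_nhds hz)).2
        hF).continuousOn.comp h.continuousOn hcB
    rw [← intervalIntegral.integral_const_mul, ← intervalIntegral.integral_add hd (hi.const_mul _)]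
    refine intervalIntegral.integral_congr fun s hs => ?_
    rw [uIcc_of_le h.lt.le] at hs
    have h1 := hne s hs
    simp only [dslope_of_ne F h1, slope_def_field]
    have : c s - z ≠ 0 := sub_ne_zero.2 h1
    field_simp; ring
  have hne : ∀ z, OnRight c e a b z → ∀ s ∈ Icc a b, c s ≠ z := fun z hz s hs h0 => by
    have := Complex.slitPlane_ne_zero (h.mem_slitPlane hz hs)
    simp [h0] at this
  have hne' : ∀ z, OnLeft c e a b z → ∀ s ∈ Icc a b, c s ≠ z := fun z hz s hs h0 => by
    have := Complex.slitPlane_ne_zero (h.reverse.mem_slitPlane ((onLeft_iff_reverse z).1 hz)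
      (r := -s) ⟨by linarith [hs.2], by linarith [hs.1]⟩)
    simp [h0] at this
  intro z hz
  refine ⟨fun hr => ?_, fun hl => ?_⟩
  · have := h.integral_of_onRight hr
    rw [key z hz.1 (hne z hr) this.1, this.2]; ring
  · have := h.integral_of_onLeft hl hz.2
    rw [key z hz.1 (hne' z hl) this.1, this.2]; ring

end NearlyStraight

/-- Near the diagonal, strict differentiability with nonzero derivative bounds chords from below;
away from it, injectivity does. Compactness of the square combines the local constants. -/
theorem exists_chord_bound {α : ℝ → ℂ} (hα : ContDiff ℝ 1 α) (hinj : Function.Injective α)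
    (hd : ∀ x, deriv α x ≠ 0) (a b : ℝ) :
    ∃ κ > 0, ∀ s ∈ Icc a b, ∀ t ∈ Icc a b, κ * |s - t| ≤ ‖α s - α t‖ := by
  have hK : IsCompact (Icc a b ×ˢ Icc a b) := isCompact_Icc.prod isCompact_Icc
  obtain ⟨κ, hκ, H⟩ : ∃ κ > 0, ∀ q ∈ Icc a b ×ˢ Icc a b,
      κ * |q.1 - q.2| ≤ ‖α q.1 - α q.2‖ := by
    refine hK.induction_on (p := fun S => ∃ κ > 0, ∀ q ∈ S, κ * |q.1 - q.2| ≤ ‖α q.1 - α q.2‖)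
      ⟨1, one_pos, by simp⟩ ?_ ?_ ?_
    · rintro S T hST ⟨κ, hκ, H⟩
      exact ⟨κ, hκ, fun q hq => H q (hST hq)⟩
    · rintro S T ⟨κ, hκ, H⟩ ⟨κ', hκ', H'⟩
      refine ⟨min κ κ', lt_min hκ hκ', ?_⟩
      rintro q (hq | hq)
      · exact (mul_le_mul_of_nonneg_right (min_le_left _ _) (abs_nonneg _)).trans (H q hq)
      · exact (mul_le_mul_of_nonneg_right (min_le_right _ _) (abs_nonneg _)).trans (H' q hq)
    · rintro ⟨s, t⟩ -
      rcases eq_or_ne s t with rfl | hst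
      · have hs := (hα.contDiffAt (x := s)).hasStrictDerivAt (by norm_num)
        have h0 : 0 < ‖deriv α s‖ / 2 := by have := norm_pos_iff.2 (hd s); positivity
        have := hs.isLittleO.def h0
        refine ⟨_, mem_nhdsWithin_of_mem_nhds this, ‖deriv α s‖ / 2, h0, ?_⟩
        rintro ⟨x, y⟩ hq
        simp only [mem_ofPred_eq, ContinuousLinearMap.toSpanSingleton_apply] at hq
        have h1 : ‖(x - y) • deriv α s‖ = |x - y| * ‖deriv α s‖ := by
          rw [norm_smul, Real.norm_eq_abs]
        have h2 : ‖(x - y) • deriv α s‖ ≤ ‖α x - α y‖ + ‖α x - α y - (x - y) • deriv α s‖ := by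
          have := norm_sub_le (α x - α y) (α x - α y - (x - y) • deriv α s)
          simpa using this
        rw [Real.norm_eq_abs] at hq
        simp only
        linarith
      · set f : ℝ × ℝ → ℝ := fun q => ‖α q.1 - α q.2‖ with hf
        have hfc : Continuous f := by
          have := hα.continuous
          fun_prop
        have hpos : 0 < f (s, t) := norm_pos_iff.2 (sub_ne_zero.2 fun h => hst (hinj h))
        set L := |s - t| + 1 with hL
        have hLp : 0 < L := by positivity
        have e1 : ∀ᶠ q in 𝓝 (s, t), f (s, t) / 2 < f q :=
          hfc.continuousAt.eventually (lt_mem_nhds (by linarith))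
        have e2 : ∀ᶠ q : ℝ × ℝ in 𝓝 (s, t), |q.1 - q.2| < L := by
          have : Continuous fun q : ℝ × ℝ => |q.1 - q.2| := by fun_prop
          exact this.continuousAt.eventually (gt_mem_nhds (by simp [hL]))
        refine ⟨_, mem_nhdsWithin_of_mem_nhds (e1.and e2), f (s, t) / 2 / L, by positivity, ?_⟩
        rintro q ⟨h1, h2⟩
        calc f (s, t) / 2 / L * |q.1 - q.2| ≤ f (s, t) / 2 / L * L := by gcongr
          _ = f (s, t) / 2 := by field_simp
          _ ≤ ‖α q.1 - α q.2‖ := h1.le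
  exact ⟨κ, hκ, fun s hs t ht => H (s, t) ⟨hs, ht⟩⟩

theorem exists_nearlyStraight {β : ℝ → ℂ} (hβ : ContDiff ℝ 1 β) {s₀ : ℝ} (hs₀ : deriv β s₀ ≠ 0) :
    ∃ δ > 0, ∀ a b, s₀ - δ ≤ a → a < b → b ≤ s₀ + δ →
      NearlyStraight β (deriv β) (deriv β s₀) a b := by
  have hc : Continuous (deriv β) := hβ.continuous_deriv le_rfl
  have h1 : Continuous fun r => ‖deriv β r / deriv β s₀ - 1‖ := by fun_prop
  have h2 : ∀ᶠ r in 𝓝 s₀, ‖deriv β r / deriv β s₀ - 1‖ < 1 / 10 :=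
    h1.continuousAt.eventually (gt_mem_nhds (by simp [hs₀]))
  obtain ⟨δ, hδ, H⟩ := Metric.eventually_nhds_iff.1 h2
  refine ⟨δ / 2, by positivity, fun a b ha hab hb => ⟨hab, hs₀, fun r _ =>
    ((hβ.differentiable (by norm_num)) r).hasDerivAt, hc.continuousOn, fun r hr => (H ?_).le⟩⟩
  rw [Real.dist_eq, abs_lt]
  constructor <;> linarith [hr.1, hr.2]

/-! ### A logarithm attached to an arc, and analytic continuation across an arc. -/

/-- The continuous branch of `log ((z - β a)/(z - β b))` off the arc `β [a, b]`. -/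
noncomputable def logRatio (β : ℝ → ℂ) (a b : ℝ) (z : ℂ) : ℂ :=
  ∫ s in a..b, deriv β s / (z - β s)

section logRatio

variable {β : ℝ → ℂ} {a b : ℝ} {z : ℂ}

theorem intervalIntegrable_logRatio (hβ : ContDiff ℝ 1 β) (hab : a ≤ b) (hz : z ∉ β '' Icc a b) :
    IntervalIntegrable (fun s => deriv β s / (z - β s)) volume a b := by
  refine ContinuousOn.intervalIntegrable ?_
  rw [uIcc_of_le hab]
  exact (hβ.continuous_deriv le_rfl).continuousOn.div
    (continuousOn_const.sub hβ.continuous.continuousOn) fun s hs h => hz ⟨s, hs, (sub_eq_zero.1 h).symm⟩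

theorem logRatio_add {d : ℝ} (hβ : ContDiff ℝ 1 β) (hab : a ≤ b) (hbd : b ≤ d)
    (hz : z ∉ β '' Icc a d) : logRatio β a d z = logRatio β a b z + logRatio β b d z := by
  refine (intervalIntegral.integral_add_adjacent_intervals
    (intervalIntegrable_logRatio hβ hab fun h => hz ?_)
    (intervalIntegrable_logRatio hβ hbd fun h => hz ?_)).symm
  · exact image_mono (Icc_subset_Icc le_rfl hbd) h
  · exact image_mono (Icc_subset_Icc hab le_rfl) h

theorem continuousOn_logRatio_left (hβ : ContDiff ℝ 1 β) (hab : a ≤ b) (hz : z ∉ β '' Icc a b) :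
    ContinuousOn (fun s => logRatio β s b z) (Icc a b) := by
  have h := intervalIntegrable_logRatio hβ hab hz
  have := intervalIntegral.continuousOn_primitive_interval_left
    (f := fun s => deriv β s / (z - β s)) (a := a) (b := b) (μ := volume)
    (by rw [uIcc_of_le hab, integrableOn_Icc_iff_integrableOn_Ioc]
        exact (intervalIntegrable_iff_integrableOn_Ioc_of_le hab).1 h)
  rwa [uIcc_of_le hab] at this

/-- The product of `z - β s` and the exponential of the integral up to `s` has zero derivative in
`s`. No branch of the logarithm has to be chosen. -/
theorem exp_logRatio (hβ : ContDiff ℝ 1 β) (hab : a ≤ b) (hz : z ∉ β '' Icc a b) :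
    Complex.exp (logRatio β a b z) = (z - β a) / (z - β b) := by
  have hne : ∀ s ∈ Icc a b, z - β s ≠ 0 := fun s hs h => hz ⟨s, hs, (sub_eq_zero.1 h).symm⟩
  have hint := intervalIntegrable_logRatio hβ hab hz
  have hcs : ContinuousOn (fun s => deriv β s / (z - β s)) (Icc a b) :=
    (hβ.continuous_deriv le_rfl).continuousOn.div
      (continuousOn_const.sub hβ.continuous.continuousOn) hne
  have key : ∀ s ∈ Icc a b, (z - β s) * Complex.exp (logRatio β a s z) =
      (z - β a) * Complex.exp (logRatio β a a z) := by
    refine constant_of_has_deriv_right_zero ?_ ?_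
    · refine ContinuousOn.mul (continuousOn_const.sub hβ.continuous.continuousOn) ?_
      refine ContinuousOn.cexp ?_
      have := intervalIntegral.continuousOn_primitive_interval
        (f := fun s => deriv β s / (z - β s)) (a := a) (b := b) (μ := volume)
        (by rw [uIcc_of_le hab, integrableOn_Icc_iff_integrableOn_Ioc]
            exact (intervalIntegrable_iff_integrableOn_Ioc_of_le hab).1 hint)
      rwa [uIcc_of_le hab] at this
    · intro s hs
      have hsI := Ico_subset_Icc_self hs
      have h1 : HasDerivWithinAt (fun u => logRatio β a u z) (deriv β s / (z - β s)) (Ici s) s := by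
        have hi : IntervalIntegrable (fun s => deriv β s / (z - β s)) volume a s :=
          intervalIntegrable_logRatio hβ hs.1 fun h =>
            hz (image_mono (Icc_subset_Icc le_rfl hsI.2) h)
        refine intervalIntegral.integral_hasDerivWithinAt_right hi (t := Ioi s) ?_ ?_
        · refine ⟨Ioc s b, mem_nhdsWithin.2 ⟨Iio b, isOpen_Iio, hs.2, fun x hx => ⟨hx.2, hx.1.le⟩⟩, ?_⟩
          exact (hcs.mono fun x hx => ⟨hs.1.trans hx.1.le, hx.2⟩).aestronglyMeasurable measurableSet_Ioc
        · exact (hcs s hsI).mono_of_mem_nhdsWithin (mem_nhdsWithin.2 ⟨Iio b, isOpen_Iio, hs.2,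
            fun x hx => ⟨hs.1.trans (le_of_lt hx.2), le_of_lt hx.1⟩⟩)
      have h2 : HasDerivWithinAt (fun u => z - β u) (-deriv β s) (Ici s) s :=
        ((hβ.differentiable (by norm_num) s).hasDerivAt.const_sub z).hasDerivWithinAt
      have h3 := h2.mul h1.cexp
      refine h3.congr_deriv ?_
      have := hne s hsI
      field_simp
      ring
  have h := key b ⟨hab, le_rfl⟩
  rw [logRatio, logRatio, intervalIntegral.integral_same, Complex.exp_zero, mul_one] at h
  rw [logRatio, eq_div_iff (hne b ⟨hab, le_rfl⟩), mul_comm]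
  exact h

theorem differentiableOn_logRatio (hβ : ContDiff ℝ 1 β) (hab : a ≤ b) :
    DifferentiableOn ℂ (logRatio β a b) (β '' Icc a b)ᶜ := by
  have h := differentiableOn_cauchyIntegral (c := β) (p := fun s => -deriv β s) hab
    hβ.continuous.continuousOn ((hβ.continuous_deriv le_rfl).neg.intervalIntegrable a b)
  refine h.congr fun z hz => intervalIntegral.integral_congr fun s _ => ?_
  rw [← neg_sub (β s) z, div_neg, neg_div]

end logRatio

/-- Analytic continuation across a closed set with dense complement. -/
theorem exists_differentiableOn_extension {K U : Set ℂ} (hK : IsClosed K) (hKd : Dense Kᶜ)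
    (hU : IsOpen U) {D : ℂ → ℂ} (hD : DifferentiableOn ℂ D (U \ K))
    (hloc : ∀ p ∈ U ∩ K, ∃ R > 0, ∃ G : ℂ → ℂ, DifferentiableOn ℂ G (Metric.ball p R) ∧
      ∀ z ∈ Metric.ball p R \ K, D z = G z) :
    ∃ G : ℂ → ℂ, DifferentiableOn ℂ G U ∧ ∀ z ∈ U \ K, G z = D z := by
  have hne : ∀ z : ℂ, (𝓝[Kᶜ] z).NeBot := fun z => mem_closure_iff_nhdsWithin_neBot.1 (hKd z)
  -- Defining the extension by limits through the dense complement makes all local extensions agree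
  -- with it, so no gluing argument is needed.
  refine ⟨fun z => limUnder (𝓝[Kᶜ] z) D, fun z hz => ?_, fun z hz => ?_⟩
  · have hG : ∃ V ∈ 𝓝 z, IsOpen V ∧ ∃ G : ℂ → ℂ, DifferentiableOn ℂ G V ∧ ∀ w ∈ V \ K, D w = G w := by
      by_cases hzK : z ∈ K
      · obtain ⟨R, hR, G, hG, H⟩ := hloc z ⟨hz, hzK⟩
        exact ⟨_, Metric.ball_mem_nhds z hR, Metric.isOpen_ball, G, hG, H⟩
      · exact ⟨U \ K, (hU.sdiff hK).mem_nhds ⟨hz, hzK⟩, hU.sdiff hK, D, hD, fun w _ => rfl⟩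
    obtain ⟨V, hV, hVo, G, hG, H⟩ := hG
    have heq : ∀ w ∈ V, limUnder (𝓝[Kᶜ] w) D = G w := fun w hw => by
      have := hne w
      refine Tendsto.limUnder_eq ?_
      have h1 : Tendsto G (𝓝[Kᶜ] w) (𝓝 (G w)) :=
        ((hG w hw).differentiableAt (hVo.mem_nhds hw)).continuousAt.mono_left nhdsWithin_le_nhds
      refine h1.congr' ?_
      filter_upwards [mem_nhdsWithin_of_mem_nhds (hVo.mem_nhds hw), self_mem_nhdsWithin] with x hx hxK
      exact (H x ⟨hx, hxK⟩).symm
    have := (hG z (mem_of_mem_nhds hV)).differentiableAt hV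
    exact (this.congr_of_eventuallyEq (by filter_upwards [hV] with w hw using heq w hw)).differentiableWithinAt
  · have := hne z
    refine Tendsto.limUnder_eq ?_
    exact ((hD z hz).differentiableAt ((hU.sdiff hK).mem_nhds hz)).continuousAt.mono_left
      nhdsWithin_le_nhds

theorem OnRight.mono {c : ℝ → ℂ} {e : ℂ} {a b a' b' : ℝ} {z : ℂ} (h : OnRight c e a b z)
    (ha : a' ≤ a) (hb : b ≤ b') : OnRight c e a' b' z := by
  obtain ⟨r, hr, y, hy, h0⟩ := h
  exact ⟨r, ⟨ha.trans hr.1, hr.2.trans hb⟩, y, hy, h0⟩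

theorem OnLeft.mono {c : ℝ → ℂ} {e : ℂ} {a b a' b' : ℝ} {z : ℂ} (h : OnLeft c e a b z)
    (ha : a' ≤ a) (hb : b ≤ b') : OnLeft c e a' b' z := by
  obtain ⟨r, hr, y, hy, h0⟩ := h
  exact ⟨r, ⟨ha.trans hr.1, hr.2.trans hb⟩, y, hy, h0⟩

namespace NearlyStraight

variable {c c' : ℝ → ℂ} {e : ℂ} {a b : ℝ}

theorem mono (h : NearlyStraight c c' e a b) {a' b' : ℝ} (ha : a ≤ a') (hab : a' < b')
    (hb : b' ≤ b) : NearlyStraight c c' e a' b' :=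
  ⟨hab, h.ne, fun r hr => h.deriv r ⟨ha.trans hr.1, hr.2.trans hb⟩,
    h.cont.mono (Icc_subset_Icc ha hb), fun r hr => h.near r ⟨ha.trans hr.1, hr.2.trans hb⟩⟩

theorem notMem_of_onRight (h : NearlyStraight c c' e a b) {z : ℂ} (hz : OnRight c e a b z) :
    z ∉ c '' Icc a b := by
  rintro ⟨s, hs, rfl⟩
  have := Complex.slitPlane_ne_zero (h.mem_slitPlane hz hs)
  simp at this

theorem notMem_of_onLeft (h : NearlyStraight c c' e a b) {z : ℂ} (hz : OnLeft c e a b z) :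
    z ∉ c '' Icc a b := by
  rintro ⟨s, hs, rfl⟩
  exact h.reverse.notMem_of_onRight ((onLeft_iff_reverse _).1 hz)
    ⟨-s, ⟨by linarith [hs.2], by linarith [hs.1]⟩, by simp⟩

theorem mem_crossStrip (h : NearlyStraight c c' e a b) {s : ℝ} (hs : s ∈ Ioo a b) :
    c s ∈ crossStrip c e a b := by
  have h1 := abs_le.1 (h.re_sub (left_mem_Icc.2 h.lt.le) (Ioo_subset_Icc_self hs))
  have h2 := abs_le.1 (h.re_sub (right_mem_Icc.2 h.lt.le) (Ioo_subset_Icc_self hs))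
  rw [abs_of_neg (by linarith [hs.1])] at h1
  rw [abs_of_pos (by linarith [hs.2])] at h2
  constructor <;> linarith [hs.1, hs.2]

end NearlyStraight

/-! ### The square root cut along an arc and its boundary values. -/

/-- A `C¹` regular simple curve. -/
structure RegularArc (β : ℝ → ℂ) : Prop where
  contDiff : ContDiff ℝ 1 β
  inj : Function.Injective β
  deriv_ne : ∀ x, deriv β x ≠ 0

/-- The branch of `√((z - β a)(z - β b))` which is analytic off the arc `β [a, b]` and `∼ z`. -/
noncomputable def arcSqrt (β : ℝ → ℂ) (a b : ℝ) (z : ℂ) : ℂ :=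
  (z - β b) * Complex.exp (logRatio β a b z / 2)

/-- Directions pointing to the right of the direction `1`, within an angle `π/4` of `-I`. -/
def rightSector : Set ℂ := {w | w.im < 0 ∧ |w.re| ≤ -w.im}

/-- The boundary value of `arcSqrt` from the right of the arc. -/
noncomputable def rightSqrt (β : ℝ → ℂ) (a b s : ℝ) : ℂ :=
  limUnder (𝓝[rightSector] 0) fun w => arcSqrt β a b (β s + w * deriv β s)

theorem tendsto_rightSector {d : ℝ} (hd : 0 < d) :
    Tendsto (fun ε : ℝ => -(ε * d : ℝ) * Complex.I) (𝓝[>] 0) (𝓝[rightSector] 0) := by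
  refine tendsto_nhdsWithin_iff.2 ⟨?_, ?_⟩
  · have : Continuous fun ε : ℝ => -(ε * d : ℝ) * Complex.I := by fun_prop
    have h := this.tendsto 0
    simp only [zero_mul, Complex.ofReal_zero, neg_zero] at h
    exact h.mono_left nhdsWithin_le_nhds
  · filter_upwards [self_mem_nhdsWithin] with ε hε
    have hε' : (0 : ℝ) < ε := hε
    constructor <;> simp [hd, hd.le, hε']

instance neBot_rightSector : (𝓝[rightSector] (0 : ℂ)).NeBot :=
  (tendsto_rightSector one_pos).neBot

theorem logRatio_eq_neg (β : ℝ → ℂ) (a b : ℝ) (z : ℂ) :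
    logRatio β a b z = -∫ s in a..b, deriv β s / (β s - z) := by
  rw [logRatio, ← intervalIntegral.integral_neg]
  refine intervalIntegral.integral_congr fun s _ => ?_
  rw [← neg_sub (β s) z, div_neg]

theorem logRatio_reverse (β : ℝ → ℂ) (a b : ℝ) (z : ℂ) :
    logRatio (fun s => β (-s)) (-b) (-a) z = -logRatio β a b z := by
  have hd : ∀ s, deriv (fun s => β (-s)) s = -deriv β (-s) := fun s => deriv_comp_neg β s
  simp only [logRatio, hd]
  rw [intervalIntegral.integral_comp_neg (fun s => -deriv β s / (z - β s)), neg_neg, neg_neg,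
    ← intervalIntegral.integral_neg]
  exact intervalIntegral.integral_congr fun s _ => by ring

namespace RegularArc

variable {β : ℝ → ℂ} {a b : ℝ} {z : ℂ}

theorem reverse (h : RegularArc β) : RegularArc fun s => β (-s) where
  contDiff := h.contDiff.comp contDiff_neg
  inj := h.inj.comp neg_injective
  deriv_ne x := by rw [deriv_comp_neg]; exact neg_ne_zero.2 (h.deriv_ne _)

theorem differentiableOn_arcSqrt (h : RegularArc β) (hab : a ≤ b) :
    DifferentiableOn ℂ (arcSqrt β a b) (β '' Icc a b)ᶜ :=
  (differentiableOn_id.sub_const _).mul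
    ((differentiableOn_logRatio h.contDiff hab).div_const 2).cexp

theorem isClosed_image (h : RegularArc β) (a b : ℝ) : IsClosed (β '' Icc a b) :=
  (isCompact_Icc.image h.contDiff.continuous).isClosed

theorem dense_compl_image (h : RegularArc β) (a b : ℝ) : Dense (β '' Icc a b)ᶜ :=
  (h.contDiff.dense_compl_range_of_finrank_lt_finrank (by simp)).mono
    (compl_subset_compl.2 (image_subset_range _ _))

theorem arcSqrt_sq (h : RegularArc β) (hab : a ≤ b) (hz : z ∉ β '' Icc a b) :
    arcSqrt β a b z ^ 2 = (z - β a) * (z - β b) := by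
  have h1 : z - β b ≠ 0 := fun h0 => hz ⟨b, right_mem_Icc.2 hab, (sub_eq_zero.1 h0).symm⟩
  rw [arcSqrt, mul_pow, ← Complex.exp_nat_mul]
  have : ((2 : ℕ) : ℂ) * (logRatio β a b z / 2) = logRatio β a b z := by push_cast; ring
  rw [this, exp_logRatio h.contDiff hab hz]
  field_simp

/-- The definition treats the two end points differently only in appearance: by `exp_logRatio`,
exchanging them replaces `(z - β b) e^{l/2}` by `(z - β a) e^{-l/2}`, which is the same number.
Statements at `β b` thus follow from those at `β a`. -/
theorem arcSqrt_reverse (h : RegularArc β) (hab : a ≤ b) (hz : z ∉ β '' Icc a b) :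
    arcSqrt (fun s => β (-s)) (-b) (-a) z = arcSqrt β a b z := by
  have h1 : z - β b ≠ 0 := fun h0 => hz ⟨b, right_mem_Icc.2 hab, (sub_eq_zero.1 h0).symm⟩
  have h2 := exp_logRatio h.contDiff hab hz
  rw [show logRatio β a b z = logRatio β a b z / 2 + logRatio β a b z / 2 by ring, Complex.exp_add,
    eq_div_iff h1] at h2
  rw [arcSqrt, arcSqrt, logRatio_reverse, neg_neg, neg_div, Complex.exp_neg]
  have := Complex.exp_ne_zero (logRatio β a b z / 2)
  field_simp
  linear_combination -h2

/-- Near an interior point of the arc, `arcSqrt` is `±` an analytic function on the two sides. -/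
theorem exists_local_sqrt (h : RegularArc β) {s₀ : ℝ} (hs₀ : s₀ ∈ Ioo a b) :
    ∃ R > 0, ∃ a' b', a ≤ a' ∧ b' ≤ b ∧ s₀ ∈ Ioo a' b' ∧
      NearlyStraight β (deriv β) (deriv β s₀) a' b' ∧
      Metric.ball (β s₀) R ⊆ crossStrip β (deriv β s₀) a' b' ∧
      ∃ N : ℂ → ℂ, DifferentiableOn ℂ N (Metric.ball (β s₀) R) ∧
        (∀ z ∈ Metric.ball (β s₀) R, N z ^ 2 = (z - β a) * (z - β b) ∧ N z ≠ 0) ∧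
        (∀ z ∈ Metric.ball (β s₀) R,
          (OnRight β (deriv β s₀) a' b' z → z ∉ β '' Icc a b ∧ arcSqrt β a b z = N z) ∧
          (OnLeft β (deriv β s₀) a' b' z → z ∉ β '' Icc a b ∧ arcSqrt β a b z = -N z)) := by
  obtain ⟨δ, hδ, hns⟩ := exists_nearlyStraight h.contDiff (h.deriv_ne s₀)
  set a' := max a (s₀ - δ) with ha'
  set b' := min b (s₀ + δ) with hb'
  have h1 : a' < s₀ := max_lt hs₀.1 (by linarith)
  have h2 : s₀ < b' := lt_min hs₀.2 (by linarith)
  have haa : a ≤ a' := le_max_left _ _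
  have hbb : b' ≤ b := min_le_left _ _
  have hst := hns a' b' (le_max_right _ _) (h1.trans h2) (min_le_right _ _)
  set e := deriv β s₀ with he
  set V : Set ℂ := crossStrip β e a' b' ∩ ((β '' Icc a a')ᶜ ∩ (β '' Icc b' b)ᶜ) with hV
  have hVo : IsOpen V := (isOpen_crossStrip _ _ _ _).inter
    ((h.isClosed_image _ _).isOpen_compl.inter (h.isClosed_image _ _).isOpen_compl)
  have hsV : β s₀ ∈ V := by
    refine ⟨hst.mem_crossStrip ⟨h1, h2⟩, ?_, ?_⟩
    · rintro ⟨s, hs, hs'⟩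
      rw [h.inj hs'] at hs; linarith [hs.2]
    · rintro ⟨s, hs, hs'⟩
      rw [h.inj hs'] at hs; linarith [hs.1]
  obtain ⟨R, hR, hRV⟩ := Metric.isOpen_iff.1 hVo _ hsV
  have hcov : ∀ z, z ∈ V → z ∉ β '' Icc a' b' → z ∉ β '' Icc a b := by
    rintro z hz hz' ⟨s, hs, rfl⟩
    rcases le_or_gt s a' with h3 | h3
    · exact hz.2.1 ⟨s, ⟨hs.1, h3⟩, rfl⟩
    rcases le_or_gt b' s with h4 | h4
    · exact hz.2.2 ⟨s, ⟨h4, hs.2⟩, rfl⟩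
    · exact hz' ⟨s, ⟨h3.le, h4.le⟩, rfl⟩
  -- The middle piece of `logRatio` is `-(logJump - πi)` on the right and `-(logJump + πi)` on the
  -- left. Halved and exponentiated, the constants give factors `I` and `-I`, so the two sides carry
  -- `N` and `-N`.
  set N : ℂ → ℂ := fun z => (z - β b) * Complex.exp ((logRatio β a a' z + logRatio β b' b z
    - logJump β e a' b' z) / 2) * Complex.I with hN
  have hsplit : ∀ z, z ∉ β '' Icc a b → logRatio β a b z =
      logRatio β a a' z + logRatio β b' b z - ∫ s in a'..b', deriv β s / (β s - z) := by
    intro z hz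
    rw [logRatio_add h.contDiff haa ((h1.trans h2).le.trans hbb) hz,
      logRatio_add h.contDiff (h1.trans h2).le hbb
        (fun h => hz (image_mono (Icc_subset_Icc haa le_rfl) h)), logRatio_eq_neg β a' b']
    ring
  have hexp : ∀ x : ℂ, Complex.exp (x / 2 + Real.pi * Complex.I / 2) =
      Complex.exp (x / 2) * Complex.I := fun x => by
    rw [Complex.exp_add, show (Real.pi : ℂ) * Complex.I / 2 = Real.pi / 2 * Complex.I by ring,
      Complex.exp_pi_div_two_mul_I]
  refine ⟨R, hR, a', b', haa, hbb, ⟨h1, h2⟩, hst, hRV.trans inter_subset_left, N, ?_, ?_, ?_⟩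
  · have d1 := (differentiableOn_logRatio h.contDiff haa).mono
      (hRV.trans (inter_subset_right.trans inter_subset_left))
    have d2 := (differentiableOn_logRatio h.contDiff hbb).mono
      (hRV.trans (inter_subset_right.trans inter_subset_right))
    have d3 := (differentiableOn_logJump β e a' b').mono (hRV.trans inter_subset_left)
    exact ((differentiableOn_id.sub_const _).mul (((d1.add d2).sub d3).div_const 2).cexp).mul_const _
  · intro z hz
    have hzV := hRV hz
    have n1 : z - β b ≠ 0 := fun h0 => hzV.2.2 ⟨b, right_mem_Icc.2 hbb, (sub_eq_zero.1 h0).symm⟩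
    have n2 : z - β b' ≠ 0 := fun h0 => hzV.2.2 ⟨b', left_mem_Icc.2 hbb, (sub_eq_zero.1 h0).symm⟩
    have n3 : z - β a' ≠ 0 := fun h0 => hzV.2.1 ⟨a', right_mem_Icc.2 haa, (sub_eq_zero.1 h0).symm⟩
    have n4 : z - β a ≠ 0 := fun h0 => hzV.2.1 ⟨a, left_mem_Icc.2 haa, (sub_eq_zero.1 h0).symm⟩
    have hsq : N z ^ 2 = (z - β a) * (z - β b) := by
      have x1 := exp_logRatio h.contDiff haa hzV.2.1
      have x2 := exp_logRatio h.contDiff hbb hzV.2.2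
      have x3 : Complex.exp (logJump β e a' b' z) = -((z - β b') / (z - β a')) := by
        have y1 : ∀ s, z - β s ≠ 0 → -Complex.I * ((β s - z) / e) ≠ 0 := fun s hs =>
          mul_ne_zero (neg_ne_zero.2 Complex.I_ne_zero)
            (div_ne_zero (by rw [← neg_sub]; exact neg_ne_zero.2 hs) hst.ne)
        rw [logJump, Complex.exp_add, Complex.exp_sub, Complex.exp_log (y1 _ n2),
          Complex.exp_log (y1 _ n3), Complex.exp_pi_mul_I,
          mul_div_mul_left _ _ (neg_ne_zero.2 Complex.I_ne_zero),
          div_div_div_cancel_right₀ hst.ne, ← neg_sub z, ← neg_sub z, neg_div_neg_eq]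
        ring
      rw [hN]
      simp only [mul_pow, Complex.I_sq, ← Complex.exp_nat_mul]
      rw [show ((2 : ℕ) : ℂ) * ((logRatio β a a' z + logRatio β b' b z - logJump β e a' b' z) / 2)
        = logRatio β a a' z + logRatio β b' b z - logJump β e a' b' z by push_cast; ring,
        Complex.exp_sub, Complex.exp_add, x1, x2, x3]
      field_simp
    refine ⟨hsq, fun h0 => ?_⟩
    rw [h0] at hsq
    simp [n1, n4] at hsq
  · intro z hz
    have hzV := hRV hz
    refine ⟨fun hr => ?_, fun hl => ?_⟩
    · have hzn := hcov z hzV (hst.notMem_of_onRight hr)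
      refine ⟨hzn, ?_⟩
      rw [arcSqrt, hsplit z hzn, (hst.integral_of_onRight hr).2, hN]
      simp only
      rw [mul_assoc, ← hexp]
      congr 2; ring
    · have hzn := hcov z hzV (hst.notMem_of_onLeft hl)
      refine ⟨hzn, ?_⟩
      rw [arcSqrt, hsplit z hzn, (hst.integral_of_onLeft hl hzV.1).2, hN]
      simp only
      rw [mul_assoc, ← hexp, show (logRatio β a a' z + logRatio β b' b z -
        logJump β e a' b' z) / 2 + Real.pi * Complex.I / 2 = (logRatio β a a' z +
        logRatio β b' b z - (logJump β e a' b' z + Real.pi * Complex.I)) / 2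
          + Real.pi * Complex.I by ring, Complex.exp_add, Complex.exp_pi_mul_I]
      ring

/-- The boundary values of `arcSqrt` on the two sides are given locally by an analytic function. -/
theorem exists_boundary (h : RegularArc β) {s₀ : ℝ} (hs₀ : s₀ ∈ Ioo a b) :
    ∃ R > 0, ∃ a' b', a ≤ a' ∧ b' ≤ b ∧ s₀ ∈ Ioo a' b' ∧
      NearlyStraight β (deriv β) (deriv β s₀) a' b' ∧
      ∃ N : ℂ → ℂ, DifferentiableOn ℂ N (Metric.ball (β s₀) R) ∧
        (∀ z ∈ Metric.ball (β s₀) R, N z ^ 2 = (z - β a) * (z - β b) ∧ N z ≠ 0) ∧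
        (∀ z ∈ Metric.ball (β s₀) R,
          (OnRight β (deriv β s₀) a' b' z → z ∉ β '' Icc a b ∧ arcSqrt β a b z = N z) ∧
          (OnLeft β (deriv β s₀) a' b' z → z ∉ β '' Icc a b ∧ arcSqrt β a b z = -N z)) ∧
        ∀ s ∈ Ioo a' b', β s ∈ Metric.ball (β s₀) R →
          rightSqrt β a b s = N (β s) ∧
          Tendsto (fun w => arcSqrt β a b (β s + w * deriv β s)) (𝓝[rightSector] 0) (𝓝 (N (β s))) ∧
          Tendsto (fun w => arcSqrt β a b (β s - w * deriv β s)) (𝓝[rightSector] 0)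
            (𝓝 (-N (β s))) ∧
          ∀ᶠ w in 𝓝[rightSector] 0, β s + w * deriv β s ∉ β '' Icc a b := by
  obtain ⟨R, hR, a', b', ha, hb, hs, hst, -, N, hNd, hNsq, hN⟩ := h.exists_local_sqrt hs₀
  refine ⟨R, hR, a', b', ha, hb, hs, hst, N, hNd, hNsq, hN, fun s hs hsR => ?_⟩
  have hNc : ContinuousAt N (β s) :=
    (hNd.differentiableAt (Metric.isOpen_ball.mem_nhds hsR)).continuousAt
  have t1 : Tendsto (fun w => β s + w * deriv β s) (𝓝[rightSector] 0) (𝓝 (β s)) := by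
    have : Continuous fun w => β s + w * deriv β s := by fun_prop
    have h := this.tendsto 0
    simp only [zero_mul, add_zero] at h
    exact h.mono_left nhdsWithin_le_nhds
  have t2 : Tendsto (fun w => β s - w * deriv β s) (𝓝[rightSector] 0) (𝓝 (β s)) := by
    have : Continuous fun w => β s - w * deriv β s := by fun_prop
    have h := this.tendsto 0
    simp only [zero_mul, sub_zero] at h
    exact h.mono_left nhdsWithin_le_nhds
  have b1 := t1.eventually (Metric.isOpen_ball.mem_nhds hsR)
  have b2 := t2.eventually (Metric.isOpen_ball.mem_nhds hsR)
  obtain ⟨η, hη, H⟩ := hst.onRight_of_sector hs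
  obtain ⟨η', hη', H'⟩ := hst.onLeft_of_sector hs
  have sm : ∀ η > 0, ∀ᶠ w : ℂ in 𝓝[rightSector] 0, ‖w‖ < η := fun η hη => by
    filter_upwards [mem_nhdsWithin_of_mem_nhds (Metric.ball_mem_nhds (0 : ℂ) hη)] with w hw
    simpa using hw
  have r1 : ∀ᶠ w in 𝓝[rightSector] 0, OnRight β (deriv β s₀) a' b' (β s + w * deriv β s) := by
    filter_upwards [sm η hη, self_mem_nhdsWithin] with w hw hws using H w hw hws.1 hws.2
  have r2 : ∀ᶠ w in 𝓝[rightSector] 0, OnLeft β (deriv β s₀) a' b' (β s - w * deriv β s) := by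
    filter_upwards [sm η' hη', self_mem_nhdsWithin] with w hw hws
    have := H' (-w) (by simpa) (by simpa using hws.1) (by simpa using hws.2)
    rwa [neg_mul, ← sub_eq_add_neg] at this
  have lim1 : Tendsto (fun w => arcSqrt β a b (β s + w * deriv β s)) (𝓝[rightSector] 0)
      (𝓝 (N (β s))) := by
    refine (hNc.tendsto.comp t1).congr' ?_
    filter_upwards [b1, r1] with w hw hr using (((hN _ hw).1 hr).2).symm
  refine ⟨lim1.limUnder_eq, lim1, ?_, ?_⟩
  · refine (hNc.tendsto.comp t2).neg.congr' ?_
    filter_upwards [b2, r2] with w hw hr using (((hN _ hw).2 hr).2).symm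
  · filter_upwards [b1, r1] with w hw hr using ((hN _ hw).1 hr).1

theorem tendsto_rightSqrt (h : RegularArc β) {s : ℝ} (hs : s ∈ Ioo a b) :
    Tendsto (fun w => arcSqrt β a b (β s + w * deriv β s)) (𝓝[rightSector] 0)
      (𝓝 (rightSqrt β a b s)) ∧
    Tendsto (fun w => arcSqrt β a b (β s - w * deriv β s)) (𝓝[rightSector] 0)
      (𝓝 (-rightSqrt β a b s)) ∧
    (∀ᶠ w in 𝓝[rightSector] 0, β s + w * deriv β s ∉ β '' Icc a b) ∧
    rightSqrt β a b s ^ 2 = (β s - β a) * (β s - β b) ∧ rightSqrt β a b s ≠ 0 ∧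
    ContinuousAt (rightSqrt β a b) s := by
  obtain ⟨R, hR, a', b', ha, hb, hs', hst, N, hNd, hNsq, -, H⟩ := h.exists_boundary hs
  have hself := Metric.mem_ball_self (x := β s) hR
  obtain ⟨h1, h2, h3, h4⟩ := H s hs' hself
  have hNc : ContinuousAt N (β s) :=
    (hNd.differentiableAt (Metric.isOpen_ball.mem_nhds hself)).continuousAt
  refine ⟨h1 ▸ h2, h1 ▸ h3, h4, h1 ▸ (hNsq _ hself).1, h1 ▸ (hNsq _ hself).2, ?_⟩
  have : ContinuousAt (fun s => N (β s)) s :=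
    ContinuousAt.comp (f := β) hNc h.contDiff.continuous.continuousAt
  refine this.congr ?_
  filter_upwards [Ioo_mem_nhds hs'.1 hs'.2,
    h.contDiff.continuous.continuousAt.eventually (Metric.ball_mem_nhds _ hR)] with x hx hxR
  exact ((H x hx hxR).1).symm

end RegularArc

/-! ### Removing the jump of a quotient by the arc square root. -/

/-- The function `m / √((z - β a)(z - β b))` corrected by the Cauchy integral of its boundary
values, so as to become analytic across the arc. -/
noncomputable def arcDefect (β : ℝ → ℂ) (a b : ℝ) (m : ℂ → ℂ) (p : ℝ → ℂ) (z : ℂ) : ℂ :=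
  m z / arcSqrt β a b z
    + 1 / (Real.pi * Complex.I) * ∫ s in a..b, p s * deriv β s / (β s - z)

namespace RegularArc

variable {β : ℝ → ℂ} {a b : ℝ} {m : ℂ → ℂ} {p : ℝ → ℂ}

theorem intervalIntegrable_mul_deriv (h : RegularArc β) (hp : IntervalIntegrable p volume a b) :
    IntervalIntegrable (fun s => p s * deriv β s) volume a b :=
  hp.mul_continuousOn (h.contDiff.continuous_deriv le_rfl).continuousOn

theorem intervalIntegrable_cauchy (h : RegularArc β) (hab : a ≤ b)
    (hp : IntervalIntegrable p volume a b) {z : ℂ} (hz : z ∉ β '' Icc a b) :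
    IntervalIntegrable (fun s => p s * deriv β s / (β s - z)) volume a b := by
  simp only [div_eq_mul_inv]
  refine (h.intervalIntegrable_mul_deriv hp).mul_continuousOn ?_
  rw [uIcc_of_le hab]
  exact (h.contDiff.continuous.continuousOn.sub continuousOn_const).inv₀
    fun s hs h0 => hz ⟨s, hs, sub_eq_zero.1 h0⟩

theorem differentiableOn_cauchy (h : RegularArc β) (hab : a ≤ b)
    (hp : IntervalIntegrable p volume a b) :
    DifferentiableOn ℂ (fun z => ∫ s in a..b, p s * deriv β s / (β s - z)) (β '' Icc a b)ᶜ :=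
  differentiableOn_cauchyIntegral hab h.contDiff.continuous.continuousOn
    (h.intervalIntegrable_mul_deriv hp)

theorem differentiableOn_arcDefect (h : RegularArc β) (hab : a ≤ b) {V : Set ℂ}
    (hm : DifferentiableOn ℂ m V) (hp : IntervalIntegrable p volume a b) :
    DifferentiableOn ℂ (arcDefect β a b m p) (V \ β '' Icc a b) := by
  refine DifferentiableOn.add (DifferentiableOn.div (hm.mono sdiff_subset)
    ((h.differentiableOn_arcSqrt hab).mono fun z hz => hz.2) fun z hz h0 => ?_)
    (((h.differentiableOn_cauchy hab hp).mono fun z hz => hz.2).const_mul _)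
  have := h.arcSqrt_sq hab hz.2
  rw [h0, zero_pow two_ne_zero] at this
  rcases mul_eq_zero.1 this.symm with h1 | h1
  · exact hz.2 ⟨a, left_mem_Icc.2 hab, (sub_eq_zero.1 h1).symm⟩
  · exact hz.2 ⟨b, right_mem_Icc.2 hab, (sub_eq_zero.1 h1).symm⟩

/-- The quotient equals `m/N` on the right and `-m/N` on the left, while by Plemelj the added Cauchy
integral contributes `-m/N` and `+m/N`. The jumps cancel and the same analytic function remains on
both sides. -/
theorem arcDefect_extends_interior (h : RegularArc β) {V : Set ℂ} (hV : IsOpen V)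
    (hm : DifferentiableOn ℂ m V) (hp : IntervalIntegrable p volume a b)
    (hpm : ∀ s ∈ Ioo a b, p s = m (β s) / rightSqrt β a b s) {s₀ : ℝ} (hs₀ : s₀ ∈ Ioo a b)
    (hsV : β s₀ ∈ V) :
    ∃ R > 0, ∃ G : ℂ → ℂ, DifferentiableOn ℂ G (Metric.ball (β s₀) R) ∧
      ∀ z ∈ Metric.ball (β s₀) R \ β '' Icc a b, arcDefect β a b m p z = G z := by
  obtain ⟨R, hR, a', b', ha, hb, hs, hst, N, hNd, hNsq, hN, H⟩ := h.exists_boundary hs₀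
  obtain ⟨R₁, hR₁, hRV⟩ := Metric.isOpen_iff.1 (hV.inter Metric.isOpen_ball) _
    ⟨hsV, Metric.mem_ball_self hR⟩
  obtain ⟨δ, hδ, hδR⟩ := Metric.eventually_nhds_iff.1
    (h.contDiff.continuous.continuousAt.eventually (Metric.ball_mem_nhds (β s₀) hR₁))
  obtain ⟨a₂, ha₂, ha₂s⟩ := exists_between (max_lt hs.1 (by linarith : s₀ - δ < s₀))
  obtain ⟨b₂, hb₂s, hb₂⟩ := exists_between (lt_min hs.2 (by linarith : s₀ < s₀ + δ))
  have ha1 := (le_max_left _ _).trans_lt ha₂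
  have ha3 := (le_max_right _ _).trans_lt ha₂
  have hb1 := hb₂.trans_le (min_le_left _ _)
  have hb3 := hb₂.trans_le (min_le_right _ _)
  have hst₂ := hst.mono ha1.le (ha₂s.trans hb₂s) hb1.le
  have hin : ∀ s ∈ Icc a₂ b₂, β s ∈ Metric.ball (β s₀) R₁ := fun s hs => hδR (by
    rw [Real.dist_eq, abs_lt]; constructor <;> linarith [hs.1, hs.2])
  have hF : DifferentiableOn ℂ (fun z => m z / N z) (Metric.ball (β s₀) R₁) :=
    (hm.mono (hRV.trans inter_subset_left)).div (hNd.mono (hRV.trans inter_subset_right))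
      fun z hz => (hNsq z (hRV hz).2).2
  obtain ⟨G, hGd, hG⟩ := hst₂.exists_plemelj hF hin
  have haa : a ≤ a₂ := ha.trans ha1.le
  have hbb : b₂ ≤ b := hb1.le.trans hb
  have hpI : ∀ x y, a ≤ x → x ≤ y → y ≤ b → IntervalIntegrable p volume x y := fun x y h1 h2 h3 =>
    hp.mono_set (by
      rw [uIcc_of_le h2, uIcc_of_le (h1.trans (h2.trans h3))]; exact Icc_subset_Icc h1 h3)
  have i1 := hpI a a₂ le_rfl haa ((ha₂s.trans hb₂s).le.trans hbb)
  have i2 := hpI a₂ b₂ haa (ha₂s.trans hb₂s).le hbb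
  have i3 := hpI b₂ b (haa.trans (ha₂s.trans hb₂s).le) hbb le_rfl
  set W : Set ℂ := (Metric.ball (β s₀) R₁ ∩ crossStrip β (deriv β s₀) a₂ b₂) ∩
    ((β '' Icc a a₂)ᶜ ∩ (β '' Icc b₂ b)ᶜ) with hW
  have hWo : IsOpen W := (Metric.isOpen_ball.inter (isOpen_crossStrip _ _ _ _)).inter
    ((h.isClosed_image _ _).isOpen_compl.inter (h.isClosed_image _ _).isOpen_compl)
  have hsW : β s₀ ∈ W := by
    refine ⟨⟨Metric.mem_ball_self hR₁, hst₂.mem_crossStrip ⟨ha₂s, hb₂s⟩⟩, ?_, ?_⟩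
    · rintro ⟨s, hs, hs'⟩
      rw [h.inj hs'] at hs; linarith [hs.2]
    · rintro ⟨s, hs, hs'⟩
      rw [h.inj hs'] at hs; linarith [hs.1]
  obtain ⟨R₂, hR₂, hRW⟩ := Metric.isOpen_iff.1 hWo _ hsW
  refine ⟨R₂, hR₂, fun z => 1 / (Real.pi * Complex.I) *
    ((∫ s in a..a₂, p s * deriv β s / (β s - z)) + (∫ s in b₂..b, p s * deriv β s / (β s - z))
      + G z), ?_, ?_⟩
  · refine DifferentiableOn.const_mul (DifferentiableOn.add (DifferentiableOn.add ?_ ?_) ?_) _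
    · exact (h.differentiableOn_cauchy haa i1).mono
        (hRW.trans (inter_subset_right.trans inter_subset_left))
    · exact (h.differentiableOn_cauchy hbb i3).mono
        (hRW.trans (inter_subset_right.trans inter_subset_right))
    · exact hGd.mono (hRW.trans inter_subset_left)
  · rintro z ⟨hzR, hzK⟩
    have hzW := hRW hzR
    have hz' : ∀ x y, a ≤ x → y ≤ b → z ∉ β '' Icc x y := fun x y h1 h2 h3 =>
      hzK (image_mono (Icc_subset_Icc h1 h2) h3)
    have hab₂ := (ha₂s.trans hb₂s).le
    have c1 := h.intervalIntegrable_cauchy haa i1 (hz' _ _ le_rfl (hab₂.trans hbb))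
    have c2 := h.intervalIntegrable_cauchy hab₂ i2 (hz' _ _ haa hbb)
    have c3 := h.intervalIntegrable_cauchy hbb i3 (hz' _ _ (haa.trans hab₂) le_rfl)
    have hsplit : ∫ s in a..b, p s * deriv β s / (β s - z) =
        (∫ s in a..a₂, p s * deriv β s / (β s - z)) +
        (∫ s in a₂..b₂, p s * deriv β s / (β s - z)) +
        ∫ s in b₂..b, p s * deriv β s / (β s - z) := by
      rw [intervalIntegral.integral_add_adjacent_intervals c1 c2,
        intervalIntegral.integral_add_adjacent_intervals (c1.trans c2) c3]
    have hmid : ∫ s in a₂..b₂, p s * deriv β s / (β s - z) =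
        ∫ s in a₂..b₂, m (β s) / N (β s) * deriv β s / (β s - z) := by
      refine intervalIntegral.integral_congr fun s hs => ?_
      rw [uIcc_of_le hab₂] at hs
      have hs1 : s ∈ Ioo a' b' := ⟨ha1.trans_le hs.1, hs.2.trans_lt hb1⟩
      simp only [hpm s ⟨ha.trans_lt hs1.1, hs1.2.trans_le hb⟩, (H s hs1 (hRV (hin s hs)).2).1]
    have hpi : (Real.pi : ℂ) * Complex.I ≠ 0 :=
      mul_ne_zero (by exact_mod_cast Real.pi_ne_zero) Complex.I_ne_zero
    have hNz := (hNsq z (hRV hzW.1.1).2).2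
    rw [arcDefect, hsplit, hmid]
    rcases hst₂.onRight_or_onLeft hzW.1.2 (hz' _ _ haa hbb) with hr | hl
    · rw [(hG z hzW.1).1 hr, ((hN z (hRV hzW.1.1).2).1 (hr.mono ha1.le hb1.le)).2]
      field_simp; ring
    · rw [(hG z hzW.1).2 hl, ((hN z (hRV hzW.1.1).2).2 (hl.mono ha1.le hb1.le)).2]
      field_simp; ring

end RegularArc

/-- Divide the difference quotient of the square by `f y + f x`, which tends to `2 f x ≠ 0`. The
field is left general because the lemma serves a real parameter in `exists_sqrtCurve` and a complex
one in `hasDerivAt_kern`. -/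
theorem hasDerivAt_of_sq {𝕜 : Type*} [NontriviallyNormedField 𝕜] [NormedAlgebra 𝕜 ℂ] {f : 𝕜 → ℂ}
    {d : ℂ} {x : 𝕜} (hc : ContinuousAt f x) (h0 : f x ≠ 0)
    (h : HasDerivAt (fun y => f y ^ 2) d x) : HasDerivAt f (d / (2 * f x)) x := by
  rw [hasDerivAt_iff_tendsto_slope] at h ⊢
  have h1 : Tendsto (fun y => f y + f x) (𝓝[≠] x) (𝓝 (2 * f x)) := by
    rw [two_mul]
    exact (hc.tendsto.mono_left nhdsWithin_le_nhds).add_const _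
  have h2 : (2 : ℂ) * f x ≠ 0 := mul_ne_zero two_ne_zero h0
  refine (h.div h1 h2).congr' ?_
  filter_upwards [h1.eventually_ne h2] with y hy
  simp only [Pi.div_apply, slope, vsub_eq_sub]
  rw [div_eq_iff hy, smul_mul_assoc]
  congr 1; ring

/-! ### End points of the arc in a square root coordinate. -/

/-- A square root of `β - β a` along the arc starting at `β a`, continued to an odd curve. -/
structure SqrtCurve (β : ℝ → ℂ) (a ρ : ℝ) (τ τ' : ℝ → ℂ) (e : ℂ) : Prop where
  straight : NearlyStraight τ τ' e (-ρ) ρ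
  odd : ∀ r, τ (-r) = -τ r
  even : ∀ r, τ' (-r) = τ' r
  sq : ∀ r ∈ Icc (-ρ) ρ, τ r ^ 2 = β (a + r ^ 2) - β a
  mul : ∀ r ∈ Icc (-ρ) ρ, τ r * τ' r = r * deriv β (a + r ^ 2)
  deriv_zero : τ' 0 = e

namespace SqrtCurve

variable {β : ℝ → ℂ} {a ρ : ℝ} {τ τ' : ℝ → ℂ} {e : ℂ}

theorem pos (h : SqrtCurve β a ρ τ τ' e) : 0 < ρ := by linarith [h.straight.lt]

theorem mono (h : SqrtCurve β a ρ τ τ' e) {ρ' : ℝ} (h0 : 0 < ρ') (h1 : ρ' ≤ ρ) :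
    SqrtCurve β a ρ' τ τ' e :=
  ⟨h.straight.mono (by linarith) (by linarith) h1, h.odd, h.even,
    fun r hr => h.sq r ⟨by linarith [hr.1], by linarith [hr.2]⟩,
    fun r hr => h.mul r ⟨by linarith [hr.1], by linarith [hr.2]⟩, h.deriv_zero⟩

theorem zero (h : SqrtCurve β a ρ τ τ' e) : τ 0 = 0 := by
  have := h.odd 0
  rw [neg_zero] at this
  exact self_eq_neg.1 this

theorem onRight_neg (h : SqrtCurve β a ρ τ τ' e) {σ : ℂ} (hσ : OnLeft τ e (-ρ) ρ σ) :
    OnRight τ e (-ρ) ρ (-σ) := by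
  obtain ⟨r, hr, y, hy, h0⟩ := hσ
  refine ⟨-r, ⟨by linarith [hr.2], by linarith [hr.1]⟩, -y, by linarith, ?_⟩
  rw [h.odd, show -τ r - -σ = -(τ r - σ) by ring, neg_div, h0]
  push_cast; ring

theorem notMem_arc (h : SqrtCurve β a ρ τ τ' e) {σ : ℂ} (hσ : OnRight τ e (-ρ) ρ σ) :
    β a + σ ^ 2 ∉ β '' Icc a (a + ρ ^ 2) := by
  rintro ⟨s, hs, hs'⟩
  set r := √(s - a) with hr
  have hr0 : 0 ≤ r := Real.sqrt_nonneg _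
  have hr2 : r ^ 2 = s - a := Real.sq_sqrt (by linarith [hs.1])
  have hrρ : r ≤ ρ := Real.sqrt_le_iff.2 ⟨h.pos.le, by linarith [hs.2]⟩
  have hrI : r ∈ Icc (-ρ) ρ := ⟨by linarith, hrρ⟩
  have h1 := h.sq r hrI
  rw [hr2, show a + (s - a) = s by ring, hs'] at h1
  have h2 : σ ^ 2 = τ r ^ 2 := by rw [h1]; ring
  rcases sq_eq_sq_iff_eq_or_eq_neg.1 h2 with h3 | h3
  · exact h.straight.notMem_of_onRight hσ ⟨r, hrI, h3.symm⟩
  · exact h.straight.notMem_of_onRight hσ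
      ⟨-r, ⟨by linarith, by linarith⟩, by rw [h.odd]; exact h3.symm⟩

theorem ne_zero_of_onRight (h : SqrtCurve β a ρ τ τ' e) {σ : ℂ} (hσ : OnRight τ e (-ρ) ρ σ) :
    σ ≠ 0 := by
  rintro rfl
  exact h.straight.notMem_of_onRight hσ ⟨0, ⟨by linarith [h.pos], h.pos.le⟩, h.zero⟩

theorem ne_zero (h : SqrtCurve β a ρ τ τ' e) (hβ : RegularArc β) {r : ℝ} (hr : r ∈ Icc (-ρ) ρ)
    (hr0 : r ≠ 0) : τ r ≠ 0 := by
  intro h0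
  have h1 := h.sq r hr
  rw [h0, zero_pow two_ne_zero] at h1
  have := hβ.inj (sub_eq_zero.1 h1.symm)
  have : r ^ 2 = 0 := by linarith
  exact hr0 (pow_eq_zero_iff two_ne_zero |>.1 this)

/-- Every point near the end point and off the arc is `β a + σ²` with `σ` to the right of the
square root curve. -/
theorem exists_root (h : SqrtCurve β a ρ τ τ' e) : ∃ d > 0, ∀ z, ‖z - β a‖ < d ^ 2 →
    z ∉ β '' Icc a (a + ρ ^ 2) → ∃ σ, σ ^ 2 = z - β a ∧ ‖σ‖ < d ∧ OnRight τ e (-ρ) ρ σ := by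
  obtain ⟨d, hd, hdS⟩ := Metric.isOpen_iff.1 (isOpen_crossStrip τ e (-ρ) ρ) 0
    (by simpa [h.zero] using h.straight.mem_crossStrip (s := 0) ⟨by linarith [h.pos], h.pos⟩)
  refine ⟨d, hd, fun z hz hzK => ?_⟩
  obtain ⟨σ, hσ⟩ := IsAlgClosed.exists_pow_nat_eq (z - β a) two_pos
  have hσd : ‖σ‖ < d := by
    rw [← hσ, norm_pow] at hz
    exact lt_of_pow_lt_pow_left₀ 2 hd.le hz
  have hnot : ∀ σ : ℂ, σ ^ 2 = z - β a → σ ∉ τ '' Icc (-ρ) ρ := by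
    rintro σ hσ ⟨r, hr, rfl⟩
    rw [h.sq r hr] at hσ
    refine hzK ⟨a + r ^ 2, ⟨by nlinarith, ?_⟩, by linear_combination hσ⟩
    have := sq_le_sq' hr.1 hr.2
    linarith
  -- Of the two roots `σ` and `-σ` one lies to the right, since the curve `τ` is odd.
  rcases h.straight.onRight_or_onLeft (hdS (by simpa using hσd)) (hnot σ hσ) with h1 | h1
  · exact ⟨σ, hσ, hσd, h1⟩
  · exact ⟨-σ, by rw [neg_sq, hσ], by rwa [norm_neg], h.onRight_neg h1⟩

end SqrtCurve

theorem convex_rightSector : Convex ℝ rightSector := by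
  intro x hx y hy s t hs ht hst
  simp only [rightSector, mem_ofPred_eq, Complex.add_im, Complex.add_re, Complex.real_smul,
    Complex.mul_im, Complex.mul_re, Complex.ofReal_re, Complex.ofReal_im, zero_mul, add_zero,
    sub_zero] at *
  refine ⟨?_, ?_⟩
  · rcases hs.eq_or_lt with rfl | hs'
    · have : t = 1 := by linarith
      subst this; linarith
    · nlinarith [mul_neg_of_pos_of_neg hs' hx.1, mul_nonneg ht (neg_nonneg.2 hy.1.le)]
  · calc |s * x.re + t * y.re| ≤ |s * x.re| + |t * y.re| := abs_add_le _ _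
      _ = s * |x.re| + t * |y.re| := by rw [abs_mul, abs_mul, abs_of_nonneg hs, abs_of_nonneg ht]
      _ ≤ s * (-x.im) + t * (-y.im) := by gcongr; exacts [hx.2, hy.2]
      _ = -(s * x.im + t * y.im) := by ring

namespace RegularArc

variable {β : ℝ → ℂ} {a b : ℝ}

/-- One has `β(a + r²) - β a = r² β'(a) u(r)` with `u` continuous and even, `u(0) = 1`, so `r
√(β'(a)) √(u(r))` is an odd root. Away from `0` its derivative comes from differentiating the
square, at `0` from the slopes. The formula `β'(a + r²)/(e √u)` is continuous although `β` is only
`C¹`. -/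
theorem exists_sqrtCurve (h : RegularArc β) (a : ℝ) :
    ∃ ρ τ τ' e, SqrtCurve β a ρ τ τ' e := by
  set B := deriv β a with hB
  have hB0 : B ≠ 0 := h.deriv_ne a
  set u : ℝ → ℂ := fun r => dslope β a (a + r ^ 2) / B with hu
  have hdiff : Differentiable ℝ β := h.contDiff.differentiable (by norm_num)
  have hdc : Continuous (dslope β a) := continuous_iff_continuousAt.2 fun x => by
    rcases eq_or_ne x a with rfl | hx
    · exact continuousAt_dslope_same.2 (hdiff _)
    · exact (continuousAt_dslope_of_ne hx).2 (hdiff.continuous.continuousAt)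
  have huc : Continuous u := (hdc.comp (by fun_prop)).div_const B
  have hu0 : u 0 = 1 := by simp [hu, hB, h.deriv_ne a]
  have hus : ∀ r, ((r ^ 2 : ℝ) : ℂ) * (B * u r) = β (a + r ^ 2) - β a := fun r => by
    have := sub_smul_dslope β a (a + r ^ 2)
    rw [add_sub_cancel_left, Complex.real_smul] at this
    rw [← this, hu]; field_simp
  obtain ⟨ρ₁, hρ₁, H₁⟩ := Metric.eventually_nhds_iff.1
    (huc.continuousAt.eventually (Complex.isOpen_slitPlane.mem_nhds (x := u 0)
      (by rw [hu0]; exact Complex.one_mem_slitPlane)))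
  set E : ℝ → ℂ := fun r => Complex.exp (Complex.log (u r) / 2) with hE
  set e : ℂ := Complex.exp (Complex.log B / 2) with he
  have he0 : e ≠ 0 := Complex.exp_ne_zero _
  have hE0 : ∀ r, E r ≠ 0 := fun r => Complex.exp_ne_zero _
  have hsq : ∀ x : ℂ, x ≠ 0 → Complex.exp (Complex.log x / 2) ^ 2 = x := fun x hx => by
    rw [← Complex.exp_nat_mul]; push_cast
    rw [mul_div_cancel₀ _ two_ne_zero, Complex.exp_log hx]
  have hes : e ^ 2 = B := hsq B hB0
  have hslit : ∀ r, |r| < ρ₁ → u r ∈ Complex.slitPlane := fun r hr =>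
    H₁ (by rwa [Real.dist_eq, sub_zero])
  have hEs : ∀ r, |r| < ρ₁ → E r ^ 2 = u r := fun r hr =>
    hsq _ (Complex.slitPlane_ne_zero (hslit r hr))
  have hEc : ∀ r, |r| < ρ₁ → ContinuousAt E r := fun r hr =>
    ((huc.continuousAt.clog (hslit r hr)).div_const 2).cexp
  set τ : ℝ → ℂ := fun r => r * (e * E r) with hτ
  set τ' : ℝ → ℂ := fun r => deriv β (a + r ^ 2) / (e * E r) with hτ'
  have hdβ : Continuous (deriv β) := h.contDiff.continuous_deriv le_rfl
  have hτ'c : ∀ r, |r| < ρ₁ → ContinuousAt τ' r := fun r hr =>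
    ContinuousAt.div ((hdβ.comp (by fun_prop)).continuousAt) (continuousAt_const.mul (hEc r hr))
      (mul_ne_zero he0 (hE0 r))
  have hEat0 : E 0 = 1 := by simp [hE, hu0]
  have hτ'0 : τ' 0 = e := by
    simp only [hτ', hEat0]
    rw [div_eq_iff (by simpa using he0)]
    simp only [ne_eq, OfNat.ofNat_ne_zero, not_false_eq_true, zero_pow, add_zero, mul_one]
    rw [← sq, hes]
  have hτs : ∀ r, |r| < ρ₁ → τ r ^ 2 = β (a + r ^ 2) - β a := fun r hr => by
    rw [← hus, hτ]
    simp only [mul_pow, hes, hEs r hr]; push_cast; ring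
  have hder : ∀ r, |r| < ρ₁ → HasDerivAt τ (τ' r) r := by
    intro r hr
    rcases eq_or_ne r 0 with rfl | hr0
    · rw [hτ'0, hasDerivAt_iff_tendsto_slope]
      have : Tendsto (fun r => e * E r) (𝓝[≠] 0) (𝓝 e) := by
        have := (continuousAt_const.mul (hEc 0 hr)).tendsto (x := (0 : ℝ)) (f := fun r => e * E r)
        simp only [hEat0, mul_one] at this
        exact this.mono_left nhdsWithin_le_nhds
      refine this.congr' ?_
      filter_upwards [self_mem_nhdsWithin] with x hx
      have hx0 : (x : ℂ) ≠ 0 := Complex.ofReal_ne_zero.2 hx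
      simp only [slope, hτ, vsub_eq_sub, sub_zero, Complex.ofReal_zero, zero_mul, Complex.real_smul,
        Complex.ofReal_inv]
      field_simp
    · have hr0' : (r : ℂ) ≠ 0 := Complex.ofReal_ne_zero.2 hr0
      have h0 : τ r ≠ 0 := mul_ne_zero hr0' (mul_ne_zero he0 (hE0 r))
      have hc : ContinuousAt τ r :=
        (Complex.continuous_ofReal.continuousAt).mul (continuousAt_const.mul (hEc r hr))
      have h2 : HasDerivAt (fun r : ℝ => β (a + r ^ 2) - β a) ((2 * r) • deriv β (a + r ^ 2)) r := by
        have h3 : HasDerivAt (fun r : ℝ => a + r ^ 2) (2 * r) r := by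
          simpa using (hasDerivAt_pow 2 r).const_add a
        exact ((hdiff (a + r ^ 2)).hasDerivAt.scomp r h3).sub_const _
      have hnear : ∀ᶠ x in 𝓝 r, |x| < ρ₁ := continuous_abs.continuousAt.eventually (gt_mem_nhds hr)
      have h4 := hasDerivAt_of_sq hc h0 (h2.congr_of_eventuallyEq
        (by filter_upwards [hnear] with x hx using hτs x hx))
      convert h4 using 1
      simp only [hτ, hτ', Complex.real_smul]
      have := hE0 r
      push_cast
      field_simp
  have hn : ∀ᶠ r in 𝓝 (0 : ℝ), ‖τ' r / e - 1‖ < 1 / 10 := by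
    have : ContinuousAt (fun r => ‖τ' r / e - 1‖) 0 :=
      (((hτ'c 0 (by simpa using hρ₁)).div_const e).sub continuousAt_const).norm
    exact this.eventually (gt_mem_nhds (by simp [hτ'0, he0]))
  obtain ⟨ρ₂, hρ₂, H₂⟩ := Metric.eventually_nhds_iff.1 hn
  set ρ := min ρ₁ ρ₂ / 2 with hρ
  have hρ0 : 0 < ρ := by have := lt_min hρ₁ hρ₂; positivity
  have hρ1 : ρ < ρ₁ := by linarith [min_le_left ρ₁ ρ₂]
  have hρ2 : ρ < ρ₂ := by linarith [min_le_right ρ₁ ρ₂]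
  have habs : ∀ r ∈ Icc (-ρ) ρ, |r| ≤ ρ := fun r hr => abs_le.2 hr
  refine ⟨ρ, τ, τ', e, ⟨⟨by linarith, he0, fun r hr => hder r ((habs r hr).trans_lt hρ1),
    fun r hr => (hτ'c r ((habs r hr).trans_lt hρ1)).continuousWithinAt,
    fun r hr => (H₂ (by rw [Real.dist_eq, sub_zero]; exact (habs r hr).trans_lt hρ2)).le⟩, ?_, ?_,
    fun r hr => hτs r ((habs r hr).trans_lt hρ1), ?_, hτ'0⟩⟩
  · intro r; simp [hτ, hE, hu]
  · intro r; simp [hτ', hE, hu]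
  · intro r _
    simp only [hτ, hτ']
    have := hE0 r
    field_simp

end RegularArc

namespace SqrtCurve

variable {β : ℝ → ℂ} {a b ρ : ℝ} {τ τ' : ℝ → ℂ} {e : ℂ}

/-- In terms of the square root coordinate `σ` to the right of the odd curve, `arcSqrt` is `σ` times
an analytic function. -/
theorem exists_arcSqrt_eq (h : SqrtCurve β a ρ τ τ' e) (hβ : RegularArc β) (hab : a + ρ ^ 2 < b) :
    ∃ d > 0, ∃ n : ℂ → ℂ, DifferentiableOn ℂ n (Metric.ball (β a) (d ^ 2)) ∧
      (∀ z ∈ Metric.ball (β a) (d ^ 2), n z ≠ 0) ∧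
      ∀ σ, ‖σ‖ < d → OnRight τ e (-ρ) ρ σ → β a + σ ^ 2 ∉ β '' Icc a b ∧
        arcSqrt β a b (β a + σ ^ 2) = σ * n (β a + σ ^ 2) := by
  have hρ := h.pos
  have hab' : a < b := by nlinarith
  set e' := β a - β b with he'
  have he'0 : e' ≠ 0 := sub_ne_zero.2 fun h0 => hab'.ne (hβ.inj h0)
  set V : Set ℂ := Metric.ball (β a) ‖e'‖ ∩ (β '' Icc (a + ρ ^ 2) b)ᶜ with hV
  have hVo : IsOpen V := Metric.isOpen_ball.inter (hβ.isClosed_image _ _).isOpen_compl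
  have haV : β a ∈ V := by
    refine ⟨Metric.mem_ball_self (norm_pos_iff.2 he'0), ?_⟩
    rintro ⟨s, hs, hs'⟩
    rw [hβ.inj hs'] at hs; nlinarith [hs.1]
  obtain ⟨R, hR, hRV⟩ := Metric.isOpen_iff.1 hVo _ haV
  set c₀ := Complex.exp (Complex.log e' / 2) with hc₀
  have hsq : ∀ x : ℂ, x ≠ 0 → Complex.exp (Complex.log x / 2) ^ 2 = x := fun x hx => by
    rw [← Complex.exp_nat_mul]; push_cast
    rw [mul_div_cancel₀ _ two_ne_zero, Complex.exp_log hx]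
  -- An analytic root of `z - β b` near `β a`. Then `σ n₁` and `arcSqrt` have equal squares, and
  -- only a constant sign is in question.
  set n₁ : ℂ → ℂ := fun z => c₀ * Complex.exp (Complex.log (1 + (z - β a) / e') / 2) with hn₁
  have hslit : ∀ z ∈ Metric.ball (β a) ‖e'‖, 1 + (z - β a) / e' ∈ Complex.slitPlane := fun z hz => by
    refine Complex.mem_slitPlane_of_norm_lt_one ?_
    rw [norm_div, div_lt_one (norm_pos_iff.2 he'0), ← dist_eq_norm]
    exact hz
  have hn₁d : DifferentiableOn ℂ n₁ (Metric.ball (β a) ‖e'‖) := fun z hz => by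
    refine DifferentiableAt.differentiableWithinAt ?_
    have h1 : DifferentiableAt ℂ (fun z => 1 + (z - β a) / e') z := by fun_prop
    exact (((h1.clog (hslit z hz)).div_const 2).cexp).const_mul _
  have hn₁0 : ∀ z, n₁ z ≠ 0 := fun z => mul_ne_zero (Complex.exp_ne_zero _) (Complex.exp_ne_zero _)
  have hn₁s : ∀ z ∈ Metric.ball (β a) ‖e'‖, n₁ z ^ 2 = z - β b := fun z hz => by
    simp only [hn₁, mul_pow, hc₀, hsq _ he'0, hsq _ (Complex.slitPlane_ne_zero (hslit z hz))]
    field_simp; rw [he']; ring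
  set d₁ := √R with hd₁
  have hd₁0 : 0 < d₁ := Real.sqrt_pos.2 hR
  have hd₁s : d₁ ^ 2 = R := Real.sq_sqrt hR.le
  have hball : ∀ σ : ℂ, ‖σ‖ < d₁ → β a + σ ^ 2 ∈ Metric.ball (β a) R := fun σ hσ => by
    rw [Metric.mem_ball, dist_eq_norm, add_sub_cancel_left, norm_pow, ← hd₁s]
    gcongr
  have hoff : ∀ σ, ‖σ‖ < d₁ → OnRight τ e (-ρ) ρ σ → β a + σ ^ 2 ∉ β '' Icc a b := by
    rintro σ hσ hr ⟨s, hs, hs'⟩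
    rcases le_or_gt s (a + ρ ^ 2) with h1 | h1
    · exact h.notMem_arc hr ⟨s, ⟨hs.1, h1⟩, hs'⟩
    · exact (hRV (hball σ hσ)).2 ⟨s, ⟨h1.le, hs.2⟩, hs'⟩
  set D : Set ℂ := {σ | ‖σ‖ < d₁ ∧ OnRight τ e (-ρ) ρ σ} with hD
  set f : ℂ → ℂ := fun σ => arcSqrt β a b (β a + σ ^ 2) with hf
  set g : ℂ → ℂ := fun σ => σ * n₁ (β a + σ ^ 2) with hg
  have hfc : ContinuousOn f D := fun σ hσ => by
    have h1 := (hβ.differentiableOn_arcSqrt hab'.le).differentiableAt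
      ((hβ.isClosed_image a b).isOpen_compl.mem_nhds (hoff σ hσ.1 hσ.2))
    exact (ContinuousAt.comp (f := fun σ : ℂ => β a + σ ^ 2) h1.continuousAt
      (by fun_prop)).continuousWithinAt
  have hgc : ContinuousOn g D := fun σ hσ => by
    have h1 := hn₁d.differentiableAt (Metric.isOpen_ball.mem_nhds (hRV (hball σ hσ.1)).1)
    exact (continuousAt_id.mul (ContinuousAt.comp (f := fun σ : ℂ => β a + σ ^ 2) h1.continuousAt
      (by fun_prop))).continuousWithinAt
  have hfg : EqOn (f ^ 2) (g ^ 2) D := fun σ hσ => by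
    simp only [Pi.pow_apply, hf, hg, mul_pow]
    rw [hβ.arcSqrt_sq hab'.le (hoff σ hσ.1 hσ.2), hn₁s _ (hRV (hball σ hσ.1)).1]
    ring
  have hg0 : ∀ {σ}, σ ∈ D → g σ ≠ 0 := fun hσ => mul_ne_zero (h.ne_zero_of_onRight hσ.2) (hn₁0 _)
  -- The sign is fixed on a convex sector at the origin, which is connected and lies to the right of
  -- `τ`; connectedness of the whole right side is not needed.
  obtain ⟨η, hη, H⟩ := h.straight.onRight_of_sector (r₀ := 0) ⟨by linarith, hρ⟩
  simp only [h.zero, h.deriv_zero, zero_add] at H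
  have he := h.straight.ne
  have hen : 0 < ‖e‖ := norm_pos_iff.2 he
  set η₁ := min η (d₁ / ‖e‖) with hη₁
  have hη₁0 : 0 < η₁ := lt_min hη (by positivity)
  set S : Set ℂ := (fun w => w * e) '' (rightSector ∩ Metric.ball 0 η₁) with hS
  have hSD : S ⊆ D := by
    rintro _ ⟨w, ⟨hw, hwη⟩, rfl⟩
    rw [mem_ball_zero_iff] at hwη
    refine ⟨?_, H w (hwη.trans_le (min_le_left _ _)) hw.1 hw.2⟩
    simp only [norm_mul]
    calc ‖w‖ * ‖e‖ < d₁ / ‖e‖ * ‖e‖ := by gcongr; exact hwη.trans_le (min_le_right _ _)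
      _ = d₁ := by field_simp
  have hSp : IsPreconnected S :=
    ((convex_rightSector.inter (convex_ball _ _)).isPreconnected).image _ (by fun_prop)
  obtain ⟨κ, hκ, hκS⟩ : ∃ κ : ℂ, κ ^ 2 = 1 ∧ ∀ σ ∈ S, f σ = κ * g σ := by
    rcases hSp.eq_or_eq_neg_of_sq_eq (hfc.mono hSD) (hgc.mono hSD) (hfg.mono hSD)
      (fun hx => hg0 (hSD hx)) with h1 | h1
    · exact ⟨1, by norm_num, fun σ hσ => by rw [one_mul]; exact h1 hσ⟩
    · exact ⟨-1, by norm_num, fun σ hσ => by rw [h1 hσ]; simp⟩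
  have hκ0 : κ ≠ 0 := by rintro rfl; norm_num at hκ
  have hle : (η₁ / 8 * ‖e‖) < d₁ := by
    calc η₁ / 8 * ‖e‖ < η₁ * ‖e‖ := by gcongr; linarith
      _ ≤ d₁ / ‖e‖ * ‖e‖ := by gcongr; exact min_le_right _ _
      _ = d₁ := by field_simp
  have hsub : Metric.ball (β a) ((η₁ / 8 * ‖e‖) ^ 2) ⊆ Metric.ball (β a) ‖e'‖ := by
    refine (Metric.ball_subset_ball ?_).trans (hRV.trans inter_subset_left)
    rw [← hd₁s]
    gcongr
  refine ⟨η₁ / 8 * ‖e‖, by positivity, fun z => κ * n₁ z, (hn₁d.mono hsub).const_mul _,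
    fun z _ => mul_ne_zero hκ0 (hn₁0 z), fun σ hσ hr => ⟨hoff σ (hσ.trans hle) hr, ?_⟩⟩
  -- move `σ` to the right until it reaches the sector
  set w := σ / e with hw
  have hwe : w * e = σ := by rw [hw]; field_simp
  have hwn : ‖w‖ < η₁ / 8 := by
    rw [hw, norm_div, div_lt_iff₀ hen]; exact hσ
  set ε := η₁ / 8 with hε
  -- As `‖w‖ < ε`, a shift by `3 ε` makes the imaginary part less than `-2 ε`, beyond the real part,
  -- while the norm stays below `4 ε < η₁`.
  set L : Set ℂ := (fun t : ℝ => (w - t * Complex.I) * e) '' Icc 0 (3 * ε) with hL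
  have hLp : IsPreconnected L := isPreconnected_Icc.image _ (by fun_prop)
  have hnorm : ∀ t ∈ Icc 0 (3 * ε), ‖w - t * Complex.I‖ < η₁ := fun t ht => by
    calc ‖w - t * Complex.I‖ ≤ ‖w‖ + ‖(t : ℂ) * Complex.I‖ := norm_sub_le _ _
      _ = ‖w‖ + t := by simp [abs_of_nonneg ht.1]
      _ < η₁ := by linarith [ht.2]
  have hLD : L ⊆ D := by
    rintro _ ⟨t, ht, rfl⟩
    refine ⟨?_, ?_⟩
    · simp only [norm_mul]
      calc ‖w - t * Complex.I‖ * ‖e‖ < d₁ / ‖e‖ * ‖e‖ := by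
            gcongr; exact (hnorm t ht).trans_le (min_le_right _ _)
        _ = d₁ := by field_simp
    · obtain ⟨r, hr, y, hy, h0⟩ := hr
      refine ⟨r, hr, y + t, by linarith [ht.1], ?_⟩
      rw [show τ r - (w - t * Complex.I) * e = (τ r - σ) + t * Complex.I * e by rw [← hwe]; ring,
        add_div, h0, mul_div_cancel_right₀ _ he]
      push_cast; ring
  have h3ε : (3 * ε) ∈ Icc 0 (3 * ε) := ⟨by positivity, le_rfl⟩
  have hend : (w - ((3 * ε : ℝ) : ℂ) * Complex.I) * e ∈ S := by
    refine ⟨_, ⟨?_, by rw [mem_ball_zero_iff]; exact hnorm _ h3ε⟩, rfl⟩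
    have i1 := abs_le.1 (Complex.abs_im_le_norm w)
    have i2 := Complex.abs_re_le_norm w
    constructor
    · simp only [Complex.sub_im, Complex.mul_im, Complex.ofReal_re, Complex.I_im, mul_one,
        Complex.ofReal_im, Complex.I_re, mul_zero, add_zero]
      linarith
    · simp only [Complex.sub_im, Complex.mul_im, Complex.ofReal_re, Complex.I_im, mul_one,
        Complex.ofReal_im, Complex.I_re, mul_zero, add_zero, Complex.sub_re, Complex.mul_re,
        sub_zero]
      linarith
  have hfin := hLp.eq_of_sq_eq (f := f) (g := fun σ => κ * g σ) (hfc.mono hLD)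
    (continuousOn_const.mul (hgc.mono hLD))
    (fun x hx => by
      simp only [Pi.pow_apply, mul_pow, hκ, one_mul]
      simpa using hfg (hLD hx))
    (fun hx => mul_ne_zero hκ0 (hg0 (hLD hx)))
    (y := (w - ((3 * ε : ℝ) : ℂ) * Complex.I) * e) ⟨3 * ε, h3ε, rfl⟩ (hκS _ hend)
  have : f σ = κ * g σ := hfin ⟨0, ⟨le_rfl, by positivity⟩, by simp [hwe]⟩
  simp only [hf, hg] at this
  rw [this]; ring

/-- Approach `τ r` from the right in the `σ`-plane along `τ r + δ τ' r`. The square moves by `(2 r δ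
+ q δ²) β'(a + r²)` with `q = r τ'/τ`; for small `δ` the quadratic term leaves this displacement in
`rightSector`, so both limits compute the same boundary value. -/
theorem rightSqrt_eq (h : SqrtCurve β a ρ τ τ' e) (hβ : RegularArc β) (hab : a + ρ ^ 2 ≤ b) {d : ℝ}
    {n : ℂ → ℂ} (hn : ContinuousOn n (Metric.ball (β a) (d ^ 2)))
    (hr : ∀ σ, ‖σ‖ < d → OnRight τ e (-ρ) ρ σ →
      arcSqrt β a b (β a + σ ^ 2) = σ * n (β a + σ ^ 2))
    {r : ℝ} (hr0 : r ∈ Ioo 0 ρ) (hrd : ‖τ r‖ < d) :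
    rightSqrt β a b (a + r ^ 2) = τ r * n (β (a + r ^ 2)) := by
  have hrI : r ∈ Icc (-ρ) ρ := ⟨by linarith [hr0.1, h.pos], hr0.2.le⟩
  have hs : a + r ^ 2 ∈ Ioo a b := ⟨by nlinarith [hr0.1], by
    have : r ^ 2 < ρ ^ 2 := by have := hr0.1; gcongr; exact hr0.2
    linarith⟩
  have hτ0 : τ r ≠ 0 := h.ne_zero hβ hrI hr0.1.ne'
  set q : ℂ := r * τ' r / τ r with hq
  set W : ℝ → ℂ := fun ε => 2 * r * (-(ε * 1 : ℝ) * Complex.I) + (-(ε * 1 : ℝ) * Complex.I) ^ 2 * q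
    with hW
  have hWr : ∀ᶠ ε in 𝓝[>] (0 : ℝ), W ε ∈ rightSector := by
    have : ∀ᶠ ε in 𝓝 (0 : ℝ), ε * ‖q‖ < r := by
      have hc : Continuous fun ε : ℝ => ε * ‖q‖ := by fun_prop
      exact hc.continuousAt.eventually (gt_mem_nhds (by simpa using hr0.1))
    filter_upwards [mem_nhdsWithin_of_mem_nhds this, self_mem_nhdsWithin] with ε hε hε0
    have hε0' : (0 : ℝ) < ε := hε0
    have him : (W ε).im = -(2 * r * ε) - ε ^ 2 * q.im := by
      simp [hW, pow_two]; ring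
    have hre : (W ε).re = -(ε ^ 2 * q.re) := by
      simp [hW, pow_two]
    have i1 := abs_le.1 (Complex.abs_im_le_norm q)
    have i2 := Complex.abs_re_le_norm q
    have i3 : ε ^ 2 * ‖q‖ ≤ r * ε := by nlinarith
    have i4 : -(ε ^ 2 * q.im) ≤ ε ^ 2 * ‖q‖ := by nlinarith [sq_nonneg ε]
    have i5 : 0 < r * ε := mul_pos hr0.1 hε0'
    constructor
    · rw [him]; linarith
    · rw [him, hre, abs_neg, abs_mul, abs_of_nonneg (sq_nonneg ε)]
      have : ε ^ 2 * |q.re| ≤ ε ^ 2 * ‖q‖ := by gcongr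
      linarith
  have hW0 : Tendsto W (𝓝[>] 0) (𝓝[rightSector] 0) := by
    refine tendsto_nhdsWithin_iff.2 ⟨?_, hWr⟩
    have : Continuous W := by fun_prop
    have h := this.tendsto 0
    simp only [hW, zero_mul, Complex.ofReal_zero, neg_zero, mul_zero, ne_eq, OfNat.ofNat_ne_zero,
      not_false_eq_true, zero_pow, add_zero] at h
    exact h.mono_left nhdsWithin_le_nhds
  have lim1 := (hβ.tendsto_rightSqrt hs).1.comp hW0
  have hw := tendsto_rightSector one_pos
  obtain ⟨η, hη, H⟩ := h.straight.onRight_of_sector (r₀ := r) ⟨by linarith [hr0.1, h.pos], hr0.2⟩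
  set σ : ℝ → ℂ := fun ε => τ r + (-(ε * 1 : ℝ) * Complex.I) * τ' r with hσ
  have hσc : Continuous σ := by fun_prop
  have hσ0 : σ 0 = τ r := by simp [hσ]
  have hright : ∀ᶠ ε in 𝓝[>] (0 : ℝ), OnRight τ e (-ρ) ρ (σ ε) := by
    have h2 := (tendsto_nhdsWithin_iff.1 hw).1.eventually (Metric.ball_mem_nhds (0 : ℂ) hη)
    filter_upwards [h2, (tendsto_nhdsWithin_iff.1 hw).2] with ε h3 h4
    exact H _ (by simpa using h3) h4.1 h4.2
  have hsmall : ∀ᶠ ε in 𝓝[>] (0 : ℝ), ‖σ ε‖ < d :=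
    mem_nhdsWithin_of_mem_nhds (hσc.norm.continuousAt.eventually (gt_mem_nhds (by simpa [hσ0] using hrd)))
  have hβs : β a + τ r ^ 2 = β (a + r ^ 2) := by rw [h.sq r hrI]; ring
  have lim2 : Tendsto (fun ε => σ ε * n (β a + σ ε ^ 2)) (𝓝[>] 0)
      (𝓝 (τ r * n (β (a + r ^ 2)))) := by
    have hmem : β a + σ 0 ^ 2 ∈ Metric.ball (β a) (d ^ 2) := by
      rw [Metric.mem_ball, dist_eq_norm, add_sub_cancel_left, norm_pow, hσ0]
      gcongr
    have hn' := (hn.continuousAt (Metric.isOpen_ball.mem_nhds hmem))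
    have : ContinuousAt (fun ε => σ ε * n (β a + σ ε ^ 2)) 0 :=
      hσc.continuousAt.mul (ContinuousAt.comp (f := fun ε => β a + σ ε ^ 2) hn' (by fun_prop))
    have h5 := this.tendsto
    rw [hσ0, hβs] at h5
    exact h5.mono_left nhdsWithin_le_nhds
  refine tendsto_nhds_unique lim1 (lim2.congr' ?_)
  filter_upwards [hright, hsmall] with ε h1 h2
  rw [← hr _ h2 h1, Function.comp]
  congr 1
  have h6 : (r : ℂ) * deriv β (a + r ^ 2) = τ r * τ' r := (h.mul r hrI).symm
  have h7 : (r : ℂ) * τ' r * deriv β (a + r ^ 2) = τ r * τ' r ^ 2 := by linear_combination τ' r * h6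
  have h8 : q * deriv β (a + r ^ 2) = τ' r ^ 2 := by
    rw [hq, div_mul_eq_mul_div, h7]; field_simp
  simp only [hσ, hW]
  linear_combination hβs - 2 * (-((ε * 1 : ℝ) : ℂ) * Complex.I) * h6
    - (-((ε * 1 : ℝ) : ℂ) * Complex.I) ^ 2 * h8

end SqrtCurve

namespace SqrtCurve

variable {β : ℝ → ℂ} {a b ρ : ℝ} {τ τ' : ℝ → ℂ} {e : ℂ}

/-- The Cauchy integral over the arc, in the square root coordinate. -/
theorem integral_cauchy (h : SqrtCurve β a ρ τ τ' e) (hβ : RegularArc β) {F : ℂ → ℂ} {p : ℝ → ℂ}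
    (hF : ContinuousOn (fun r => F (τ r)) (Icc (-ρ) ρ)) (heven : ∀ x, F (-x) = F x)
    (hp : ∀ r ∈ Ioc 0 ρ, p (a + r ^ 2) = F (τ r) / τ r) {σ : ℂ} (hσ0 : σ ≠ 0)
    (hσ : σ ∉ τ '' Icc (-ρ) ρ) :
    ∫ s in a..a + ρ ^ 2, p s * deriv β s / (β s - (β a + σ ^ 2)) =
      1 / σ * ∫ r in -ρ..ρ, F (τ r) * τ' r / (τ r - σ) := by
  have hρ := h.pos
  have hsub : ∫ r in 0..ρ, (2 * r) • ((fun s => p s * deriv β s / (β s - (β a + σ ^ 2))) ∘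
      fun r => a + r ^ 2) r = ∫ s in (a + 0 ^ 2)..(a + ρ ^ 2), p s * deriv β s / (β s - (β a + σ ^ 2)) := by
    refine intervalIntegral.integral_deriv_smul_comp_of_deriv_nonneg (f' := fun r => 2 * r)
      (by fun_prop) (fun r _ => ?_) fun r hr => ?_
    · simpa using (hasDerivAt_pow 2 r).const_add a
    · rw [min_eq_left hρ.le, max_eq_right hρ.le] at hr
      linarith [hr.1]
  rw [zero_pow two_ne_zero, add_zero] at hsub
  rw [← hsub]
  have hcont : ContinuousOn (fun r => F (τ r) * τ' r / (τ r - σ)) (Icc (-ρ) ρ) :=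
    (hF.mul h.straight.cont).div (h.straight.continuousOn.sub continuousOn_const)
      fun r hr h0 => hσ ⟨r, hr, sub_eq_zero.1 h0⟩
  have hint : ∀ x y, -ρ ≤ x → x ≤ y → y ≤ ρ →
      IntervalIntegrable (fun r => F (τ r) * τ' r / (τ r - σ)) volume x y := fun x y h1 h2 h3 =>
    (hcont.mono (by rw [uIcc_of_le h2]; exact Icc_subset_Icc h1 h3)).intervalIntegrable
  have i1 := hint (-ρ) 0 le_rfl (by linarith) hρ.le
  have i2 := hint 0 ρ (by linarith) hρ.le le_rfl
  rw [← intervalIntegral.integral_add_adjacent_intervals i1 i2]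
  -- Since `F` and `τ'` are even and `τ` is odd, the contributions of `r` and `-r` add up to `2 σ F
  -- τ'/(τ² - σ²)`. This is `σ` times the integrand obtained from `s = a + r²`, because `τ τ' = r
  -- β'`.
  have hneg : ∫ r in -ρ..0, F (τ r) * τ' r / (τ r - σ) =
      ∫ r in 0..ρ, F (τ (-r)) * τ' (-r) / (τ (-r) - σ) := by
    rw [intervalIntegral.integral_comp_neg (fun r => F (τ r) * τ' r / (τ r - σ)), neg_zero]
  have i3 : IntervalIntegrable (fun r => F (τ (-r)) * τ' (-r) / (τ (-r) - σ)) volume 0 ρ := by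
    have := (IntervalIntegrable.iff_comp_neg (by simp)).1 i1
    simpa using this.symm
  rw [hneg, ← intervalIntegral.integral_add i3 i2, ← intervalIntegral.integral_const_mul]
  refine intervalIntegral.integral_congr_ae (ae_of_all _ fun r hr => ?_)
  rw [uIoc_of_le hρ.le] at hr
  have hrI : r ∈ Icc (-ρ) ρ := ⟨by linarith [hr.1], hr.2⟩
  have hnI : -r ∈ Icc (-ρ) ρ := ⟨by linarith [hr.2], by linarith [hr.1]⟩
  have h1 : τ r - σ ≠ 0 := fun h0 => hσ ⟨r, hrI, sub_eq_zero.1 h0⟩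
  have h2 : -τ r - σ ≠ 0 := fun h0 => hσ ⟨-r, hnI, by rw [h.odd]; exact sub_eq_zero.1 h0⟩
  have h3 : τ r ≠ 0 := h.ne_zero hβ hrI hr.1.ne'
  have h4 : β (a + r ^ 2) - (β a + σ ^ 2) = (τ r - σ) * (τ r + σ) := by
    have := h.sq r hrI
    linear_combination -this
  have h5 : τ r + σ ≠ 0 := fun h0 => h2 (by linear_combination -h0)
  simp only [Function.comp, Complex.real_smul, h.odd, h.even, heven, hp r hr, h4]
  have h6 := h.mul r hrI
  rw [show -τ r - σ = -(τ r + σ) by ring]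
  field_simp
  push_cast
  linear_combination -2 * F (τ r) * σ * h6

/-- Near the end point of the arc, `arcDefect` is `O(|z - β a|^{-1/2})`. -/
theorem exists_arcDefect_bound (h₀ : SqrtCurve β a ρ τ τ' e) (hβ : RegularArc β) (hab : a < b)
    {V : Set ℂ} (hV : IsOpen V) (haV : β a ∈ V) {m : ℂ → ℂ} {p : ℝ → ℂ}
    (hm : DifferentiableOn ℂ m V) (hp : IntervalIntegrable p volume a b)
    (hpm : ∀ s ∈ Ioo a b, p s = m (β s) / rightSqrt β a b s) :
    ∃ R > 0, ∃ C : ℝ, ∀ z ∈ Metric.ball (β a) R \ β '' Icc a b,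
      ‖arcDefect β a b m p z‖ ≤ C / √‖z - β a‖ := by
  obtain ⟨ρ₁, hρ₁, hρ₁a⟩ : ∃ ρ₁ ∈ Ioc 0 ρ, a + ρ₁ ^ 2 < b := by
    have hc : Continuous fun x : ℝ => a + x ^ 2 := by fun_prop
    obtain ⟨δ, hδ, H⟩ := Metric.eventually_nhds_iff.1
      (hc.continuousAt.eventually (gt_mem_nhds (show a + (0 : ℝ) ^ 2 < b by simpa using hab)))
    have hm0 : 0 < min ρ (δ / 2) := lt_min h₀.pos (by linarith)
    refine ⟨min ρ (δ / 2), ⟨hm0, min_le_left _ _⟩, H ?_⟩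
    rw [Real.dist_eq, sub_zero, abs_of_pos hm0]
    linarith [min_le_right ρ (δ / 2)]
  have h₁ := h₀.mono hρ₁.1 hρ₁.2
  obtain ⟨d, hd, n, hn, hn0, hsqrt⟩ := h₁.exists_arcSqrt_eq hβ hρ₁a
  obtain ⟨R₀, hR₀, hRV⟩ := Metric.isOpen_iff.1 hV _ haV
  set d₁ := min d √R₀ with hd₁
  have hd₁0 : 0 < d₁ := lt_min hd (Real.sqrt_pos.2 hR₀)
  have hbn : Metric.ball (β a) (d₁ ^ 2) ⊆ Metric.ball (β a) (d ^ 2) :=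
    Metric.ball_subset_ball (by gcongr; exact min_le_left _ _)
  have hbV : Metric.ball (β a) (d₁ ^ 2) ⊆ V :=
    (Metric.ball_subset_ball (by
      calc d₁ ^ 2 ≤ √R₀ ^ 2 := by gcongr; exact min_le_right _ _
        _ = R₀ := Real.sq_sqrt hR₀.le)).trans hRV
  have hmem : ∀ x : ℂ, ‖x‖ < d₁ → β a + x ^ 2 ∈ Metric.ball (β a) (d₁ ^ 2) := fun x hx => by
    rw [Metric.mem_ball, dist_eq_norm, add_sub_cancel_left, norm_pow]
    gcongr
  -- In the square root coordinate the density `p` is `F(τ)/τ` with `F` analytic and even, so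
  -- `exists_plemelj` applies on the odd curve even at the former end point.
  set F : ℂ → ℂ := fun x => m (β a + x ^ 2) / n (β a + x ^ 2) with hF
  have hFd : DifferentiableOn ℂ F (Metric.ball 0 d₁) := by
    have hmaps : MapsTo (fun x : ℂ => β a + x ^ 2) (Metric.ball 0 d₁) (Metric.ball (β a) (d₁ ^ 2)) :=
      fun x hx => hmem x (by simpa using hx)
    have hpoly : DifferentiableOn ℂ (fun x : ℂ => β a + x ^ 2) (Metric.ball 0 d₁) := by fun_prop
    exact ((hm.mono hbV).comp hpoly hmaps).div ((hn.mono hbn).comp hpoly hmaps)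
      fun x hx => hn0 _ (hbn (hmaps hx))
  obtain ⟨ρ₂, hρ₂, hρ₂d⟩ : ∃ ρ₂ ∈ Ioo 0 ρ₁, ∀ r ∈ Icc (-ρ₂) ρ₂, ‖τ r‖ < d₁ := by
    have hc : ContinuousAt τ 0 := (h₁.straight.deriv 0 ⟨by linarith [hρ₁.1], hρ₁.1.le⟩).continuousAt
    obtain ⟨δ, hδ, H⟩ := Metric.eventually_nhds_iff.1
      (hc.norm.eventually (gt_mem_nhds (show ‖τ 0‖ < d₁ by simpa [h₁.zero] using hd₁0)))
    have hm0 : 0 < min ρ₁ δ := lt_min hρ₁.1 hδ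
    refine ⟨min ρ₁ δ / 2, ⟨by positivity, by linarith [min_le_left ρ₁ δ]⟩, fun r hr => H ?_⟩
    rw [Real.dist_eq, sub_zero]
    have := abs_le.2 hr
    linarith [min_le_right ρ₁ δ]
  have h := h₁.mono hρ₂.1 hρ₂.2.le
  have hρ₂b : a + ρ₂ ^ 2 < b := by
    have : ρ₂ ^ 2 ≤ ρ₁ ^ 2 := by have := hρ₂.1; gcongr; exact hρ₂.2.le
    linarith
  obtain ⟨d₂, hd₂, hroot⟩ := h.exists_root
  obtain ⟨G, hG, hGint⟩ := h.straight.exists_plemelj hFd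
    (fun s hs => by simpa using hρ₂d s hs)
  have h0W : (0 : ℂ) ∈ Metric.ball 0 d₁ ∩ crossStrip τ e (-ρ₂) ρ₂ :=
    ⟨Metric.mem_ball_self hd₁0, by
      have := h.straight.mem_crossStrip (s := 0) ⟨by linarith [hρ₂.1], hρ₂.1⟩
      rwa [h.zero] at this⟩
  have hWo : IsOpen (Metric.ball 0 d₁ ∩ crossStrip τ e (-ρ₂) ρ₂) :=
    Metric.isOpen_ball.inter (isOpen_crossStrip _ _ _ _)
  have hG0 := (hG.continuousOn.continuousAt (hWo.mem_nhds h0W)).norm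
  obtain ⟨d₃, hd₃, hGb⟩ := Metric.eventually_nhds_iff.1
    ((hG0.eventually (gt_mem_nhds (lt_add_one _))).and (hWo.mem_nhds h0W))
  have iI : ∀ x y, a ≤ x → x ≤ y → y ≤ b → IntervalIntegrable p volume x y := fun x y h1 h2 h3 =>
    hp.mono_set (by
      rw [uIcc_of_le h2, uIcc_of_le (h1.trans (h2.trans h3))]; exact Icc_subset_Icc h1 h3)
  have ha2 : a ≤ a + ρ₂ ^ 2 := by nlinarith
  have i1 := iI a (a + ρ₂ ^ 2) le_rfl ha2 hρ₂b.le
  have i2 := iI (a + ρ₂ ^ 2) b ha2 hρ₂b.le le_rfl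
  have hrest := hβ.differentiableOn_cauchy hρ₂b.le i2
  have haR : β a ∈ (β '' Icc (a + ρ₂ ^ 2) b)ᶜ := by
    rintro ⟨s, hs, hs'⟩
    rw [hβ.inj hs'] at hs; nlinarith [hs.1, hρ₂.1]
  obtain ⟨d₄, hd₄, hRb⟩ := Metric.eventually_nhds_iff.1
    ((hrest.continuousOn.continuousAt ((hβ.isClosed_image _ _).isOpen_compl.mem_nhds haR)).norm.eventually
      (gt_mem_nhds (lt_add_one _)))
  set C₁ := ‖G 0‖ + 1 with hC₁
  set C₂ := ‖∫ s in (a + ρ₂ ^ 2)..b, p s * deriv β s / (β s - β a)‖ + 1 with hC₂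
  set δ := min (min d₁ d₂) (min d₃ (min √d₄ 1)) with hδ
  have hδ0 : 0 < δ := by
    have := Real.sqrt_pos.2 hd₄
    simp only [hδ, lt_min_iff]; exact ⟨⟨hd₁0, hd₂⟩, hd₃, this, one_pos⟩
  refine ⟨δ ^ 2, by positivity, C₁ + C₂, ?_⟩
  rintro z ⟨hzR, hzK⟩
  rw [Metric.mem_ball, dist_eq_norm] at hzR
  have hzK₂ : ∀ x y, a ≤ x → y ≤ b → z ∉ β '' Icc x y := fun x y h1 h2 h3 =>
    hzK (image_mono (Icc_subset_Icc h1 h2) h3)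
  have hδle : ∀ x, δ ≤ x → ‖z - β a‖ < x ^ 2 := fun x hx => hzR.trans_le (by gcongr)
  have l2 : δ ≤ d₂ := (min_le_left _ _).trans (min_le_right _ _)
  have l1 : δ ≤ d₁ := (min_le_left _ _).trans (min_le_left _ _)
  have l3 : δ ≤ d₃ := (min_le_right _ _).trans (min_le_left _ _)
  have l4 : δ ≤ √d₄ := (min_le_right _ _).trans ((min_le_right _ _).trans (min_le_left _ _))
  have l5 : δ ≤ 1 := (min_le_right _ _).trans ((min_le_right _ _).trans (min_le_right _ _))
  obtain ⟨σ, hσz, -, hright⟩ := hroot z (hδle _ l2) (hzK₂ _ _ le_rfl hρ₂b.le)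
  have hσδ : ‖σ‖ < δ := by
    rw [← hσz, norm_pow] at hzR
    exact lt_of_pow_lt_pow_left₀ 2 hδ0.le hzR
  have hσ0 := h.ne_zero_of_onRight hright
  have hzσ : z = β a + σ ^ 2 := by rw [hσz]; ring
  have hσd₁ : ‖σ‖ < d₁ := hσδ.trans_le l1
  have hσd : ‖σ‖ < d := hσd₁.trans_le (min_le_left _ _)
  obtain ⟨-, hsq⟩ := hsqrt σ hσd (hright.mono (by linarith [hρ₂.2]) hρ₂.2.le)
  obtain ⟨hGσ, hσW⟩ := hGb (show dist σ 0 < d₃ by simpa using hσδ.trans_le l3)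
  have hRσ := hRb (show dist z (β a) < d₄ by
    rw [dist_eq_norm]
    calc ‖z - β a‖ < √d₄ ^ 2 := hδle _ l4
      _ = d₄ := Real.sq_sqrt hd₄.le)
  have hpF : ∀ r ∈ Ioc 0 ρ₂, p (a + r ^ 2) = F (τ r) / τ r := fun r hr => by
    have hrI : r ∈ Icc (-ρ₂) ρ₂ := ⟨by linarith [hr.1, hρ₂.1], hr.2⟩
    have hr2 : r ^ 2 ≤ ρ₂ ^ 2 := by have := hr.1; gcongr; exact hr.2
    have hβr : β a + τ r ^ 2 = β (a + r ^ 2) := by rw [h.sq r hrI]; ring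
    rw [hpm _ ⟨by nlinarith [hr.1], by linarith⟩, h₁.rightSqrt_eq hβ hρ₁a.le hn.continuousOn
      (fun σ h1 h2 => (hsqrt σ h1 h2).2) ⟨hr.1, hr.2.trans_lt hρ₂.2⟩
      ((hρ₂d r hrI).trans_le (min_le_left _ _)), hF]
    simp only [hβr]
    rw [div_div, mul_comm (n _)]
  have hFc : ContinuousOn (fun r => F (τ r)) (Icc (-ρ₂) ρ₂) :=
    hFd.continuousOn.comp h.straight.continuousOn fun r hr => by simpa using hρ₂d r hr
  have key := h.integral_cauchy hβ hFc (fun x => by simp [hF]) hpF hσ0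
    (h.straight.notMem_of_onRight hright)
  rw [(hGint σ hσW).1 hright, ← hzσ] at key
  have hpi : (Real.pi : ℂ) * Complex.I ≠ 0 :=
    mul_ne_zero (by exact_mod_cast Real.pi_ne_zero) Complex.I_ne_zero
  -- The term `F(σ)/σ` from the quotient cancels against the one from the Plemelj formula on the
  -- right. What remains is `G(σ)/σ` with `G` bounded near `0`, and `|σ| = |z - β a|^{1/2}`.
  have hval : arcDefect β a b m p z = 1 / (Real.pi * Complex.I) * (G σ / σ +
      ∫ s in (a + ρ₂ ^ 2)..b, p s * deriv β s / (β s - z)) := by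
    rw [arcDefect, ← intervalIntegral.integral_add_adjacent_intervals
      (hβ.intervalIntegrable_cauchy ha2 i1 (hzK₂ _ _ le_rfl hρ₂b.le))
      (hβ.intervalIntegrable_cauchy hρ₂b.le i2 (hzK₂ _ _ ha2 le_rfl)), key, hzσ, hsq]
    have := hn0 _ (hbn (hmem σ hσd₁))
    simp only [hF]
    field_simp
    ring
  have hnorm : ‖1 / (Real.pi * Complex.I)‖ ≤ (1 : ℝ) := by
    rw [norm_div, norm_mul, Complex.norm_I, norm_one, mul_one, Complex.norm_real, Real.norm_eq_abs,
      abs_of_pos Real.pi_pos, div_le_one Real.pi_pos]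
    linarith [Real.pi_gt_three]
  have hσn : 0 < ‖σ‖ := norm_pos_iff.2 hσ0
  have hs : √‖z - β a‖ = ‖σ‖ := by rw [← hσz, norm_pow, Real.sqrt_sq hσn.le]
  rw [hval, hs, norm_mul]
  calc ‖1 / (Real.pi * Complex.I)‖ * ‖G σ / σ + ∫ s in (a + ρ₂ ^ 2)..b, p s * deriv β s / (β s - z)‖
      ≤ 1 * (C₁ / ‖σ‖ + C₂) := by
        gcongr
        refine (norm_add_le _ _).trans (add_le_add ?_ hRσ.le)
        rw [norm_div]
        exact div_le_div_of_nonneg_right hGσ.le hσn.le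
    _ ≤ (C₁ + C₂) / ‖σ‖ := by
        rw [one_mul, add_div C₁ C₂]
        refine add_le_add le_rfl ?_
        rw [le_div_iff₀ hσn]
        exact mul_le_of_le_one_right (by positivity) (hσδ.le.trans l5)

end SqrtCurve

namespace RegularArc

variable {β : ℝ → ℂ} {a b : ℝ} {m : ℂ → ℂ} {p : ℝ → ℂ} {V : Set ℂ}

/-- Across the open arc the jump is already gone, which gives an analytic function on a punctured
disc about `β a`. It is `O(|z - β a|^{-1/2})`, hence `o(|z - β a|^{-1})`, and the singularity is
removable. -/
theorem arcDefect_extends_left (h : RegularArc β) (hab : a < b) (hV : IsOpen V)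
    (harc : ∀ s ∈ Icc a b, β s ∈ V)
    (hm : DifferentiableOn ℂ m V) (hp : IntervalIntegrable p volume a b)
    (hpm : ∀ s ∈ Ioo a b, p s = m (β s) / rightSqrt β a b s) :
    ∃ R > 0, ∃ G : ℂ → ℂ, DifferentiableOn ℂ G (Metric.ball (β a) R) ∧
      ∀ z ∈ Metric.ball (β a) R \ β '' Icc a b, arcDefect β a b m p z = G z := by
  obtain ⟨ρ, τ, τ', e, hS⟩ := h.exists_sqrtCurve a
  have haV := harc a (left_mem_Icc.2 hab.le)
  obtain ⟨R₀, hR₀, C, hC⟩ := hS.exists_arcDefect_bound h hab hV haV hm hp hpm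
  obtain ⟨R₁, hR₁, hRV⟩ := Metric.isOpen_iff.1 hV _ haV
  have hne : β a ≠ β b := fun h0 => hab.ne (h.inj h0)
  set R := min (min R₀ R₁) (dist (β b) (β a)) with hR
  have hR0 : 0 < R := lt_min (lt_min hR₀ hR₁) (dist_pos.2 hne.symm)
  set K := β '' Icc a b with hK
  set U := Metric.ball (β a) R \ {β a} with hU
  have hUo : IsOpen U := Metric.isOpen_ball.sdiff isClosed_singleton
  have hUV : U ⊆ V := sdiff_subset.trans ((Metric.ball_subset_ball
    ((min_le_left _ _).trans (min_le_right _ _))).trans hRV)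
  obtain ⟨G, hG, hGD⟩ := exists_differentiableOn_extension (h.isClosed_image a b)
    (h.dense_compl_image a b) hUo (D := arcDefect β a b m p)
    ((h.differentiableOn_arcDefect hab.le hm hp).mono (sdiff_subset_sdiff_left hUV)) (by
      rintro _ ⟨hpU, s, hs, rfl⟩
      refine h.arcDefect_extends_interior hV hm hp hpm ⟨hs.1.lt_of_ne ?_, hs.2.lt_of_ne ?_⟩ (harc s hs)
      · rintro rfl; exact hpU.2 rfl
      · rintro rfl
        have h1 := Metric.mem_ball.1 hpU.1
        exact absurd h1 (not_lt.2 (min_le_right _ _)))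
  have hGb : ∀ z ∈ U, ‖G z‖ ≤ C / √‖z - β a‖ := fun z hz => by
    have hcl : z ∈ closure (U ∩ Kᶜ) := by
      have h1 := (h.dense_compl_image a b).open_subset_closure_inter hUo
      exact h1 hz
    have := mem_closure_iff_nhdsWithin_neBot.1 hcl
    have hc : ContinuousAt G z := hG.continuousOn.continuousAt (hUo.mem_nhds hz)
    have h0 : √‖z - β a‖ ≠ 0 := (Real.sqrt_pos.2 (norm_pos_iff.2 (sub_ne_zero.2 hz.2))).ne'
    have hc2 : ContinuousAt (fun z => C / √‖z - β a‖) z :=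
      ContinuousAt.div continuousAt_const (by fun_prop) h0
    refine le_of_tendsto_of_tendsto (hc.norm.tendsto.mono_left nhdsWithin_le_nhds)
      (hc2.tendsto.mono_left nhdsWithin_le_nhds) (b := 𝓝[U ∩ Kᶜ] z) ?_
    filter_upwards [self_mem_nhdsWithin] with w hw
    rw [hGD w ⟨hw.1, hw.2⟩]
    exact hC w ⟨Metric.ball_subset_ball ((min_le_left _ _).trans (min_le_left _ _)) hw.1.1, hw.2⟩
  have ho : (fun z => G z - G (β a)) =o[𝓝[≠] β a] fun z => (z - β a)⁻¹ := by
    rw [Asymptotics.isLittleO_iff]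
    intro ε hε
    have hc : Continuous fun z => C * √‖z - β a‖ + ‖G (β a)‖ * ‖z - β a‖ := by fun_prop
    have h1 := hc.continuousAt.eventually (gt_mem_nhds
      (show C * √‖β a - β a‖ + ‖G (β a)‖ * ‖β a - β a‖ < ε by simpa using hε))
    filter_upwards [mem_nhdsWithin_of_mem_nhds h1, self_mem_nhdsWithin,
      mem_nhdsWithin_of_mem_nhds (Metric.ball_mem_nhds (β a) hR0)] with z h1 h2 h3
    have hn : 0 < ‖z - β a‖ := norm_pos_iff.2 (sub_ne_zero.2 h2)
    have hs : 0 < √‖z - β a‖ := Real.sqrt_pos.2 hn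
    have hss : √‖z - β a‖ * √‖z - β a‖ = ‖z - β a‖ := Real.mul_self_sqrt hn.le
    rw [norm_inv, ← div_eq_mul_inv, le_div_iff₀ hn]
    calc ‖G z - G (β a)‖ * ‖z - β a‖ ≤ (C / √‖z - β a‖ + ‖G (β a)‖) * ‖z - β a‖ := by
          gcongr
          exact (norm_sub_le _ _).trans (by gcongr; exact hGb z ⟨h3, h2⟩)
      _ = C * √‖z - β a‖ + ‖G (β a)‖ * ‖z - β a‖ := by
          rw [add_mul]
          congr 1
          rw [div_mul_eq_mul_div, div_eq_iff hs.ne', mul_assoc, hss]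
      _ ≤ ε := h1.le
  refine ⟨R, hR0, _, Complex.differentiableOn_update_limUnder_of_isLittleO
    (Metric.ball_mem_nhds _ hR0) hG ho, ?_⟩
  rintro z ⟨hz, hzK⟩
  have hza : z ≠ β a := by rintro rfl; exact hzK ⟨a, left_mem_Icc.2 hab.le, rfl⟩
  rw [Function.update_of_ne hza, hGD z ⟨⟨hz, hza⟩, hzK⟩]

/-- The right of the reversed arc is the left of the original one, where the boundary value has the
opposite sign. -/
theorem rightSqrt_reverse (h : RegularArc β) (hab : a ≤ b) {s : ℝ} (hs : s ∈ Ioo a b) :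
    rightSqrt (fun s => β (-s)) (-b) (-a) (-s) = -rightSqrt β a b s := by
  obtain ⟨-, hleft, hright, -⟩ := h.tendsto_rightSqrt hs
  obtain ⟨hr, -, hoff, -⟩ := h.reverse.tendsto_rightSqrt (a := -b) (b := -a) (s := -s)
    ⟨by linarith [hs.2], by linarith [hs.1]⟩
  refine tendsto_nhds_unique hr (hleft.congr' ?_)
  filter_upwards [hoff] with w hw
  have hd : deriv (fun s => β (-s)) (-s) = -deriv β s := by rw [deriv_comp_neg, neg_neg]
  have him : (fun s => β (-s)) '' Icc (-b) (-a) = β '' Icc a b := by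
    rw [show (fun s => β (-s)) = β ∘ Neg.neg from rfl, image_comp, Set.image_neg_eq_neg]; simp
  rw [hd, neg_neg, him, mul_neg, ← sub_eq_add_neg] at hw
  rw [hd, neg_neg, mul_neg, ← sub_eq_add_neg, h.arcSqrt_reverse hab hw]

theorem arcDefect_reverse (h : RegularArc β) (hab : a ≤ b) {z : ℂ} (hz : z ∉ β '' Icc a b) :
    arcDefect (fun s => β (-s)) (-b) (-a) m (fun s => -p (-s)) z = arcDefect β a b m p z := by
  have hd : ∀ s, deriv (fun s => β (-s)) s = -deriv β (-s) := fun s => deriv_comp_neg β s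
  rw [arcDefect, arcDefect, h.arcSqrt_reverse hab hz]
  congr 2
  simp only [hd, neg_mul_neg]
  rw [intervalIntegral.integral_comp_neg (fun s => p s * deriv β s / (β s - z)), neg_neg, neg_neg]

theorem arcDefect_extends_right (h : RegularArc β) (hab : a < b) (hV : IsOpen V)
    (harc : ∀ s ∈ Icc a b, β s ∈ V)
    (hm : DifferentiableOn ℂ m V) (hp : IntervalIntegrable p volume a b)
    (hpm : ∀ s ∈ Ioo a b, p s = m (β s) / rightSqrt β a b s) :
    ∃ R > 0, ∃ G : ℂ → ℂ, DifferentiableOn ℂ G (Metric.ball (β b) R) ∧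
      ∀ z ∈ Metric.ball (β b) R \ β '' Icc a b, arcDefect β a b m p z = G z := by
  have hp' : IntervalIntegrable (fun s => -p (-s)) volume (-b) (-a) := by
    have := (IntervalIntegrable.iff_comp_neg (by simp)).1 hp
    exact this.symm.neg
  obtain ⟨R, hR, G, hG, H⟩ := h.reverse.arcDefect_extends_left (a := -b) (b := -a)
    (p := fun s => -p (-s)) (neg_lt_neg hab) hV
    (fun s hs => harc (-s) ⟨by linarith [hs.2], by linarith [hs.1]⟩) hm hp' (fun s hs => by
      have hs' : -s ∈ Ioo a b := ⟨by linarith [hs.2], by linarith [hs.1]⟩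
      have := h.rightSqrt_reverse hab.le hs'
      rw [neg_neg] at this
      rw [hpm _ hs', this, div_neg])
  simp only [neg_neg] at hG H
  have him : (fun s => β (-s)) '' Icc (-b) (-a) = β '' Icc a b := by
    rw [show (fun s => β (-s)) = β ∘ Neg.neg from rfl, image_comp, Set.image_neg_eq_neg]; simp
  refine ⟨R, hR, G, hG, fun z hz => ?_⟩
  rw [← H z (by rwa [him]), h.arcDefect_reverse hab.le hz.2]

/-- The function `arcDefect` extends analytically across the arc. -/
theorem exists_arcDefect_extension (h : RegularArc β) (hab : a < b) (hV : IsOpen V)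
    (harc : ∀ s ∈ Icc a b, β s ∈ V)
    (hm : DifferentiableOn ℂ m V) (hp : IntervalIntegrable p volume a b)
    (hpm : ∀ s ∈ Ioo a b, p s = m (β s) / rightSqrt β a b s) :
    ∃ G : ℂ → ℂ, DifferentiableOn ℂ G V ∧
      ∀ z ∈ V \ β '' Icc a b, G z = arcDefect β a b m p z := by
  refine exists_differentiableOn_extension (h.isClosed_image a b) (h.dense_compl_image a b) hV
    (h.differentiableOn_arcDefect hab.le hm hp) ?_
  rintro _ ⟨hpU, s, hs, rfl⟩
  rcases hs.1.eq_or_lt with rfl | h1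
  · exact h.arcDefect_extends_left hab hV harc hm hp hpm
  rcases hs.2.eq_or_lt with rfl | h2
  · exact h.arcDefect_extends_right hab hV harc hm hp hpm
  · exact h.arcDefect_extends_interior hV hm hp hpm ⟨h1, h2⟩ hpU

end RegularArc

/-! ### Integrability at the end points and behaviour at infinity. -/

theorem intervalIntegrable_inv_sqrt_abs (a x y : ℝ) :
    IntervalIntegrable (fun s => (√|s - a|)⁻¹) volume x y := by
  have h0 : ∀ y, 0 ≤ y → IntervalIntegrable (fun s : ℝ => (√|s|)⁻¹) volume 0 y := fun y hy => by
    refine (intervalIntegral.intervalIntegrable_rpow' (r := -(1 / 2)) (by norm_num)).congr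
      fun s hs => ?_
    rw [uIoc_of_le hy] at hs
    rw [abs_of_pos hs.1, Real.rpow_neg hs.1.le, Real.sqrt_eq_rpow]
  have h1 : ∀ y, IntervalIntegrable (fun s : ℝ => (√|s|)⁻¹) volume 0 y := fun y => by
    rcases le_total 0 y with hy | hy
    · exact h0 y hy
    · have := (IntervalIntegrable.iff_comp_neg (by simp)).1 (h0 (-y) (by linarith))
      simpa using this
  have h2 := ((h1 (x - a)).symm.trans (h1 (y - a))).comp_sub_right a
  simpa using h2

theorem tendsto_cauchy_cobounded {c f : ℝ → ℂ} {a b : ℝ} (hab : a ≤ b)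
    (hc : ContinuousOn c (Icc a b)) (hf : IntervalIntegrable f volume a b) :
    Tendsto (fun z => ∫ s in a..b, f s / (c s - z)) (Bornology.cobounded ℂ) (𝓝 0) := by
  obtain ⟨B, hB⟩ := isCompact_Icc.exists_bound_of_continuousOn hc
  have hn := tendsto_norm_cobounded_atTop (E := ℂ)
  have h1 : Tendsto (fun z : ℂ => (∫ s in a..b, ‖f s‖) / (‖z‖ - B)) (Bornology.cobounded ℂ) (𝓝 0) :=
    tendsto_const_nhds.div_atTop (tendsto_atTop_add_const_right _ (-B) hn)
  refine squeeze_zero_norm' ?_ h1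
  filter_upwards [hn.eventually_gt_atTop B] with z hz
  rw [← intervalIntegral.integral_div]
  refine intervalIntegral.norm_integral_le_of_norm_le hab (ae_of_all _ fun s hs => ?_)
    (hf.norm.div_const _)
  rw [norm_div]
  have h2 := hB s (Ioc_subset_Icc_self hs)
  have h3 : ‖z‖ - B ≤ ‖c s - z‖ := by
    have := norm_sub_norm_le z (c s)
    rw [norm_sub_rev] at this; linarith
  have : 0 < ‖z‖ - B := by linarith
  gcongr

/-- Use `z/(c - z) = c/(c - z) - 1`, where the first term is again a Cauchy integral and vanishes at
infinity. -/
theorem tendsto_mul_cauchy_cobounded {c f : ℝ → ℂ} {a b : ℝ} (hab : a ≤ b)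
    (hc : ContinuousOn c (Icc a b)) (hf : IntervalIntegrable f volume a b) :
    Tendsto (fun z => z * ∫ s in a..b, f s / (c s - z)) (Bornology.cobounded ℂ)
      (𝓝 (-∫ s in a..b, f s)) := by
  have hfc : IntervalIntegrable (fun s => f s * c s) volume a b :=
    hf.mul_continuousOn (by rwa [uIcc_of_le hab])
  have h1 := (tendsto_cauchy_cobounded hab hc hfc).add_const (-∫ s in a..b, f s)
  rw [zero_add] at h1
  refine h1.congr' ?_
  obtain ⟨B, hB⟩ := isCompact_Icc.exists_bound_of_continuousOn hc
  filter_upwards [(tendsto_norm_cobounded_atTop (E := ℂ)).eventually_gt_atTop B] with z hz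
  have hne : ∀ s ∈ Icc a b, c s - z ≠ 0 := fun s hs h0 => by
    have := hB s hs
    rw [sub_eq_zero.1 h0] at this; linarith
  have hinv : ContinuousOn (fun s => (c s - z)⁻¹) (uIcc a b) := by
    rw [uIcc_of_le hab]; exact (hc.sub continuousOn_const).inv₀ hne
  rw [← intervalIntegral.integral_const_mul, ← sub_eq_add_neg,
    ← intervalIntegral.integral_sub (by simpa only [div_eq_mul_inv] using hfc.mul_continuousOn hinv) hf]
  refine intervalIntegral.integral_congr fun s hs => ?_
  rw [uIcc_of_le hab] at hs
  have := hne s hs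
  field_simp
  ring

namespace RegularArc

variable {β : ℝ → ℂ} {a b : ℝ} {m : ℂ → ℂ} {p : ℝ → ℂ} {V : Set ℂ}

theorem tendsto_arcSqrt_div (h : RegularArc β) (hab : a ≤ b) :
    Tendsto (fun z => arcSqrt β a b z / z) (Bornology.cobounded ℂ) (𝓝 1) := by
  have h1 := tendsto_cauchy_cobounded hab h.contDiff.continuous.continuousOn
    ((h.contDiff.continuous_deriv le_rfl).intervalIntegrable a b)
  have h2 : Tendsto (fun z => Complex.exp (logRatio β a b z / 2)) (Bornology.cobounded ℂ) (𝓝 1) := by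
    have h3 := (h1.neg.div_const 2).cexp
    simp only [neg_zero, zero_div, Complex.exp_zero] at h3
    exact h3.congr fun z => by rw [logRatio_eq_neg]
  have h4 : Tendsto (fun z : ℂ => 1 - β b * z⁻¹) (Bornology.cobounded ℂ) (𝓝 1) := by
    simpa using (tendsto_inv₀_cobounded (α := ℂ)).const_mul (β b) |>.const_sub 1
  have h5 := h4.mul h2
  rw [one_mul] at h5
  refine h5.congr' ?_
  filter_upwards [(tendsto_norm_cobounded_atTop (E := ℂ)).eventually_gt_atTop 0] with z hz
  have hz0 : z ≠ 0 := norm_pos_iff.1 hz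
  rw [arcSqrt]; field_simp

theorem continuousOn_rightSqrt (h : RegularArc β) : ContinuousOn (rightSqrt β a b) (Ioo a b) :=
  fun _ hs => (h.tendsto_rightSqrt hs).2.2.2.2.2.continuousWithinAt

/-- The chord bound gives `|√| ≥ κ √((s - a)(b - s))`, and one of the two distances is at least half
the length, so each singularity can be estimated separately. -/
theorem exists_norm_rightSqrt_ge (h : RegularArc β) (hab : a < b) : ∃ C, ∀ s ∈ Ioo a b,
    ‖(rightSqrt β a b s)⁻¹‖ ≤ C * ((√|s - a|)⁻¹ + (√|s - b|)⁻¹) := by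
  obtain ⟨κ, hκ, H⟩ := exists_chord_bound h.contDiff h.inj h.deriv_ne a b
  refine ⟨(κ * √((b - a) / 2))⁻¹, fun s hs => ?_⟩
  have hsq := (h.tendsto_rightSqrt hs).2.2.2.1
  have ha : 0 < s - a := by linarith [hs.1]
  have hb : 0 < b - s := by linarith [hs.2]
  have hL : 0 < (b - a) / 2 := by linarith [hs.1, hs.2]
  have hsI := Ioo_subset_Icc_self hs
  have h1 := H s hsI a (left_mem_Icc.2 hab.le)
  have h2 := H s hsI b (right_mem_Icc.2 hab.le)
  rw [abs_of_pos ha] at h1 ⊢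
  rw [abs_sub_comm, abs_of_pos hb] at h2 ⊢
  have h3 : κ ^ 2 * ((s - a) * (b - s)) ≤ ‖rightSqrt β a b s‖ ^ 2 := by
    rw [← norm_pow, hsq, norm_mul]
    calc κ ^ 2 * ((s - a) * (b - s)) = (κ * (s - a)) * (κ * (b - s)) := by ring
      _ ≤ _ := by gcongr
  have h4 : κ * (√(s - a) * √(b - s)) ≤ ‖rightSqrt β a b s‖ := by
    refine abs_le_of_sq_le_sq' ?_ (norm_nonneg _) |>.2
    rw [mul_pow, mul_pow, Real.sq_sqrt ha.le, Real.sq_sqrt hb.le]; exact h3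
  have p1 := Real.sqrt_pos.2 ha
  have p2 := Real.sqrt_pos.2 hb
  have p3 := Real.sqrt_pos.2 hL
  rw [norm_inv]
  calc ‖rightSqrt β a b s‖⁻¹ ≤ (κ * (√(s - a) * √(b - s)))⁻¹ := by gcongr
    _ ≤ (κ * √((b - a) / 2))⁻¹ * ((√(s - a))⁻¹ + (√(b - s))⁻¹) := by
      rw [mul_inv κ, mul_inv κ, mul_assoc]
      gcongr
      have h5 : √((b - a) / 2) ≤ √(s - a) + √(b - s) := by
        rcases le_total (s - a) (b - s) with h6 | h6
        · have := Real.sqrt_le_sqrt (show (b - a) / 2 ≤ b - s by linarith); linarith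
        · have := Real.sqrt_le_sqrt (show (b - a) / 2 ≤ s - a by linarith); linarith
      rw [show (√((b - a) / 2))⁻¹ * ((√(s - a))⁻¹ + (√(b - s))⁻¹) =
        (√(s - a) * √(b - s))⁻¹ * ((√(s - a) + √(b - s)) / √((b - a) / 2)) by field_simp; ring]
      refine le_mul_of_one_le_right (by positivity) ?_
      rwa [le_div_iff₀ p3, one_mul]

theorem intervalIntegrable_inv_rightSqrt (h : RegularArc β) (hab : a < b) :
    IntervalIntegrable (fun s => (rightSqrt β a b s)⁻¹) volume a b := by
  obtain ⟨C, hC⟩ := h.exists_norm_rightSqrt_ge hab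
  have hdom := ((intervalIntegrable_inv_sqrt_abs a a b).add
    (intervalIntegrable_inv_sqrt_abs b a b)).const_mul C
  rw [intervalIntegrable_iff_integrableOn_Ioo_of_le hab.le] at hdom ⊢
  refine Integrable.mono' hdom ?_ ((ae_restrict_mem measurableSet_Ioo).mono fun s hs => hC s hs)
  exact (h.continuousOn_rightSqrt.inv₀ fun s hs =>
    (h.tendsto_rightSqrt hs).2.2.2.2.1).aestronglyMeasurable measurableSet_Ioo

end RegularArc

theorem differentiableOn_conj_conj {f : ℂ → ℂ} {U : Set ℂ} (hU : IsOpen U)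
    (hf : DifferentiableOn ℂ f U) :
    DifferentiableOn ℂ (fun z => conj (f (conj z))) {z | conj z ∈ U} := fun z hz => by
  have := (hf.differentiableAt (hU.mem_nhds hz)).conj_conj
  rw [Complex.conj_conj] at this
  exact this.differentiableWithinAt

theorem tendsto_conj_cobounded : Tendsto (fun z : ℂ => conj z) (Bornology.cobounded ℂ)
    (Bornology.cobounded ℂ) := by
  rw [← tendsto_norm_atTop_iff_cobounded]
  simpa using tendsto_norm_cobounded_atTop (E := ℂ)

theorem eventually_cobounded_notMem {K : Set ℂ} (hK : IsCompact K) :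
    ∀ᶠ z in Bornology.cobounded ℂ, z ∉ K :=
  Bornology.isBounded_def.1 hK.isBounded

theorem eventually_cobounded_ne_zero : ∀ᶠ z : ℂ in Bornology.cobounded ℂ, z ≠ 0 :=
  (eventually_cobounded_notMem (isCompact_singleton (x := (0 : ℂ)))).mono fun _ h => h

namespace RegularArc

variable {α : ℝ → ℂ} {a b : ℝ}

/-! ### The interaction identity. -/

/-- The boundary value on `α [a, b]` of `√((z - α a)(z - α b))` times its Schwarz reflection. -/
noncomputable def symSqrt (α : ℝ → ℂ) (a b s : ℝ) : ℂ :=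
  conj (arcSqrt α a b (conj (α s))) * rightSqrt α a b s

/-- Liouville's theorem. The function `(z - c)/(M(z) conj(M(conj z)))` is `1/z` to leading order at
infinity and jumps only on two conjugate arcs. Compensating both jumps by Cauchy integrals leaves an
entire function that vanishes, so the residues at infinity of these integrals must balance `1`. The
contributions of the two arcs are conjugate, so only an imaginary part is determined. -/
theorem im_integral_eq (h : RegularArc α) (hab : a < b) (him : ∀ s ∈ Icc a b, 0 < (α s).im) (c : ℝ) :
    IntervalIntegrable (fun s => (α s - c) / symSqrt α a b s * deriv α s) volume a b ∧
    (∫ s in a..b, (α s - c) / symSqrt α a b s * deriv α s).im = Real.pi / 2 := by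
  set K := α '' Icc a b with hK
  have hKcomp : IsCompact K := isCompact_Icc.image h.contDiff.continuous
  have hKim : ∀ z ∈ K, 0 < z.im := by rintro _ ⟨s, hs, rfl⟩; exact him s hs
  set V : Set ℂ := {z | conj z ∈ Kᶜ} with hV
  have hVo : IsOpen V := hKcomp.isClosed.isOpen_compl.preimage Complex.continuous_conj
  have hKV : ∀ z ∈ K, z ∈ V := fun z hz hz' => by
    have h1 := hKim _ hz; have h2 := hKim _ hz'
    rw [Complex.conj_im] at h2; linarith
  set M := arcSqrt α a b with hM
  set Mc : ℂ → ℂ := fun z => conj (M (conj z)) with hMc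
  have hMd : DifferentiableOn ℂ M Kᶜ := h.differentiableOn_arcSqrt hab.le
  have hMcd : DifferentiableOn ℂ Mc V := differentiableOn_conj_conj hKcomp.isClosed.isOpen_compl hMd
  have hM0 : ∀ z ∈ Kᶜ, M z ≠ 0 := fun z hz h0 => by
    have := h.arcSqrt_sq hab.le hz
    rw [← hM, h0, zero_pow two_ne_zero] at this
    rcases mul_eq_zero.1 this.symm with h1 | h1
    · exact hz ⟨a, left_mem_Icc.2 hab.le, (sub_eq_zero.1 h1).symm⟩
    · exact hz ⟨b, right_mem_Icc.2 hab.le, (sub_eq_zero.1 h1).symm⟩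
  have hMc0 : ∀ z ∈ V, Mc z ≠ 0 := fun z hz => by
    simpa [hMc] using hM0 _ hz
  set m : ℂ → ℂ := fun z => (z - c) / Mc z with hm
  have hmd : DifferentiableOn ℂ m V := (differentiableOn_id.sub_const _).div hMcd hMc0
  set p : ℝ → ℂ := fun s => m (α s) / rightSqrt α a b s with hp
  have hpi : IntervalIntegrable p volume a b := by
    simp only [hp, div_eq_mul_inv (m _)]
    refine (h.intervalIntegrable_inv_rightSqrt hab).continuousOn_mul ?_
    rw [uIcc_of_le hab.le]
    exact hmd.continuousOn.comp h.contDiff.continuous.continuousOn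
      fun s hs => hKV _ ⟨s, hs, rfl⟩
  have hpp : ∀ s, (α s - c) / symSqrt α a b s * deriv α s = p s * deriv α s := fun s => by
    simp only [symSqrt, hp, hm, hMc, hM, div_div]
  simp only [hpp]
  have hpd := h.intervalIntegrable_mul_deriv hpi
  refine ⟨hpd, ?_⟩
  obtain ⟨G, hG, hGD⟩ := h.exists_arcDefect_extension hab hVo (fun s hs => hKV _ ⟨s, hs, rfl⟩) hmd hpi
    (fun s _ => rfl)
  set κ : ℂ := 1 / (Real.pi * Complex.I) with hκ
  set Φ : ℂ → ℂ := fun z => κ * ∫ s in a..b, p s * deriv α s / (α s - z) with hΦ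
  have hΦd : DifferentiableOn ℂ Φ Kᶜ := (h.differentiableOn_cauchy hab.le hpi).const_mul _
  -- Here `G` has no jump on the arc, and the reflected Cauchy integral is meant to cancel the jump
  -- on the conjugate arc. Since `c` is real the sum is Schwarz symmetric.
  set D₁ : ℂ → ℂ := fun z => G z + conj (Φ (conj z)) with hD₁
  have hD₁d : DifferentiableOn ℂ D₁ V :=
    hG.add (differentiableOn_conj_conj hKcomp.isClosed.isOpen_compl hΦd)
  have hD₁e : ∀ z ∈ V, z ∉ K → D₁ z = (z - c) / (M z * Mc z) + Φ z + conj (Φ (conj z)) :=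
    fun z hz hzK => by
      simp only [hD₁]
      rw [hGD z ⟨hz, hzK⟩, arcDefect]
      simp only [hm, hΦ, div_div, mul_comm (Mc z), hM, ← hκ]
  have hsym : ∀ z ∈ V, z ∉ K → conj (D₁ (conj z)) = D₁ z := fun z hz hzK => by
    rw [hD₁e z hz hzK, hD₁e (conj z) (by simpa [hV] using hzK) hz]
    simp only [map_add, map_div₀, map_sub, map_mul, Complex.conj_conj, Complex.conj_ofReal, hMc]
    ring
  classical
  -- By this symmetry the reflection of `D₁` continues it across the conjugate arc, and no second
  -- jump computation is needed.
  set E : ℂ → ℂ := fun z => if z ∈ V then D₁ z else conj (D₁ (conj z)) with hE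
  have hEd : Differentiable ℂ E := fun z => by
    by_cases hz : z ∈ V
    · refine (hD₁d.differentiableAt (hVo.mem_nhds hz)).congr_of_eventuallyEq ?_
      filter_upwards [hVo.mem_nhds hz] with w hw
      simp only [hE, if_pos hw]
    · have hz' : conj z ∈ K := by simpa [hV] using hz
      have hzK : z ∈ Kᶜ := fun hzK => hKV _ hzK hz'
      have h1 := (differentiableOn_conj_conj hVo hD₁d).differentiableAt
        ((hVo.preimage Complex.continuous_conj).mem_nhds (hKV _ hz'))
      refine h1.congr_of_eventuallyEq ?_
      filter_upwards [hKcomp.isClosed.isOpen_compl.mem_nhds hzK] with w hw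
      by_cases hwV : w ∈ V
      · simp only [hE, if_pos hwV, hsym w hwV hw]
      · simp only [hE, if_neg hwV]
  set Z := ∫ s in a..b, p s * deriv α s with hZ
  have t1 : Tendsto (fun z => z * Φ z) (Bornology.cobounded ℂ) (𝓝 (κ * -Z)) := by
    refine ((tendsto_mul_cauchy_cobounded hab.le h.contDiff.continuous.continuousOn hpd).const_mul
      κ).congr fun z => ?_
    simp only [hΦ]; ring
  have t2 : Tendsto (fun z => z * conj (Φ (conj z))) (Bornology.cobounded ℂ) (𝓝 (conj (κ * -Z))) := by
    refine ((Complex.continuous_conj.tendsto _).comp (t1.comp tendsto_conj_cobounded)).congr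
      fun z => ?_
    simp [Function.comp]
  have t3 := h.tendsto_arcSqrt_div hab.le
  have t4 : Tendsto (fun z => Mc z / z) (Bornology.cobounded ℂ) (𝓝 1) := by
    have := (Complex.continuous_conj.tendsto _).comp (t3.comp tendsto_conj_cobounded)
    rw [map_one] at this
    refine this.congr fun z => ?_
    simp [Function.comp, hMc, hM]
  have t5 : Tendsto (fun z : ℂ => 1 - c * z⁻¹) (Bornology.cobounded ℂ) (𝓝 1) := by
    simpa using (tendsto_inv₀_cobounded (α := ℂ)).const_mul (c : ℂ) |>.const_sub 1
  have t6 : Tendsto (fun z => (1 - c * z⁻¹) / (M z / z * (Mc z / z))) (Bornology.cobounded ℂ) (𝓝 1) := by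
    have := t5.div (t3.mul t4) (by simp)
    rwa [mul_one, div_one] at this
  have t7 : Tendsto (fun z => z * E z) (Bornology.cobounded ℂ)
      (𝓝 (1 + κ * -Z + conj (κ * -Z))) := by
    refine ((t6.add t1).add t2).congr' ?_
    filter_upwards [eventually_cobounded_ne_zero, eventually_cobounded_notMem hKcomp,
      tendsto_conj_cobounded.eventually (eventually_cobounded_notMem hKcomp)] with z hz0 hz1 hz2
    have hzV : z ∈ V := hz2
    simp only [hE, if_pos hzV, hD₁e z hzV hz1]
    have h1 := hM0 z hz1
    have h2 := hMc0 z hzV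
    field_simp
  have hE0 : Tendsto E (cocompact ℂ) (𝓝 0) := by
    rw [← Metric.cobounded_eq_cocompact]
    have := t7.mul (tendsto_inv₀_cobounded (α := ℂ))
    rw [mul_zero] at this
    refine this.congr' ?_
    filter_upwards [eventually_cobounded_ne_zero] with z hz
    field_simp
  have hEz := hEd.eq_const_of_tendsto_cocompact hE0
  rw [hEz] at t7
  simp only [Function.const_apply, mul_zero] at t7
  -- The coefficient of `1/z` at infinity is `0 = 1 - κ Z - conj (κ Z)`; as `κ = -i/π`, its real
  -- part determines `Z.im`.
  have hL := tendsto_nhds_unique t7 tendsto_const_nhds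
  have hre := congrArg Complex.re hL
  simp only [Complex.add_re, Complex.conj_re, Complex.one_re, Complex.zero_re] at hre
  have hκI : κ = -((1 / Real.pi : ℝ) : ℂ) * Complex.I := by
    rw [hκ]
    have : (Real.pi : ℂ) ≠ 0 := by exact_mod_cast Real.pi_ne_zero
    push_cast
    field_simp
    simp
  have : (κ * -Z).re = -(1 / Real.pi * Z.im) := by
    rw [hκI, show -((1 / Real.pi : ℝ) : ℂ) * Complex.I * -Z = ((1 / Real.pi : ℝ) : ℂ) * (Complex.I * Z)
      by ring, Complex.re_ofReal_mul, Complex.I_mul_re]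
    ring
  rw [this] at hre
  have hpi0 := Real.pi_pos
  field_simp at hre
  linarith

end RegularArc

/-! ### The radical as a lift along the curve. -/

/-- The standing assumptions on the curve, in terms of the parametrization. -/
structure AdmissibleCurve (α : ℝ → ℂ) (μ : ℝ) : Prop extends RegularArc α where
  im_pos : ∀ s, 0 < (α s).im
  tendsto : Tendsto α atTop (𝓝 μ)
  im_atBot : Tendsto (fun s => (α s).im) atBot (𝓝 0)
  integrableOn : ∀ y, IntegrableOn (fun s => α s - μ) (Ioi y)
  tendsto_mul : Tendsto (fun s : ℝ => (α s - μ) * s) atTop (𝓝 0)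

/-- The square root near `1`. -/
noncomputable def sqrtOne (w : ℂ) : ℂ := Complex.exp (Complex.log w / 2)

theorem sqrtOne_sq {w : ℂ} (hw : w ≠ 0) : sqrtOne w ^ 2 = w := by
  rw [sqrtOne, ← Complex.exp_nat_mul]; push_cast
  rw [mul_div_cancel₀ _ two_ne_zero, Complex.exp_log hw]

theorem sqrtOne_one : sqrtOne 1 = 1 := by simp [sqrtOne]

theorem differentiableAt_sqrtOne {w : ℂ} (hw : w ∈ Complex.slitPlane) :
    DifferentiableAt ℂ sqrtOne w := by
  have h : DifferentiableAt ℂ (fun w : ℂ => w) w := differentiableAt_id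
  exact ((h.clog hw).div_const 2).cexp

theorem mem_slitPlane_of_norm_sub_one_lt {w : ℂ} (hw : ‖w - 1‖ < 1) : w ∈ Complex.slitPlane := by
  have := Complex.mem_slitPlane_of_norm_lt_one hw
  rwa [add_sub_cancel] at this

theorem norm_conj_sub_ofReal (z : ℂ) (x : ℝ) : ‖conj z - x‖ = ‖z - x‖ := by
  rw [← Complex.norm_conj (z - x)]; simp

section Lift

variable {α : ℝ → ℂ} {μ : ℝ} {y : ℝ} {z : ℂ}

theorem cut_anti {y' : ℝ} (h : y ≤ y') : cut α μ y' ⊆ cut α μ y := by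
  have := Ici_subset_Ici.2 h
  unfold cut
  gcongr

theorem conj_mem_cut : conj z ∈ cut α μ y ↔ z ∈ cut α μ y := by
  have h : ∀ z, z ∈ cut α μ y → conj z ∈ cut α μ y := by
    rintro z ((h | h) | h)
    · exact Or.inr ⟨z, h, rfl⟩
    · rw [mem_singleton_iff] at h
      subst h; simp [cut]
    · obtain ⟨w, hw, rfl⟩ := h
      rw [Complex.conj_conj]; exact Or.inl (Or.inl hw)
  exact ⟨fun h' => by simpa using h _ h', h z⟩

theorem ne_of_notMem_cut (hz : z ∉ cut α μ y) : z ≠ μ ∧ ∀ s, y ≤ s → z ≠ α s ∧ z ≠ conj (α s) := by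
  refine ⟨fun h => hz (Or.inl (Or.inr h)), fun s hs => ⟨fun h => hz (Or.inl (Or.inl ⟨s, hs, h.symm⟩)),
    fun h => hz (Or.inr ⟨α s, ⟨s, hs, rfl⟩, h.symm⟩)⟩⟩

theorem notMem_cut (h0 : z ≠ μ) (h : ∀ s, y ≤ s → z ≠ α s ∧ z ≠ conj (α s)) : z ∉ cut α μ y := by
  rintro ((⟨s, hs, rfl⟩ | h1) | ⟨_, ⟨s, hs, rfl⟩, rfl⟩)
  · exact (h s hs).1 rfl
  · exact h0 h1
  · exact (h s hs).2 rfl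

theorem quad_ne_zero (hz : z ∉ cut α μ y) {s : ℝ} (hs : y ≤ s) :
    (z - α s) * (z - conj (α s)) ≠ 0 :=
  mul_ne_zero (sub_ne_zero.2 ((ne_of_notMem_cut hz).2 s hs).1)
    (sub_ne_zero.2 ((ne_of_notMem_cut hz).2 s hs).2)

theorem IsRadicalLift.mono {g : ℝ → ℂ} (h : IsRadicalLift α μ z y g) {y' : ℝ} (hy : y ≤ y') :
    IsRadicalLift α μ z y' g :=
  ⟨h.1.mono (Ici_subset_Ici.2 hy), fun s hs => h.2.1 s (Ici_subset_Ici.2 hy hs), h.2.2⟩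

/-- Two lifts differ by a constant sign on the connected ray, and the common limit `-(z - μ) ≠ 0`
excludes the sign `-1`. -/
theorem IsRadicalLift.eqOn (hz : z ∉ cut α μ y) {g₁ g₂ : ℝ → ℂ} (h₁ : IsRadicalLift α μ z y g₁)
    (h₂ : IsRadicalLift α μ z y g₂) : EqOn g₁ g₂ (Ici y) := by
  have hsq : EqOn (g₁ ^ 2) (g₂ ^ 2) (Ici y) := fun s hs => by
    simp only [Pi.pow_apply]
    rw [h₁.2.1 s hs, h₂.2.1 s hs]
  have hne : ∀ {s}, s ∈ Ici y → g₂ s ≠ 0 := fun {s} hs h0 => by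
    have := h₂.2.1 s hs
    rw [h0, zero_pow two_ne_zero] at this
    exact quad_ne_zero hz hs this.symm
  rcases isPreconnected_Ici.eq_or_eq_neg_of_sq_eq h₁.1 h₂.1 hsq hne with h | h
  · exact h
  · exfalso
    have h3 : Tendsto g₁ atTop (𝓝 (- -(z - μ))) := by
      refine h₂.2.2.neg.congr' ?_
      filter_upwards [eventually_ge_atTop y] with s hs
      exact (h hs).symm
    have h4 := tendsto_nhds_unique h3 h₁.2.2
    rw [neg_neg, self_eq_neg] at h4
    exact (ne_of_notMem_cut hz).1 (sub_eq_zero.1 h4)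

theorem IsRadicalLift.radical_eq (hz : z ∉ cut α μ y) {g : ℝ → ℂ} (h : IsRadicalLift α μ z y g)
    {s : ℝ} (hs : y ≤ s) : radical α μ s z = g s := by
  have hex : ∃ g, IsRadicalLift α μ z s g := ⟨g, h.mono hs⟩
  rw [radical, dif_pos hex]
  exact hex.choose_spec.eqOn (fun h' => hz (cut_anti hs h')) (h.mono hs) self_mem_Ici

theorem IsRadicalLift.radical (hz : z ∉ cut α μ y) {g : ℝ → ℂ} (h : IsRadicalLift α μ z y g) :
    IsRadicalLift α μ z y fun s => radical α μ s z :=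
  ⟨h.1.congr fun _ hs => h.radical_eq hz hs, fun s hs => by
    simp only [h.radical_eq hz hs]; exact h.2.1 s hs, h.2.2.congr' (by
    filter_upwards [eventually_ge_atTop y] with s hs
    exact (h.radical_eq hz hs).symm)⟩

end Lift

namespace AdmissibleCurve

variable {α : ℝ → ℂ} {μ : ℝ} {y : ℝ} {z : ℂ}

theorem continuous (h : AdmissibleCurve α μ) : Continuous α := h.contDiff.continuous

theorem eventually_norm_le (h : AdmissibleCurve α μ) {ε : ℝ} (hε : 0 < ε) (y : ℝ) :
    ∃ T ≥ y, ∀ s ≥ T, ‖α s - μ‖ ≤ ε := by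
  obtain ⟨T, hT⟩ := eventually_atTop.1
    (((h.tendsto.sub_const (μ : ℂ)).norm).eventually (ge_mem_nhds (by simpa using hε)))
  exact ⟨max T y, le_max_right _ _, fun s hs => hT s ((le_max_left _ _).trans hs)⟩

/-- A tail of the curve and its conjugate stay in a small disc about `μ`, away from `z`; the rest of
the cut is compact. -/
theorem isOpen_compl_cut (h : AdmissibleCurve α μ) (y : ℝ) : IsOpen (cut α μ y)ᶜ := by
  rw [isOpen_iff_mem_nhds]
  intro z hz
  have hz0 : 0 < ‖z - μ‖ := norm_pos_iff.2 (sub_ne_zero.2 (ne_of_notMem_cut hz).1)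
  obtain ⟨T, hT, H⟩ := h.eventually_norm_le (half_pos hz0) y
  have hK : IsCompact (α '' Icc y T) := isCompact_Icc.image h.continuous
  have hK' : IsCompact (conj '' (α '' Icc y T)) := hK.image Complex.continuous_conj
  have h1 : z ∉ α '' Icc y T := fun h' => hz (Or.inl (Or.inl (image_mono Icc_subset_Ici_self h')))
  have h2 : z ∉ conj '' (α '' Icc y T) := fun h' =>
    hz (Or.inr (image_mono (image_mono Icc_subset_Ici_self) h'))
  filter_upwards [Metric.ball_mem_nhds z (half_pos hz0), hK.isClosed.isOpen_compl.mem_nhds h1,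
    hK'.isClosed.isOpen_compl.mem_nhds h2] with w hw hw1 hw2
  have hwn : ‖z - μ‖ / 2 < ‖w - μ‖ := by
    have h3 : ‖z - μ‖ ≤ ‖w - z‖ + ‖w - μ‖ := by
      rw [norm_sub_rev w z]
      exact norm_sub_le_norm_sub_add_norm_sub _ _ _
    rw [Metric.mem_ball, dist_eq_norm] at hw
    linarith
  refine notMem_cut (fun h0 => ?_) fun s hs => ⟨?_, ?_⟩
  · rw [h0, sub_self, norm_zero] at hwn; linarith
  · rintro rfl
    rcases le_or_gt T s with h3 | h3
    · linarith [H s h3]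
    · exact hw1 ⟨s, ⟨hs, h3.le⟩, rfl⟩
  · rintro rfl
    rcases le_or_gt T s with h3 | h3
    · rw [norm_conj_sub_ofReal] at hwn
      linarith [H s h3]
    · exact hw2 ⟨_, ⟨s, ⟨hs, h3.le⟩, rfl⟩, rfl⟩

/-- `(z - α s)(z - conj (α s)) / (z - μ)²` is close to `1` for `z` far from the arc. -/
theorem quad_div_near (hz : z ≠ μ) {s : ℝ} (hs : ‖α s - μ‖ ≤ 1 / 4 * ‖z - μ‖) :
    ‖(z - α s) * (z - conj (α s)) / (z - μ) ^ 2 - 1‖ < 1 := by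
  have h0 : z - μ ≠ 0 := sub_ne_zero.2 hz
  set u := (α s - μ) / (z - μ) with hu
  set v := (conj (α s) - μ) / (z - μ) with hv
  have hun : ‖u‖ ≤ 1 / 4 := by
    rw [hu, norm_div, div_le_iff₀ (norm_pos_iff.2 h0)]; exact hs
  have hvn : ‖v‖ ≤ 1 / 4 := by
    rw [hv, norm_div, div_le_iff₀ (norm_pos_iff.2 h0), norm_conj_sub_ofReal]; exact hs
  rw [show (z - α s) * (z - conj (α s)) / (z - μ) ^ 2 - 1 = u * v - u - v by
    rw [hu, hv]; field_simp; ring]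
  calc ‖u * v - u - v‖ ≤ ‖u‖ * ‖v‖ + ‖u‖ + ‖v‖ := by
        refine (norm_sub_le _ _).trans (add_le_add ((norm_sub_le _ _).trans ?_) le_rfl)
        rw [norm_mul]
    _ ≤ 1 / 4 * (1 / 4) + 1 / 4 + 1 / 4 := by gcongr
    _ < 1 := by norm_num

/-- The radical for `z` far from the arc. -/
noncomputable def farRadical (α : ℝ → ℂ) (μ : ℝ) (s : ℝ) (z : ℂ) : ℂ :=
  -(z - μ) * sqrtOne ((z - α s) * (z - conj (α s)) / (z - μ) ^ 2)

theorem isRadicalLift_farRadical (h : AdmissibleCurve α μ) (hz : z ≠ μ) {T : ℝ}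
    (hT : ∀ s ≥ T, ‖α s - μ‖ ≤ 1 / 4 * ‖z - μ‖) :
    IsRadicalLift α μ z T (fun s => farRadical α μ s z) := by
  have h0 : z - μ ≠ 0 := sub_ne_zero.2 hz
  have hslit : ∀ s ≥ T, (z - α s) * (z - conj (α s)) / (z - μ) ^ 2 ∈ Complex.slitPlane :=
    fun s hs => mem_slitPlane_of_norm_sub_one_lt (quad_div_near hz (hT s hs))
  have hc : Continuous fun s => (z - α s) * (z - conj (α s)) / (z - μ) ^ 2 := by
    have := h.continuous
    have := Complex.continuous_conj.comp this
    fun_prop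
  refine ⟨fun s hs => ?_, fun s hs => ?_, ?_⟩
  · exact (continuousAt_const.mul (ContinuousAt.comp (f := fun s => (z - α s) * (z - conj (α s)) /
      (z - μ) ^ 2) (differentiableAt_sqrtOne (hslit s hs)).continuousAt
      hc.continuousAt)).continuousWithinAt
  · simp only [farRadical, mul_pow]
    rw [sqrtOne_sq (Complex.slitPlane_ne_zero (hslit s hs))]
    field_simp
  · have h1 : Tendsto (fun s => (z - α s) * (z - conj (α s)) / (z - μ) ^ 2) atTop (𝓝 1) := by
      have h2 := (Complex.continuous_conj.tendsto _).comp h.tendsto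
      rw [Complex.conj_ofReal] at h2
      have h3 := ((h.tendsto.const_sub z).mul (h2.const_sub z)).div_const ((z - μ) ^ 2)
      rwa [show (z - μ) * (z - μ) / (z - μ) ^ 2 = 1 by field_simp] at h3
    have h4 := ((differentiableAt_sqrtOne Complex.one_mem_slitPlane).continuousAt.tendsto.comp
      h1).const_mul (-(z - μ))
    rwa [sqrtOne_one, mul_one] at h4

end AdmissibleCurve

namespace AdmissibleCurve

variable {α : ℝ → ℂ} {μ : ℝ} {y : ℝ} {z : ℂ}

/-- The factor by which the radical changes between the parameters `s` and `T`. -/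
noncomputable def transfer (α : ℝ → ℂ) (s T : ℝ) (z : ℂ) : ℂ :=
  Complex.exp ((logRatio α s T z + conj (logRatio α s T (conj z))) / 2)

theorem notMem_image_of_notMem_cut (hz : z ∉ cut α μ y) {s T : ℝ} (hs : y ≤ s) :
    z ∉ α '' Icc s T ∧ conj z ∉ α '' Icc s T := by
  constructor
  · rintro ⟨r, hr, h⟩
    exact ((ne_of_notMem_cut hz).2 r (hs.trans hr.1)).1 h.symm
  · rintro ⟨r, hr, h⟩
    exact ((ne_of_notMem_cut hz).2 r (hs.trans hr.1)).2 (by rw [h, Complex.conj_conj])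

theorem transfer_sq (h : AdmissibleCurve α μ) (hz : z ∉ cut α μ y) {s T : ℝ} (hs : y ≤ s)
    (hsT : s ≤ T) : (z - α T) * (z - conj (α T)) * transfer α s T z ^ 2 =
      (z - α s) * (z - conj (α s)) := by
  obtain ⟨h1, h2⟩ := notMem_image_of_notMem_cut hz (T := T) hs
  have hT := (ne_of_notMem_cut hz).2 T (hs.trans hsT)
  rw [transfer, ← Complex.exp_nat_mul]; push_cast
  rw [mul_div_cancel₀ _ two_ne_zero, Complex.exp_add, exp_logRatio h.contDiff hsT h1,
    Complex.exp_conj, exp_logRatio h.contDiff hsT h2]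
  simp only [map_div₀, map_sub, Complex.conj_conj]
  have h3 := sub_ne_zero.2 hT.1
  have h4 := sub_ne_zero.2 hT.2
  field_simp

theorem continuousOn_transfer (h : AdmissibleCurve α μ) (hz : z ∉ cut α μ y) {T : ℝ} (hT : y ≤ T) :
    ContinuousOn (fun s => transfer α s T z) (Icc y T) := by
  obtain ⟨h1, h2⟩ := notMem_image_of_notMem_cut hz (T := T) le_rfl
  have c1 := continuousOn_logRatio_left h.contDiff hT h1
  have c2 := Complex.continuous_conj.comp_continuousOn (continuousOn_logRatio_left h.contDiff hT h2)
  exact ((c1.add c2).div_const 2).cexp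

theorem transfer_self (α : ℝ → ℂ) (T : ℝ) (z : ℂ) : transfer α T T z = 1 := by
  simp [transfer, logRatio]

theorem transfer_ne_zero (α : ℝ → ℂ) (s T : ℝ) (z : ℂ) : transfer α s T z ≠ 0 :=
  Complex.exp_ne_zero _

theorem differentiableOn_transfer (h : AdmissibleCurve α μ) {T : ℝ} (hT : y ≤ T) :
    DifferentiableOn ℂ (transfer α y T) (cut α μ y)ᶜ := by
  have hK := (h.isClosed_image y T).isOpen_compl
  have d1 := differentiableOn_logRatio h.contDiff hT
  have d2 := differentiableOn_conj_conj hK d1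
  exact (((d1.mono fun z hz => (notMem_image_of_notMem_cut hz le_rfl).1).add
    (d2.mono fun z hz => (notMem_image_of_notMem_cut hz le_rfl).2)).div_const 2).cexp

theorem exists_far (h : AdmissibleCurve α μ) (hz : z ≠ μ) (y : ℝ) :
    ∃ T ≥ y, ∀ s ≥ T, ‖α s - μ‖ ≤ 1 / 8 * ‖z - μ‖ :=
  h.eventually_norm_le (mul_pos (by norm_num) (norm_pos_iff.2 (sub_ne_zero.2 hz))) y

/-- The parameter dependence of the radical for fixed `z` is the lift which defines it. -/
theorem isRadicalLift (h : AdmissibleCurve α μ) (hz : z ∉ cut α μ y) :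
    IsRadicalLift α μ z y fun s => radical α μ s z := by
  suffices ∃ g, IsRadicalLift α μ z y g from this.choose_spec.radical hz
  have hzμ := (ne_of_notMem_cut hz).1
  obtain ⟨T, hT, H⟩ := h.exists_far hzμ y
  have hfar := h.isRadicalLift_farRadical hzμ (T := T) fun s hs =>
    (H s hs).trans (by gcongr; norm_num)
  -- Beyond `T` the arc is so close to `μ` that the principal root is explicit. Before `T` it is
  -- continued back by `transfer`, which equals `1` at `T`.
  set g : ℝ → ℂ := fun s => if s ≤ T then farRadical α μ T z * transfer α s T z
    else farRadical α μ s z with hg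
  have hgT : ∀ s ≥ T, g s = farRadical α μ s z := fun s hs => by
    rcases hs.eq_or_lt with rfl | h1
    · simp only [hg, le_refl, if_true, transfer_self, mul_one]
    · simp only [hg, not_le.2 h1, if_false]
  have hgl : ∀ s ≤ T, g s = farRadical α μ T z * transfer α s T z := fun s hs => by
    simp only [hg, if_pos hs]
  refine ⟨g, ?_, fun s hs => ?_, hfar.2.2.congr' ?_⟩
  · rw [← Icc_union_Ici_eq_Ici hT]
    refine ContinuousOn.union_of_isClosed ?_ ?_ isClosed_Icc isClosed_Ici
    · exact (continuousOn_const.mul (h.continuousOn_transfer hz hT)).congr fun s hs => hgl s hs.2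
    · exact hfar.1.congr hgT
  · rcases le_total s T with h1 | h1
    · rw [hgl s h1, mul_pow, hfar.2.1 T self_mem_Ici, h.transfer_sq hz hs h1]
    · rw [hgT s h1]; exact hfar.2.1 s h1
  · filter_upwards [eventually_ge_atTop T] with s hs
    exact (hgT s hs).symm

theorem radical_sq (h : AdmissibleCurve α μ) (hz : z ∉ cut α μ y) :
    radical α μ y z ^ 2 = (z - α y) * (z - conj (α y)) :=
  (h.isRadicalLift hz).2.1 y self_mem_Ici

theorem radical_ne_zero (h : AdmissibleCurve α μ) (hz : z ∉ cut α μ y) : radical α μ y z ≠ 0 :=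
  fun h0 => quad_ne_zero hz le_rfl (by rw [← h.radical_sq hz, h0]; simp)

theorem radical_eq_far (h : AdmissibleCurve α μ) (hz : z ≠ μ)
    (hy : ∀ s ≥ y, ‖α s - μ‖ ≤ 1 / 4 * ‖z - μ‖) : radical α μ y z = farRadical α μ y z := by
  have hz0 : 0 < ‖z - μ‖ := norm_pos_iff.2 (sub_ne_zero.2 hz)
  have hcut : z ∉ cut α μ y := notMem_cut hz fun s hs => ⟨fun h0 => by
    have := hy s hs; rw [← h0] at this; linarith, fun h0 => by
    have := hy s hs; rw [← norm_conj_sub_ofReal, ← h0] at this; linarith⟩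
  exact (h.isRadicalLift_farRadical hz hy).radical_eq hcut le_rfl

theorem radical_eq_transfer (h : AdmissibleCurve α μ) {T : ℝ} (hz : z ∉ cut α μ y) (hT : y ≤ T) :
    radical α μ y z = radical α μ T z * transfer α y T z := by
  have hl := h.isRadicalLift hz
  have hT0 : radical α μ T z ≠ 0 := h.radical_ne_zero fun h' => hz (cut_anti hT h')
  refine isPreconnected_Icc.eq_of_sq_eq (S := Icc y T)
    (f := fun s => radical α μ s z) (g := fun s => radical α μ T z * transfer α s T z)
    (hl.1.mono Icc_subset_Ici_self) (continuousOn_const.mul (h.continuousOn_transfer hz hT))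
    (fun s hs => ?_) (fun _ => mul_ne_zero hT0 (transfer_ne_zero _ _ _ _)) (right_mem_Icc.2 hT)
    (by simp only [transfer_self, mul_one]) (left_mem_Icc.2 hT)
  simp only [Pi.pow_apply, mul_pow]
  rw [hl.2.1 s hs.1, h.radical_sq fun h' => hz (cut_anti hT h'), h.transfer_sq hz hs.1 hs.2]

theorem differentiableAt_farRadical (hz : z ≠ μ) {s : ℝ} (hs : ‖α s - μ‖ ≤ 1 / 4 * ‖z - μ‖) :
    DifferentiableAt ℂ (farRadical α μ s) z := by
  have h0 : (z - μ) ^ 2 ≠ 0 := pow_ne_zero 2 (sub_ne_zero.2 hz)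
  have h1 : DifferentiableAt ℂ (fun z => (z - α s) * (z - conj (α s)) / (z - μ) ^ 2) z :=
    DifferentiableAt.div (by fun_prop) (by fun_prop) h0
  have h2 : DifferentiableAt ℂ (fun z : ℂ => -(z - μ)) z := by fun_prop
  have h3 := DifferentiableAt.comp (f := fun z => (z - α s) * (z - conj (α s)) / (z - μ) ^ 2) z
    (differentiableAt_sqrtOne (mem_slitPlane_of_norm_sub_one_lt (quad_div_near hz hs))) h1
  exact h2.mul h3

theorem differentiableOn_radical (h : AdmissibleCurve α μ) (y : ℝ) :
    DifferentiableOn ℂ (radical α μ y) (cut α μ y)ᶜ := by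
  intro z hz
  refine DifferentiableAt.differentiableWithinAt ?_
  have hzμ := (ne_of_notMem_cut hz).1
  have hzn : 0 < ‖z - μ‖ := norm_pos_iff.2 (sub_ne_zero.2 hzμ)
  -- The factor `1/8` instead of `1/4` lets the same `T` serve all `w` in the ball of radius `‖z -
  -- μ‖ / 2`, where `‖w - μ‖ > ‖z - μ‖ / 2`.
  obtain ⟨T, hT, H⟩ := h.exists_far hzμ y
  have hopen := (h.isOpen_compl_cut y).mem_nhds hz
  have d1 := (h.differentiableOn_transfer hT).differentiableAt hopen
  have d2 := differentiableAt_farRadical hzμ ((H T le_rfl).trans (by gcongr; norm_num))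
  refine (d2.mul d1).congr_of_eventuallyEq ?_
  filter_upwards [hopen, Metric.ball_mem_nhds z (half_pos hzn)] with w hw hwb
  have hwn : ‖z - μ‖ / 2 < ‖w - μ‖ := by
    have h3 : ‖z - μ‖ ≤ ‖w - z‖ + ‖w - μ‖ := by
      rw [norm_sub_rev w z]
      exact norm_sub_le_norm_sub_add_norm_sub _ _ _
    rw [Metric.mem_ball, dist_eq_norm] at hwb
    linarith
  rw [h.radical_eq_transfer hw hT, h.radical_eq_far (ne_of_notMem_cut hw).1 fun s hs =>
    (H s hs).trans (by linarith)]
  rfl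

theorem exists_bound (h : AdmissibleCurve α μ) (y : ℝ) : ∃ B, ∀ s ≥ y, ‖α s - μ‖ ≤ B := by
  obtain ⟨T, -, H⟩ := h.eventually_norm_le one_pos y
  obtain ⟨B, hB⟩ := isCompact_Icc.exists_bound_of_continuousOn (s := Icc y T)
    (f := fun s => α s - μ) (h.continuous.sub continuous_const).continuousOn
  refine ⟨max B 1, fun s hs => ?_⟩
  rcases le_total s T with h1 | h1
  · exact (hB s ⟨hs, h1⟩).trans (le_max_left _ _)
  · exact (H s h1).trans (le_max_right _ _)

theorem tendsto_radical_div (h : AdmissibleCurve α μ) (y : ℝ) :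
    Tendsto (fun z => radical α μ y z / z) (Bornology.cobounded ℂ) (𝓝 (-1)) := by
  obtain ⟨B, hB⟩ := h.exists_bound y
  have hi := tendsto_inv₀_cobounded (α := ℂ)
  have t1 : ∀ c : ℂ, Tendsto (fun z : ℂ => 1 - c * z⁻¹) (Bornology.cobounded ℂ) (𝓝 1) := fun c => by
    simpa using hi.const_mul c |>.const_sub 1
  have t2 := ((t1 (α y)).mul (t1 (conj (α y)))).div ((t1 μ).pow 2) (by norm_num)
  rw [mul_one, one_pow, div_one] at t2
  have t3 := ((t1 μ).neg).mul
    ((differentiableAt_sqrtOne Complex.one_mem_slitPlane).continuousAt.tendsto.comp t2)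
  rw [sqrtOne_one, mul_one] at t3
  refine t3.congr' ?_
  have hn : Tendsto (fun z : ℂ => ‖z‖) (Bornology.cobounded ℂ) atTop := tendsto_norm_cobounded_atTop
  filter_upwards [eventually_cobounded_ne_zero, hn.eventually_gt_atTop (4 * B + ‖(μ : ℂ)‖)] with z hz hzn
  have hB0 : 0 ≤ B := (norm_nonneg _).trans (hB y le_rfl)
  have hzμ' : 4 * B < ‖z - μ‖ := by linarith [norm_sub_norm_le z μ]
  have hzμ : z ≠ μ := by rintro rfl; simp at hzμ'; linarith
  rw [h.radical_eq_far hzμ fun s hs => (hB s hs).trans (by linarith), farRadical]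
  simp only [Function.comp, Pi.div_apply]
  have e1 : ∀ c : ℂ, 1 - c * z⁻¹ = (z - c) / z := fun c => by field_simp
  simp only [e1]
  rw [show (z - α y) / z * ((z - conj (α y)) / z) / ((z - μ) / z) ^ 2 =
    (z - α y) * (z - conj (α y)) / (z - μ) ^ 2 by
      have := sub_ne_zero.2 hzμ
      field_simp]
  ring

theorem isRadicalBranch (h : AdmissibleCurve α μ) (y : ℝ) :
    IsRadicalBranch α μ y (radical α μ y) :=
  ⟨h.differentiableOn_radical y, fun _ hz => h.radical_sq hz, h.tendsto_radical_div y⟩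

theorem radical_conj (h : AdmissibleCurve α μ) (hz : z ∉ cut α μ y) :
    radical α μ y (conj z) = conj (radical α μ y z) := by
  obtain ⟨h1, h2, h3⟩ := h.isRadicalLift hz
  have hl : IsRadicalLift α μ (conj z) y fun s => conj (radical α μ s z) := by
    refine ⟨Complex.continuous_conj.comp_continuousOn h1, fun s hs => ?_, ?_⟩
    · rw [← map_pow, h2 s hs]
      simp only [map_mul, map_sub, Complex.conj_conj]; ring
    · have h4 := (Complex.continuous_conj.tendsto _).comp h3
      rwa [map_neg, map_sub, Complex.conj_ofReal] at h4
  exact hl.radical_eq (fun h' => hz (conj_mem_cut.1 h')) le_rfl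

end AdmissibleCurve

/-! ### Boundary values of the radical on the contour. -/

/-- The boundary value of the radical on the upper half of the contour. -/
noncomputable def edgeRadical (α : ℝ → ℂ) (μ : ℝ) (ξ s : ℝ) : ℂ :=
  leftValue (radical α μ ξ) (α s) (-deriv α s)

namespace AdmissibleCurve

variable {α : ℝ → ℂ} {μ : ℝ} {ξ b s : ℝ} {z : ℂ}

open RegularArc

theorem conj_ne (h : AdmissibleCurve α μ) (s t : ℝ) : α s ≠ conj (α t) := fun h0 => by
  have := congrArg Complex.im h0
  rw [Complex.conj_im] at this
  linarith [h.im_pos s, h.im_pos t]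

theorem ne_end (h : AdmissibleCurve α μ) (s : ℝ) : α s ≠ μ := fun h0 => by
  have := congrArg Complex.im h0
  rw [Complex.ofReal_im] at this
  linarith [h.im_pos s]

theorem notMem_cut_of_lt (h : AdmissibleCurve α μ) (hs : s < b) : α s ∉ cut α μ b :=
  notMem_cut (h.ne_end s) fun t ht => ⟨fun h0 => by have := h.inj h0; linarith, h.conj_ne s t⟩

theorem mem_cut_of_mem (hz : z ∈ cut α μ ξ) (b : ℝ) :
    z ∈ cut α μ b ∨ z ∈ α '' Icc ξ b ∨ conj z ∈ α '' Icc ξ b := by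
  rcases hz with (⟨s, hs, rfl⟩ | h1) | ⟨_, ⟨s, hs, rfl⟩, rfl⟩
  · rcases le_total b s with h2 | h2
    · exact Or.inl (Or.inl (Or.inl ⟨s, h2, rfl⟩))
    · exact Or.inr (Or.inl ⟨s, ⟨hs, h2⟩, rfl⟩)
  · exact Or.inl (Or.inl (Or.inr h1))
  · rcases le_total b s with h2 | h2
    · exact Or.inl (Or.inr ⟨_, ⟨s, h2, rfl⟩, rfl⟩)
    · exact Or.inr (Or.inr ⟨s, ⟨hs, h2⟩, by rw [Complex.conj_conj]⟩)

/-- The cuts beyond `b` cancel: the radical for `ξ` is the one for `b` times `transfer`, so the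
product is a polynomial times `transfer`. The polynomial splits into `z - α b` and `z - conj (α b)`,
one for each of the conjugate roots. -/
theorem radical_mul_radical (h : AdmissibleCurve α μ) (hb : ξ ≤ b) (hz : z ∉ cut α μ ξ) :
    radical α μ ξ z * radical α μ b z =
      arcSqrt α ξ b z * conj (arcSqrt α ξ b (conj z)) := by
  have hsq := h.radical_sq fun h' => hz (cut_anti hb h')
  rw [h.radical_eq_transfer hz hb, mul_right_comm, ← sq, hsq, transfer, add_div, Complex.exp_add,
    arcSqrt, arcSqrt]
  simp only [map_mul, map_sub, Complex.conj_conj, ← Complex.exp_conj, map_div₀]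
  rw [Complex.conj_ofNat]
  ring

theorem conj_notMem (h : AdmissibleCurve α μ) (s ξ b : ℝ) : conj (α s) ∉ α '' Icc ξ b := by
  rintro ⟨t, -, ht⟩; exact h.conj_ne t s ht

theorem arcSqrt_conj_ne_zero (h : AdmissibleCurve α μ) (hb : ξ ≤ b) (s : ℝ) :
    arcSqrt α ξ b (conj (α s)) ≠ 0 := fun h0 => by
  have := h.arcSqrt_sq hb (h.conj_notMem s ξ b)
  rw [h0, zero_pow two_ne_zero] at this
  rcases mul_eq_zero.1 this.symm with h1 | h1
  · exact h.conj_ne ξ s (sub_eq_zero.1 h1).symm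
  · exact h.conj_ne b s (sub_eq_zero.1 h1).symm

theorem continuous_arcSqrt_conj (h : AdmissibleCurve α μ) (hb : ξ ≤ b) :
    Continuous fun s => conj (arcSqrt α ξ b (conj (α s))) := by
  have h1 := (h.differentiableOn_arcSqrt hb).continuousOn
  exact Complex.continuous_conj.comp (h1.comp_continuous (Complex.continuous_conj.comp h.continuous)
    fun s => h.conj_notMem s ξ b)

theorem continuousOn_radical_curve (h : AdmissibleCurve α μ) (b : ℝ) :
    ContinuousOn (fun s => radical α μ b (α s)) (Iio b) :=
  (h.differentiableOn_radical b).continuousOn.comp h.continuous.continuousOn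
    fun _ hs => h.notMem_cut_of_lt hs

/-- For any auxiliary `b > s`, the radical for `b` and the reflected `arcSqrt` are analytic near `α
s`, so the boundary behaviour is that of a single `arcSqrt` on a compact arc. -/
theorem tendsto_edge (h : AdmissibleCurve α μ) (hξ : ξ < s) (hb : s < b) :
    Tendsto (fun w => radical α μ ξ (α s + w * deriv α s)) (𝓝[rightSector] 0)
      (𝓝 (symSqrt α ξ b s / radical α μ b (α s))) ∧
    ∀ᶠ w in 𝓝[rightSector] 0, α s + w * deriv α s ∉ cut α μ ξ := by
  obtain ⟨h1, -, hoff, -⟩ := h.tendsto_rightSqrt (a := ξ) (b := b) ⟨hξ, hb⟩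
  have hξb := (hξ.trans hb).le
  have hcut := h.notMem_cut_of_lt hb
  have hline : Tendsto (fun w => α s + w * deriv α s) (𝓝[rightSector] 0) (𝓝 (α s)) := by
    have : Continuous fun w => α s + w * deriv α s := by fun_prop
    have h2 := this.tendsto 0
    rw [zero_mul, add_zero] at h2
    exact h2.mono_left nhdsWithin_le_nhds
  have hline' := (Complex.continuous_conj.tendsto _).comp hline
  have hKo := (h.isClosed_image ξ b).isOpen_compl.mem_nhds (h.conj_notMem s ξ b)
  have hev : ∀ᶠ w in 𝓝[rightSector] 0, α s + w * deriv α s ∉ cut α μ ξ := by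
    filter_upwards [hoff, hline.eventually ((h.isOpen_compl_cut b).mem_nhds hcut),
      hline'.eventually hKo] with w h3 h4 h5 h6
    rcases mem_cut_of_mem h6 b with h7 | h7 | h7
    · exact h4 h7
    · exact h3 h7
    · exact h5 h7
  refine ⟨?_, hev⟩
  have h2 := ((h.differentiableOn_radical b).differentiableAt
    ((h.isOpen_compl_cut b).mem_nhds hcut)).continuousAt.tendsto.comp hline
  have h3 := (Complex.continuous_conj.tendsto _).comp
    (((h.differentiableOn_arcSqrt hξb).differentiableAt hKo).continuousAt.tendsto.comp hline')
  have h4 := (h3.mul h1).div h2 (h.radical_ne_zero hcut)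
  refine h4.congr' ?_
  filter_upwards [hev] with w hw
  have h5 := h.radical_mul_radical hξb hw
  have h6 := h.radical_ne_zero (y := b) fun h' => hw (cut_anti hξb h')
  simp only [Pi.div_apply, Function.comp]
  rw [div_eq_iff h6, h5, mul_comm]

theorem tendsto_left (h : AdmissibleCurve α μ) (hξ : ξ < s) (hb : s < b) :
    Tendsto (fun ε : ℝ => radical α μ ξ (α s + ε * (Complex.I * -deriv α s))) (𝓝[>] 0)
      (𝓝 (symSqrt α ξ b s / radical α μ b (α s))) := by
  -- The upper half of the contour runs against the parameter, so its left side is the right side of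
  -- the parametrized arc.
  refine ((h.tendsto_edge hξ hb).1.comp (tendsto_rightSector one_pos)).congr fun ε => ?_
  simp only [Function.comp, mul_one]
  congr 2; ring

theorem edgeRadical_eq (h : AdmissibleCurve α μ) (hξ : ξ < s) (hb : s < b) :
    edgeRadical α μ ξ s = symSqrt α ξ b s / radical α μ b (α s) :=
  (h.tendsto_left hξ hb).limUnder_eq

theorem hasLeftValue (h : AdmissibleCurve α μ) (hξ : ξ < s) :
    HasLeftValue (radical α μ ξ) (α s) (-deriv α s) :=
  ⟨_, h.tendsto_left hξ (lt_add_one s)⟩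

theorem tendsto_left_conj (h : AdmissibleCurve α μ) (hξ : ξ < s) :
    Tendsto (fun ε : ℝ => radical α μ ξ (conj (α s) + ε * (Complex.I * conj (deriv α s)))) (𝓝[>] 0)
      (𝓝 (conj (edgeRadical α μ ξ s))) := by
  have hb := lt_add_one s
  rw [h.edgeRadical_eq hξ hb]
  refine ((Complex.continuous_conj.tendsto _).comp (h.tendsto_left hξ hb)).congr' ?_
  filter_upwards [(tendsto_rightSector one_pos).eventually (h.tendsto_edge hξ hb).2] with ε hε
  rw [show α s + -(ε * 1 : ℝ) * Complex.I * deriv α s = α s + ε * (Complex.I * -deriv α s) by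
    push_cast; ring] at hε
  simp only [Function.comp]
  rw [← h.radical_conj hε]
  congr 1
  simp

theorem hasLeftValue_conj (h : AdmissibleCurve α μ) (hξ : ξ < s) :
    HasLeftValue (radical α μ ξ) (conj (α s)) (conj (deriv α s)) :=
  ⟨_, h.tendsto_left_conj hξ⟩

theorem leftValue_conj (h : AdmissibleCurve α μ) (hξ : ξ < s) :
    leftValue (radical α μ ξ) (conj (α s)) (conj (deriv α s)) = conj (edgeRadical α μ ξ s) :=
  (h.tendsto_left_conj hξ).limUnder_eq

theorem symSqrt_ne_zero (h : AdmissibleCurve α μ) (hξ : ξ < s) (hb : s < b) :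
    symSqrt α ξ b s ≠ 0 :=
  mul_ne_zero ((map_ne_zero _).2 (h.arcSqrt_conj_ne_zero (hξ.trans hb).le s))
    (h.tendsto_rightSqrt ⟨hξ, hb⟩).2.2.2.2.1

theorem edgeRadical_ne_zero (h : AdmissibleCurve α μ) (hξ : ξ < s) : edgeRadical α μ ξ s ≠ 0 := by
  have hb := lt_add_one s
  rw [h.edgeRadical_eq hξ hb]
  exact div_ne_zero (h.symSqrt_ne_zero hξ hb) (h.radical_ne_zero (h.notMem_cut_of_lt hb))

theorem edgeRadical_sq (h : AdmissibleCurve α μ) (hξ : ξ < s) :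
    edgeRadical α μ ξ s ^ 2 = (α s - α ξ) * (α s - conj (α ξ)) := by
  have hb := lt_add_one s
  obtain ⟨h1, h2⟩ := h.tendsto_edge hξ hb
  rw [← h.edgeRadical_eq hξ hb] at h1
  have h3 : Tendsto (fun w => (α s + w * deriv α s - α ξ) * (α s + w * deriv α s - conj (α ξ)))
      (𝓝[rightSector] 0) (𝓝 ((α s - α ξ) * (α s - conj (α ξ)))) := by
    have : Continuous fun w => (α s + w * deriv α s - α ξ) * (α s + w * deriv α s - conj (α ξ)) := by
      fun_prop
    have h4 := this.tendsto 0
    simp only [zero_mul, add_zero] at h4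
    exact h4.mono_left nhdsWithin_le_nhds
  refine tendsto_nhds_unique (h1.pow 2) (h3.congr' ?_)
  filter_upwards [h2] with w hw
  exact (h.radical_sq hw).symm

/-- The product of the radical for the parameter `t` and the boundary value for `ξ`. -/
theorem radical_mul_edgeRadical (h : AdmissibleCurve α μ) (hξ : ξ < s) (hb : s < b) :
    radical α μ b (α s) * edgeRadical α μ ξ s = symSqrt α ξ b s := by
  rw [h.edgeRadical_eq hξ hb, mul_div_cancel₀]
  exact h.radical_ne_zero (h.notMem_cut_of_lt hb)

theorem continuousOn_edgeRadical (h : AdmissibleCurve α μ) (ξ : ℝ) :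
    ContinuousOn (edgeRadical α μ ξ) (Ioi ξ) := by
  intro s hs
  have hb := lt_add_one s
  have hs' : s ∈ Ioo ξ (s + 1) := ⟨hs, hb⟩
  have h1 : ContinuousOn (fun r => symSqrt α ξ (s + 1) r / radical α μ (s + 1) (α r))
      (Ioo ξ (s + 1)) := by
    refine ContinuousOn.div ?_ ((h.continuousOn_radical_curve _).mono fun r hr => hr.2)
      fun r hr => h.radical_ne_zero (h.notMem_cut_of_lt hr.2)
    exact (h.continuous_arcSqrt_conj (lt_trans hs hb).le).continuousOn.mul h.continuousOn_rightSqrt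
  have h2 := (h1.congr fun r hr => h.edgeRadical_eq hr.1 hr.2).continuousAt
    (Ioo_mem_nhds hs hb)
  exact h2.continuousWithinAt

theorem intervalIntegrable_inv_edgeRadical (h : AdmissibleCurve α μ) {T : ℝ} (hT : ξ ≤ T) :
    IntervalIntegrable (fun s => (edgeRadical α μ ξ s)⁻¹) volume ξ T := by
  have hξb : ξ < T + 1 := by linarith
  have h1 := (h.intervalIntegrable_inv_rightSqrt hξb).mono_set (c := ξ) (d := T) (by
    rw [uIcc_of_le hT, uIcc_of_le hξb.le]; exact Icc_subset_Icc le_rfl (by linarith))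
  have hc : ContinuousOn (fun s => radical α μ (T + 1) (α s) *
      (conj (arcSqrt α ξ (T + 1) (conj (α s))))⁻¹) (uIcc ξ T) := by
    refine ((h.continuousOn_radical_curve _).mono fun r hr => ?_).mul
      ((h.continuous_arcSqrt_conj hξb.le).continuousOn.inv₀ fun r _ =>
        (map_ne_zero _).2 (h.arcSqrt_conj_ne_zero hξb.le r))
    rw [uIcc_of_le hT] at hr
    exact lt_of_le_of_lt hr.2 (lt_add_one T)
  refine (h1.mul_continuousOn hc).congr fun s hs => ?_
  rw [uIoc_of_le hT] at hs
  rw [h.edgeRadical_eq hs.1 (hs.2.trans_lt (lt_add_one T)), symSqrt, inv_div, mul_comm (conj _)]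
  rw [div_mul_eq_div_div]; ring

/-- The imaginary part of the interaction between the parameters `ξ` and `t`. -/
theorem im_interaction (h : AdmissibleCurve α μ) (hξ : ξ < b) (c : ℝ) :
    IntervalIntegrable (fun s => (α s - c) / (radical α μ b (α s) * edgeRadical α μ ξ s) * deriv α s)
      volume ξ b ∧
    (∫ s in ξ..b, (α s - c) / (radical α μ b (α s) * edgeRadical α μ ξ s) * deriv α s).im =
      Real.pi / 2 := by
  obtain ⟨h1, h2⟩ := h.im_integral_eq hξ (fun s _ => h.im_pos s) c
  have hcongr : ∀ s ∈ Ioo ξ b, (α s - c) / symSqrt α ξ b s * deriv α s =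
      (α s - c) / (radical α μ b (α s) * edgeRadical α μ ξ s) * deriv α s := fun s hs => by
    rw [h.radical_mul_edgeRadical hs.1 hs.2]
  have h3 := h1
  rw [intervalIntegrable_iff_integrableOn_Ioo_of_le hξ.le] at h3 ⊢
  refine ⟨h3.congr_fun hcongr measurableSet_Ioo, ?_⟩
  rw [← h2, intervalIntegral.integral_of_le hξ.le, intervalIntegral.integral_of_le hξ.le,
    integral_Ioc_eq_integral_Ioo, integral_Ioc_eq_integral_Ioo,
    setIntegral_congr_fun measurableSet_Ioo hcongr]

end AdmissibleCurve

/-! ### The kernel and its derivative: continuity, bounds, Fubini. -/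

/-- The function `z - μ + √((z - u)(z - ū))`, `u = α t`. -/
noncomputable def kern (α : ℝ → ℂ) (μ : ℝ) (t : ℝ) (z : ℂ) : ℂ := z - μ + radical α μ t z

/-- The derivative `1 + (z - Re u)/√((z - u)(z - ū))` of `kern`. -/
noncomputable def dkern (α : ℝ → ℂ) (μ : ℝ) (t : ℝ) (z : ℂ) : ℂ :=
  1 + (z - ((α t).re : ℂ)) / radical α μ t z

theorem re_sqrtOne_nonneg (w : ℂ) : 0 ≤ (sqrtOne w).re := by
  rw [sqrtOne, Complex.exp_re]
  refine mul_nonneg (Real.exp_pos _).le (Real.cos_nonneg_of_neg_pi_div_two_le_of_le ?_ ?_)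
  · have := Complex.neg_pi_lt_log_im w
    rw [Complex.div_ofNat_im]; linarith
  · have := Complex.log_im_le_pi w
    rw [Complex.div_ofNat_im]; linarith

namespace AdmissibleCurve

variable {α : ℝ → ℂ} {μ : ℝ} {y t s : ℝ} {z : ℂ}

/-- Compare with the explicit local root `radical α μ t z * sqrtOne (W p)`. The two agree for the
given `z` and all nearby parameters by continuity of the lift, and from there for all nearby points
by continuity in the point; each time the squares agree on a connected ball. -/
theorem continuousAt_radical_prod (h : AdmissibleCurve α μ) (hz : z ∉ cut α μ y) (hy : y < t) :
    ContinuousAt (fun p : ℝ × ℂ => radical α μ p.1 p.2) (t, z) := by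
  set Q : ℝ × ℂ → ℂ := fun p => (p.2 - α p.1) * (p.2 - conj (α p.1)) with hQ
  have hcα := h.continuous
  have hcα' : Continuous fun t => conj (α t) := Complex.continuous_conj.comp hcα
  have hQc : Continuous Q := by fun_prop
  have hzt : z ∉ cut α μ t := fun h' => hz (cut_anti hy.le h')
  have hQ0 : Q (t, z) ≠ 0 := quad_ne_zero hzt le_rfl
  set W : ℝ × ℂ → ℂ := fun p => Q p / Q (t, z) with hW
  have hWc : Continuous W := hQc.div_const _
  have hW1 : W (t, z) = 1 := div_self hQ0
  have hev : ∀ᶠ p in 𝓝 (t, z), y < p.1 ∧ p.2 ∉ cut α μ y ∧ ‖W p - 1‖ < 1 := by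
    refine ((continuous_fst.tendsto (t, z)).eventually (lt_mem_nhds hy)).and
      (((continuous_snd.tendsto (t, z)).eventually ((h.isOpen_compl_cut y).mem_nhds hz)).and ?_)
    exact (hWc.sub continuous_const).norm.continuousAt.eventually
      (gt_mem_nhds (by simp [hW1]))
  obtain ⟨r, hr, H⟩ := Metric.eventually_nhds_iff.1 hev
  have H' : ∀ s w, |s - t| < r → ‖w - z‖ < r → y < s ∧ w ∉ cut α μ y ∧ ‖W (s, w) - 1‖ < 1 :=
    fun s w hs hw => H (y := (s, w)) (by
      rw [Prod.dist_eq]; exact max_lt (by rwa [Real.dist_eq]) (by rwa [dist_eq_norm]))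
  set S : ℝ × ℂ → ℂ := fun p => radical α μ t z * sqrtOne (W p) with hS
  have hSc : ∀ p, ‖W p - 1‖ < 1 → ContinuousAt S p := fun p hp =>
    continuousAt_const.mul (ContinuousAt.comp (f := W)
      (differentiableAt_sqrtOne (mem_slitPlane_of_norm_sub_one_lt hp)).continuousAt hWc.continuousAt)
  have hSs : ∀ p, ‖W p - 1‖ < 1 → S p ^ 2 = Q p := fun p hp => by
    simp only [hS, mul_pow]
    rw [sqrtOne_sq (Complex.slitPlane_ne_zero (mem_slitPlane_of_norm_sub_one_lt hp)),
      h.radical_sq hzt]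
    exact mul_div_cancel₀ _ hQ0
  have hRs : ∀ s w, |s - t| < r → ‖w - z‖ < r → radical α μ s w ^ 2 = Q (s, w) := fun s w hs hw => by
    obtain ⟨h1, h2, -⟩ := H' s w hs hw
    exact h.radical_sq fun h' => h2 (cut_anti h1.le h')
  have hQne : ∀ s w, |s - t| < r → ‖w - z‖ < r → Q (s, w) ≠ 0 := fun s w hs hw => by
    obtain ⟨h1, h2, -⟩ := H' s w hs hw
    exact quad_ne_zero (fun h' => h2 (cut_anti h1.le h')) le_rfl
  have hSne : ∀ s w, |s - t| < r → ‖w - z‖ < r → S (s, w) ≠ 0 := fun s w hs hw h0 => by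
    have := hSs (s, w) (H' s w hs hw).2.2
    rw [h0, zero_pow two_ne_zero] at this
    exact hQne s w hs hw this.symm
  have hz0 : ‖z - z‖ < r := by simpa using hr
  have hball : ∀ s, s ∈ Metric.ball t r ↔ |s - t| < r := fun s => by
    rw [Metric.mem_ball, Real.dist_eq]
  have hballz : ∀ w, w ∈ Metric.ball z r ↔ ‖w - z‖ < r := fun w => by
    rw [Metric.mem_ball, dist_eq_norm]
  have hcentre : ∀ s, |s - t| < r → radical α μ s z = S (s, z) := fun s hs => by
    refine ((convex_ball t r).isPreconnected).eq_of_sq_eq (f := fun s => radical α μ s z)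
      (g := fun s => S (s, z)) ((h.isRadicalLift hz).1.mono fun x hx => ?_)
      (fun x hx => ?_) (fun x hx => ?_) (fun {x} hx => hSne x z ((hball x).1 hx) hz0)
      (Metric.mem_ball_self hr) ?_ ((hball s).2 hs)
    · exact (H' x z ((hball x).1 hx) hz0).1.le
    · exact (ContinuousAt.comp (f := fun s => (s, z)) (hSc (x, z) (H' x z ((hball x).1 hx) hz0).2.2)
        (by fun_prop)).continuousWithinAt
    · simp only [Pi.pow_apply]
      rw [hRs x z ((hball x).1 hx) hz0, hSs _ (H' x z ((hball x).1 hx) hz0).2.2]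
    · simp only [hS, hW1, sqrtOne_one, mul_one]
  have hball_eq : ∀ s w, |s - t| < r → ‖w - z‖ < r → radical α μ s w = S (s, w) := fun s w hs hw => by
    refine ((convex_ball z r).isPreconnected).eq_of_sq_eq (f := fun w => radical α μ s w)
      (g := fun w => S (s, w)) ((h.differentiableOn_radical s).continuousOn.mono fun x hx => ?_)
      (fun x hx => ?_) (fun x hx => ?_) (fun {x} hx => hSne s x hs ((hballz x).1 hx))
      (Metric.mem_ball_self hr) (hcentre s hs) ((hballz w).2 hw)
    · obtain ⟨h1, h2, -⟩ := H' s x hs ((hballz x).1 hx)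
      exact fun h' => h2 (cut_anti h1.le h')
    · exact (ContinuousAt.comp (f := fun w => (s, w)) (hSc (s, x) (H' s x hs ((hballz x).1 hx)).2.2)
        (by fun_prop)).continuousWithinAt
    · simp only [Pi.pow_apply]
      rw [hRs s x hs ((hballz x).1 hx), hSs _ (H' s x hs ((hballz x).1 hx)).2.2]
  refine (hSc (t, z) (by simp [hW1])).congr ?_
  filter_upwards [Metric.ball_mem_nhds (t, z) hr] with p hp
  rw [Metric.mem_ball, Prod.dist_eq, max_lt_iff, Real.dist_eq, dist_eq_norm] at hp
  exact (hball_eq p.1 p.2 hp.1 hp.2).symm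

theorem continuousAt_radical_curve (h : AdmissibleCurve α μ) (hst : s < t) :
    ContinuousAt (fun p : ℝ × ℝ => radical α μ p.1 (α p.2)) (t, s) := by
  have h1 := h.continuousAt_radical_prod (h.notMem_cut_of_lt (b := (s + t) / 2) (s := s) (by linarith))
    (t := t) (by linarith)
  have hc := h.continuous
  have h2 : ContinuousAt (fun p : ℝ × ℝ => (p.1, α p.2)) (t, s) := by fun_prop
  exact ContinuousAt.comp (f := fun p : ℝ × ℝ => (p.1, α p.2)) h1 h2

theorem continuousAt_dkern (h : AdmissibleCurve α μ) (hst : s < t) :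
    ContinuousAt (fun p : ℝ × ℝ => dkern α μ p.1 (α p.2)) (t, s) := by
  have hc := h.continuous
  have hc' : Continuous fun p : ℝ × ℝ => α p.2 - ((α p.1).re : ℂ) := by fun_prop
  exact continuousAt_const.add (hc'.continuousAt.div (h.continuousAt_radical_curve hst)
    (h.radical_ne_zero (h.notMem_cut_of_lt hst)))

theorem radical_self (α : ℝ → ℂ) (μ t : ℝ) : radical α μ t (α t) = 0 := by
  unfold radical
  split_ifs with hex
  · have := hex.choose_spec.2.1 t self_mem_Ici
    simpa using this
  · rfl

theorem norm_radical_sq (h : AdmissibleCurve α μ) (hst : s ≤ t) :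
    ‖radical α μ t (α s)‖ ^ 2 = ‖α s - α t‖ * ‖α s - conj (α t)‖ := by
  rcases hst.eq_or_lt with rfl | hst
  · simp [radical_self]
  · rw [← norm_pow, h.radical_sq (h.notMem_cut_of_lt hst), norm_mul]

/-- Bounds for `kern` and its derivative at points far from the arc. -/
theorem far_bounds (h : AdmissibleCurve α μ) (hz : z ≠ μ)
    (ht : ∀ s ≥ t, ‖α s - μ‖ ≤ 1 / 4 * ‖z - μ‖) :
    ‖kern α μ t z‖ ≤ 3 * ‖α t - μ‖ ∧ ‖dkern α μ t z‖ ≤ 6 * ‖α t - μ‖ / ‖z - μ‖ := by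
  have hz0 : 0 < ‖z - μ‖ := norm_pos_iff.2 (sub_ne_zero.2 hz)
  have hr := ht t le_rfl
  set r := ‖α t - μ‖ with hr'
  have hr0 : 0 ≤ r := norm_nonneg _
  have hcut : z ∉ cut α μ t := notMem_cut hz fun s hs => ⟨fun h0 => by
    have := ht s hs; rw [← h0] at this; linarith, fun h0 => by
    have := ht s hs; rw [← norm_conj_sub_ofReal, ← h0] at this; linarith⟩
  have hR := h.radical_eq_far hz ht
  have hsq := h.radical_sq hcut
  have hconj : ‖conj (α t) - (μ : ℂ)‖ = r := norm_conj_sub_ofReal _ _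
  -- Far away the radical is `-(z - μ) q` with `Re q ≥ 0`, so no cancellation occurs in this
  -- difference. Its product with `kern` is `R_t² - (z - μ)²`, which is `O(|α t - μ| |z - μ|)`.
  have h1 : ‖z - μ‖ ≤ ‖radical α μ t z - (z - μ)‖ := by
    rw [hR, farRadical]
    set q := sqrtOne ((z - α t) * (z - conj (α t)) / (z - μ) ^ 2)
    rw [show -(z - μ) * q - (z - μ) = -((z - μ) * (q + 1)) by ring, norm_neg, norm_mul]
    refine le_mul_of_one_le_right hz0.le ?_
    have := re_sqrtOne_nonneg ((z - α t) * (z - conj (α t)) / (z - μ) ^ 2)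
    calc (1 : ℝ) ≤ (q + 1).re := by rw [Complex.add_re, Complex.one_re]; linarith
      _ ≤ ‖q + 1‖ := Complex.re_le_norm _
  have h2 : kern α μ t z * (radical α μ t z - (z - μ)) =
      (α t - μ) * (conj (α t) - μ) - (z - μ) * ((α t - μ) + (conj (α t) - μ)) := by
    rw [kern]; linear_combination hsq
  have h3 : ‖kern α μ t z‖ * ‖z - μ‖ ≤ r * r + ‖z - μ‖ * (r + r) := by
    calc ‖kern α μ t z‖ * ‖z - μ‖ ≤ ‖kern α μ t z‖ * ‖radical α μ t z - (z - μ)‖ := by gcongr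
      _ = ‖(α t - μ) * (conj (α t) - μ) - (z - μ) * ((α t - μ) + (conj (α t) - μ))‖ := by
        rw [← norm_mul, h2]
      _ ≤ ‖α t - μ‖ * ‖conj (α t) - μ‖ + ‖z - μ‖ * (‖α t - μ‖ + ‖conj (α t) - μ‖) := by
        refine (norm_sub_le _ _).trans ?_
        rw [norm_mul, norm_mul]
        gcongr
        exact norm_add_le _ _
      _ = _ := by rw [hconj]
  have h4 : ‖kern α μ t z‖ ≤ 3 * r := by
    refine le_of_mul_le_mul_right (h3.trans ?_) hz0
    nlinarith
  refine ⟨h4, ?_⟩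
  have h5 : 3 / 4 * ‖z - μ‖ ≤ ‖radical α μ t z‖ := by
    have e1 : ‖z - μ‖ - r ≤ ‖z - α t‖ := by
      have := norm_sub_norm_le (z - μ) (α t - μ)
      rwa [sub_sub_sub_cancel_right] at this
    have e2 : ‖z - μ‖ - r ≤ ‖z - conj (α t)‖ := by
      have := norm_sub_norm_le (z - μ) (conj (α t) - μ)
      rwa [sub_sub_sub_cancel_right, hconj] at this
    have e3 : 3 / 4 * ‖z - μ‖ ≤ ‖z - μ‖ - r := by linarith
    refine (abs_le_of_sq_le_sq' ?_ (norm_nonneg _)).2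
    rw [← norm_pow, hsq, norm_mul, sq]
    exact mul_le_mul (e3.trans e1) (e3.trans e2) (by positivity) (norm_nonneg _)
  have hR0 : radical α μ t z ≠ 0 := h.radical_ne_zero hcut
  have h6 : dkern α μ t z = (kern α μ t z - (((α t).re : ℂ) - μ)) / radical α μ t z := by
    rw [dkern, kern]; field_simp; ring
  have h7 : ‖((α t).re : ℂ) - μ‖ ≤ r := by
    have := Complex.abs_re_le_norm (α t - μ)
    rw [← Complex.ofReal_sub, Complex.norm_real]
    simpa using this
  rw [h6, norm_div]
  calc ‖kern α μ t z - (((α t).re : ℂ) - μ)‖ / ‖radical α μ t z‖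
      ≤ (3 * r + r) / (3 / 4 * ‖z - μ‖) := by
        gcongr
        exact (norm_sub_le _ _).trans (add_le_add h4 h7)
    _ ≤ 6 * r / ‖z - μ‖ := by
        rw [div_le_div_iff₀ (by positivity) hz0]
        nlinarith [mul_nonneg hr0 hz0.le]

end AdmissibleCurve

/-- The integral over the parameters beyond `s` of the derivative of `kern` at `α s`. -/
noncomputable def dkernIntegral (α : ℝ → ℂ) (μ : ℝ) (s : ℝ) : ℂ :=
  ∫ t in Ioi s, dkern α μ t (α s)

namespace AdmissibleCurve

variable {α : ℝ → ℂ} {μ : ℝ} {x₁ x₂ s t : ℝ}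

theorem im_le_norm (α : ℝ → ℂ) (μ s : ℝ) : (α s).im ≤ ‖α s - μ‖ := by
  have := Complex.abs_im_le_norm (α s - μ)
  rw [Complex.sub_im, Complex.ofReal_im, sub_zero] at this
  exact (le_abs_self _).trans this

theorem exists_im_ge (h : AdmissibleCurve α μ) (h12 : x₁ ≤ x₂) :
    ∃ m > 0, ∀ s ∈ Icc x₁ x₂, m ≤ (α s).im := by
  obtain ⟨s₀, -, H⟩ := isCompact_Icc.exists_isMinOn (nonempty_Icc.2 h12)
    (Complex.continuous_im.comp h.continuous).continuousOn
  exact ⟨_, h.im_pos s₀, fun s hs => H hs⟩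

/-- The modulus of the radical at `α s` is `√(|α s - α t| |α s - conj (α t)|)`. The chord bound and
a positive lower bound for the imaginary part leave an inverse square root singularity at `t = s`;
for large `t` the far bounds apply. Both majorants are integrable in `t`. -/
theorem exists_dkern_bound (h : AdmissibleCurve α μ) (h12 : x₁ ≤ x₂) :
    ∃ T > x₂, ∃ C ≥ 0, ∀ s ∈ Icc x₁ x₂,
      (∀ t ∈ Ioc s T, ‖dkern α μ t (α s)‖ ≤ C * (√|t - s|)⁻¹) ∧
      (∀ t ≥ T, ‖dkern α μ t (α s)‖ ≤ C * ‖α t - μ‖) ∧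
      ∀ t ≥ T, ‖kern α μ t (α s)‖ ≤ 3 * ‖α t - μ‖ := by
  obtain ⟨m, hm, hmin⟩ := h.exists_im_ge h12
  obtain ⟨T, hT, HT⟩ := h.eventually_norm_le (show 0 < 1 / 4 * m by positivity) (x₂ + 1)
  obtain ⟨κ, hκ, Hκ⟩ := exists_chord_bound h.contDiff h.inj h.deriv_ne x₁ T
  obtain ⟨B, hB⟩ := h.exists_bound x₁
  have hB0 : 0 ≤ B := (norm_nonneg _).trans (hB x₁ le_rfl)
  set C₁ := √(T - x₁) + 2 * B / √(κ * m) with hC₁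
  refine ⟨T, by linarith, max C₁ (6 / m), le_max_of_le_right (by positivity), fun s hs => ?_⟩
  have hmr : ∀ s ∈ Icc x₁ x₂, m ≤ ‖α s - μ‖ := fun s hs => (hmin s hs).trans (im_le_norm α μ s)
  have hfar := fun t (ht : t ≥ T) => h.far_bounds (z := α s) (t := t) (h.ne_end s) fun r hr => by
    have h1 := HT r (ht.le.trans hr)
    have h2 := hmr s hs
    linarith
  refine ⟨fun t ht => ?_, fun t ht => ?_, fun t ht => (hfar t ht).1⟩
  · have hts : 0 < t - s := by linarith [ht.1]
    rw [abs_of_pos hts]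
    have hq : 0 < √(t - s) := Real.sqrt_pos.2 hts
    have hκm : 0 < √(κ * m) := Real.sqrt_pos.2 (by positivity)
    have h1 : ‖α s - ((α t).re : ℂ)‖ ≤ 2 * B := by
      have e1 := hB s hs.1
      have e2 := hB t (hs.1.trans ht.1.le)
      have e3 : ‖((α t).re : ℂ) - μ‖ ≤ ‖α t - μ‖ := by
        have := Complex.abs_re_le_norm (α t - μ)
        rw [← Complex.ofReal_sub, Complex.norm_real]
        simpa using this
      calc ‖α s - ((α t).re : ℂ)‖ = ‖(α s - μ) - (((α t).re : ℂ) - μ)‖ := by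
            rw [sub_sub_sub_cancel_right]
        _ ≤ _ := norm_sub_le _ _
        _ ≤ 2 * B := by linarith
    have h2 : √(κ * m) * √(t - s) ≤ ‖radical α μ t (α s)‖ := by
      refine (abs_le_of_sq_le_sq' ?_ (norm_nonneg _)).2
      rw [h.norm_radical_sq ht.1.le, mul_pow, Real.sq_sqrt (by positivity), Real.sq_sqrt hts.le]
      have e1 := Hκ s ⟨hs.1, by linarith [hs.2]⟩ t ⟨by linarith [hs.1, ht.1], ht.2⟩
      rw [abs_sub_comm, abs_of_pos hts] at e1
      have e2 : m ≤ ‖α s - conj (α t)‖ := by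
        have e3 := Complex.abs_im_le_norm (α s - conj (α t))
        rw [Complex.sub_im, Complex.conj_im] at e3
        have := le_abs_self ((α s).im - -(α t).im)
        linarith [hmin s hs, h.im_pos t]
      calc κ * m * (t - s) = (κ * (t - s)) * m := by ring
        _ ≤ _ := by gcongr
    calc ‖dkern α μ t (α s)‖ ≤ 1 + ‖α s - ((α t).re : ℂ)‖ / ‖radical α μ t (α s)‖ := by
          rw [dkern]
          refine (norm_add_le _ _).trans ?_
          rw [norm_one, norm_div]
      _ ≤ 1 + 2 * B / (√(κ * m) * √(t - s)) := by gcongr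
      _ ≤ C₁ * (√(t - s))⁻¹ := by
          rw [hC₁, add_mul, ← div_eq_mul_inv, ← div_eq_mul_inv, div_div]
          gcongr
          rw [le_div_iff₀ hq, one_mul]
          exact Real.sqrt_le_sqrt (by linarith [ht.2, hs.1])
      _ ≤ max C₁ (6 / m) * (√(t - s))⁻¹ := by gcongr; exact le_max_left _ _
  · calc ‖dkern α μ t (α s)‖ ≤ 6 * ‖α t - μ‖ / ‖α s - μ‖ := (hfar t ht).2
      _ ≤ 6 * ‖α t - μ‖ / m := by gcongr; exact hmr s hs
      _ = 6 / m * ‖α t - μ‖ := by ring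
      _ ≤ _ := by gcongr; exact le_max_right _ _

theorem continuousOn_dkern (h : AdmissibleCurve α μ) (s : ℝ) :
    ContinuousOn (fun t => dkern α μ t (α s)) (Ioi s) := fun t ht => by
  have h1 : ContinuousAt (fun t : ℝ => (t, s)) t := by fun_prop
  exact (ContinuousAt.comp (f := fun t : ℝ => (t, s)) (h.continuousAt_dkern ht) h1).continuousWithinAt

theorem integrableOn_norm (h : AdmissibleCurve α μ) (T : ℝ) :
    IntegrableOn (fun t => ‖α t - μ‖) (Ioi T) := (h.integrableOn T).norm

/-- The integrals of `|dkern|` over the parameter are bounded on compact sets. -/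
theorem exists_integral_dkern_le (h : AdmissibleCurve α μ) (h12 : x₁ ≤ x₂) :
    ∃ B, ∀ s ∈ Icc x₁ x₂, IntegrableOn (fun t => dkern α μ t (α s)) (Ioi s) ∧
      ∫ t in Ioi s, ‖dkern α μ t (α s)‖ ≤ B := by
  obtain ⟨T, hT, C, hC, H⟩ := h.exists_dkern_bound h12
  refine ⟨C * (∫ u in 0..T - x₁, (√|u|)⁻¹) + C * ∫ t in Ioi T, ‖α t - μ‖, fun s hs => ?_⟩
  obtain ⟨H1, H2, -⟩ := H s hs
  have hsT : s ≤ T := by linarith [hs.2]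
  have hm : ∀ S ⊆ Ioi s, MeasurableSet S →
      AEStronglyMeasurable (fun t => dkern α μ t (α s)) (volume.restrict S) := fun S hS hSm =>
    ((h.continuousOn_dkern s).mono hS).aestronglyMeasurable hSm
  have d1 : IntegrableOn (fun t => C * (√|t - s|)⁻¹) (Ioc s T) :=
    (intervalIntegrable_iff_integrableOn_Ioc_of_le hsT).1
      ((intervalIntegrable_inv_sqrt_abs s s T).const_mul C)
  have d2 : IntegrableOn (fun t => C * ‖α t - μ‖) (Ioi T) := (h.integrableOn_norm T).const_mul C
  have b1 : ∀ᵐ t ∂volume.restrict (Ioc s T), ‖dkern α μ t (α s)‖ ≤ C * (√|t - s|)⁻¹ :=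
    (ae_restrict_mem measurableSet_Ioc).mono fun t ht => H1 t ht
  have b2 : ∀ᵐ t ∂volume.restrict (Ioi T), ‖dkern α μ t (α s)‖ ≤ C * ‖α t - μ‖ :=
    (ae_restrict_mem measurableSet_Ioi).mono fun t ht => H2 t (le_of_lt ht)
  have i1 : IntegrableOn (fun t => dkern α μ t (α s)) (Ioc s T) :=
    Integrable.mono' d1 (hm _ Ioc_subset_Ioi_self measurableSet_Ioc) b1
  have i2 : IntegrableOn (fun t => dkern α μ t (α s)) (Ioi T) :=
    Integrable.mono' d2 (hm _ (Ioi_subset_Ioi hsT) measurableSet_Ioi) b2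
  have hU := Ioc_union_Ioi_eq_Ioi hsT
  refine ⟨by rw [← hU]; exact i1.union i2, ?_⟩
  rw [← hU, setIntegral_union (Ioc_disjoint_Ioi le_rfl) measurableSet_Ioi i1.norm i2.norm]
  refine add_le_add ?_ ?_
  · refine (integral_mono_ae i1.norm d1 b1).trans ?_
    rw [integral_const_mul]
    gcongr
    rw [← intervalIntegral.integral_of_le hsT,
      intervalIntegral.integral_comp_sub_right (fun u => (√|u|)⁻¹), sub_self]
    refine intervalIntegral.integral_mono_interval le_rfl (by linarith) (by linarith [hs.1])
      (ae_of_all _ fun u => inv_nonneg.2 (Real.sqrt_nonneg _)) ?_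
    simpa using intervalIntegrable_inv_sqrt_abs 0 0 (T - x₁)
  · refine (integral_mono_ae i2.norm d2 b2).trans ?_
    rw [integral_const_mul]

theorem integrableOn_dkern (h : AdmissibleCurve α μ) (s : ℝ) :
    IntegrableOn (fun t => dkern α μ t (α s)) (Ioi s) := by
  obtain ⟨B, hB⟩ := h.exists_integral_dkern_le (le_refl s)
  exact (hB s ⟨le_rfl, le_rfl⟩).1

/-- Interchanging the integrations over the curve and over the parameter. -/
theorem integral_mul_dkernIntegral (h : AdmissibleCurve α μ) (h12 : x₁ ≤ x₂) {ψ : ℝ → ℂ}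
    (hψ : IntervalIntegrable ψ volume x₁ x₂) :
    IntegrableOn (fun t => ∫ s in x₁..min t x₂, ψ s * dkern α μ t (α s)) (Ioi x₁) ∧
    ∫ s in x₁..x₂, ψ s * dkernIntegral α μ s =
      ∫ t in Ioi x₁, ∫ s in x₁..min t x₂, ψ s * dkern α μ t (α s) := by
  rw [intervalIntegrable_iff_integrableOn_Ioc_of_le h12] at hψ
  obtain ⟨B, hB⟩ := h.exists_integral_dkern_le h12
  set E : Set (ℝ × ℝ) := {p | p.1 < p.2} with hE
  have hEo : IsOpen E := isOpen_lt continuous_fst continuous_snd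
  set ν := volume.restrict (Ioc x₁ x₂) with hν
  set Ψ : ℝ × ℝ → ℂ := fun p => ψ p.1 * E.indicator (fun p => dkern α μ p.2 (α p.1)) p with hΨ
  have hcont : ContinuousOn (fun p : ℝ × ℝ => dkern α μ p.2 (α p.1)) E := fun p hp => by
    have h1 : ContinuousAt Prod.swap p := continuous_swap.continuousAt
    exact (ContinuousAt.comp (f := Prod.swap) (h.continuousAt_dkern hp) h1).continuousWithinAt
  have hΨm : AEStronglyMeasurable Ψ (ν.prod volume) :=
    (hψ.aestronglyMeasurable.comp_fst).mul
      ((aestronglyMeasurable_indicator_iff hEo.measurableSet).2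
        (hcont.aestronglyMeasurable hEo.measurableSet))
  have hΨs : ∀ s, (fun t => Ψ (s, t)) = (Ioi s).indicator fun t => ψ s * dkern α μ t (α s) := fun s => by
    ext t
    by_cases hst : s < t
    · rw [indicator_of_mem (show t ∈ Ioi s from hst)]
      simp only [hΨ, indicator_of_mem (show (s, t) ∈ E from hst)]
    · rw [indicator_of_notMem (show t ∉ Ioi s from hst)]
      simp only [hΨ, indicator_of_notMem (show (s, t) ∉ E from hst), mul_zero]
  have hΨi : Integrable Ψ (ν.prod volume) := by
    rw [integrable_prod_iff hΨm]
    refine ⟨(ae_restrict_mem measurableSet_Ioc).mono fun s hs => ?_, ?_⟩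
    · rw [hΨs, integrable_indicator_iff measurableSet_Ioi]
      exact (hB s (Ioc_subset_Icc_self hs)).1.const_mul _
    · refine Integrable.mono' (g := fun s => ‖ψ s‖ * B) (hψ.norm.mul_const B)
        hΨm.norm.integral_prod_right' ((ae_restrict_mem measurableSet_Ioc).mono fun s hs => ?_)
      have h1 : (fun t => ‖Ψ (s, t)‖) =
          (Ioi s).indicator fun t => ‖ψ s‖ * ‖dkern α μ t (α s)‖ := by
        ext t
        rw [show Ψ (s, t) = (fun t => Ψ (s, t)) t from rfl, hΨs, norm_indicator_eq_indicator_norm]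
        simp only [norm_mul]
      rw [h1, integral_indicator measurableSet_Ioi, integral_const_mul, norm_mul, norm_norm,
        Real.norm_of_nonneg (by positivity)]
      gcongr
      exact (hB s (Ioc_subset_Icc_self hs)).2
  have hswap := integral_integral_swap (f := fun s t => Ψ (s, t)) hΨi
  have hR := hΨi.integral_prod_right
  -- For fixed `t` only `s < t` contributes, so the inner integral stops at `min t x₂`.
  have hinner : ∀ t, ∫ s, Ψ (s, t) ∂ν =
      (Ioi x₁).indicator (fun t => ∫ s in x₁..min t x₂, ψ s * dkern α μ t (α s)) t := fun t => by
    have h2 : (fun s => Ψ (s, t)) = (Iio t).indicator fun s => ψ s * dkern α μ t (α s) := by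
      ext s
      by_cases hst : s < t
      · rw [indicator_of_mem (show s ∈ Iio t from hst)]
        simp only [hΨ, indicator_of_mem (show (s, t) ∈ E from hst)]
      · rw [indicator_of_notMem (show s ∉ Iio t from hst)]
        simp only [hΨ, indicator_of_notMem (show (s, t) ∉ E from hst), mul_zero]
    rw [h2, integral_indicator measurableSet_Iio, hν, Measure.restrict_restrict measurableSet_Iio]
    by_cases ht : x₁ < t
    · rw [indicator_of_mem (show t ∈ Ioi x₁ from ht), intervalIntegral.integral_of_le (le_min ht.le h12)]
      have h3 : (Iio t ∩ Ioc x₁ x₂ : Set ℝ) =ᵐ[volume] (Iic t ∩ Ioc x₁ x₂ : Set ℝ) :=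
        Iio_ae_eq_Iic.inter (ae_eq_refl _)
      have h4 : Iic t ∩ Ioc x₁ x₂ = Ioc x₁ (min t x₂) := by
        ext s; simp only [mem_inter_iff, mem_Iic, mem_Ioc, le_min_iff]; tauto
      rw [← h4]
      exact setIntegral_congr_set h3
    · rw [indicator_of_notMem (show t ∉ Ioi x₁ from ht)]
      rw [show Iio t ∩ Ioc x₁ x₂ = ∅ by
        ext s; simp only [mem_inter_iff, mem_Iio, mem_Ioc, mem_empty_iff_false, iff_false]
        intro h4; exact ht (h4.2.1.trans h4.1)]
      simp
  rw [funext hinner] at hR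
  rw [integrable_indicator_iff measurableSet_Ioi] at hR
  refine ⟨hR, ?_⟩
  rw [funext hinner, integral_indicator measurableSet_Ioi] at hswap
  rw [← hswap, intervalIntegral.integral_of_le h12]
  refine integral_congr_ae (ae_of_all _ fun s => ?_)
  simp only
  rw [show (∫ t, Ψ (s, t)) = ∫ t, (fun t => Ψ (s, t)) t from rfl, hΨs,
    integral_indicator measurableSet_Ioi, integral_const_mul, dkernIntegral]

end AdmissibleCurve

namespace AdmissibleCurve

variable {α : ℝ → ℂ} {μ : ℝ} {x₁ x₂ s t : ℝ} {z : ℂ}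

theorem hasDerivAt_kern (h : AdmissibleCurve α μ) (hz : z ∉ cut α μ t) :
    HasDerivAt (kern α μ t) (dkern α μ t z) z := by
  have hN := (h.isOpen_compl_cut t).mem_nhds hz
  have hR0 := h.radical_ne_zero hz
  have hc := ((h.differentiableOn_radical t).differentiableAt hN).continuousAt
  have h1 : HasDerivAt (fun w => (w - α t) * (w - conj (α t)))
      (1 * (z - conj (α t)) + (z - α t) * 1) z :=
    ((hasDerivAt_id z).sub_const _).mul ((hasDerivAt_id z).sub_const _)
  have h2 := h1.congr_of_eventuallyEq (f₁ := fun w => radical α μ t w ^ 2)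
    (by filter_upwards [hN] with w hw using h.radical_sq hw)
  have h3 := hasDerivAt_of_sq (𝕜 := ℂ) hc hR0 h2
  have h4 := ((hasDerivAt_id z).sub_const (μ : ℂ)).add h3
  refine h4.congr_deriv ?_
  rw [dkern]
  congr 1
  rw [div_eq_div_iff (mul_ne_zero two_ne_zero hR0) hR0]
  have : α t + conj (α t) = 2 * ((α t).re : ℂ) := by
    rw [Complex.add_conj]; push_cast; ring
  linear_combination -radical α μ t z * this

theorem hasDerivAt_kern_curve (h : AdmissibleCurve α μ) (hst : s < t) :
    HasDerivAt (fun s => kern α μ t (α s)) (dkern α μ t (α s) * deriv α s) s :=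
  (h.hasDerivAt_kern (h.notMem_cut_of_lt hst)).comp_of_eq s
    (h.contDiff.differentiable (by norm_num) s).hasDerivAt rfl

theorem kern_self (α : ℝ → ℂ) (μ t : ℝ) : kern α μ t (α t) = α t - μ := by
  rw [kern, radical_self, add_zero]

theorem continuousOn_kern_curve (h : AdmissibleCurve α μ) (t : ℝ) :
    ContinuousOn (fun s => kern α μ t (α s)) (Iic t) := by
  intro s hs
  rcases (show s ≤ t from hs).eq_or_lt with rfl | hst
  · have h1 : Tendsto (fun r => radical α μ s (α r)) (𝓝[Iic s] s) (𝓝 0) := by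
      have hc : Continuous fun r => √(‖α r - α s‖ * ‖α r - conj (α s)‖) := by
        have := h.continuous
        fun_prop
      have h2 := hc.tendsto s
      rw [sub_self, norm_zero, zero_mul, Real.sqrt_zero] at h2
      refine squeeze_zero_norm' ?_ (h2.mono_left nhdsWithin_le_nhds)
      filter_upwards [self_mem_nhdsWithin] with r hr
      rw [← h.norm_radical_sq hr, Real.sqrt_sq (norm_nonneg _)]
    have h3 : Tendsto (fun r => α r - μ) (𝓝[Iic s] s) (𝓝 (α s - μ)) :=
      ((h.continuous.sub continuous_const).tendsto s).mono_left nhdsWithin_le_nhds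
    have h4 := h3.add h1
    rw [ContinuousWithinAt, kern_self]
    simpa only [kern, add_zero] using h4
  · exact (h.hasDerivAt_kern_curve hst).continuousAt.continuousWithinAt

theorem intervalIntegrable_dkern_curve (h : AdmissibleCurve α μ) (hst : s ≤ t) :
    IntervalIntegrable (fun r => dkern α μ t (α r)) volume s t := by
  obtain ⟨T, hT, C, hC, H⟩ := h.exists_dkern_bound hst
  have hd := (intervalIntegrable_inv_sqrt_abs t s t).const_mul C
  rw [intervalIntegrable_iff_integrableOn_Ioo_of_le hst] at hd ⊢
  have hc : ContinuousOn (fun r => dkern α μ t (α r)) (Ioo s t) := fun r hr => by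
    have h1 : ContinuousAt (fun r : ℝ => (t, r)) r := by fun_prop
    exact (ContinuousAt.comp (f := fun r : ℝ => (t, r)) (h.continuousAt_dkern hr.2)
      h1).continuousWithinAt
  refine Integrable.mono' hd (hc.aestronglyMeasurable measurableSet_Ioo)
    ((ae_restrict_mem measurableSet_Ioo).mono fun r hr => ?_)
  rw [abs_sub_comm]
  exact (H r (Ioo_subset_Icc_self hr)).1 t ⟨hr.2, hT.le⟩

theorem integral_dkern_curve (h : AdmissibleCurve α μ) (h12 : x₁ ≤ x₂) (h2 : x₂ ≤ t) :
    ∫ s in x₁..x₂, deriv α s * dkern α μ t (α s) = kern α μ t (α x₂) - kern α μ t (α x₁) := by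
  have hi : IntervalIntegrable (fun s => deriv α s * dkern α μ t (α s)) volume x₁ x₂ := by
    refine IntervalIntegrable.continuousOn_mul ?_ (h.contDiff.continuous_deriv le_rfl).continuousOn
    refine (h.intervalIntegrable_dkern_curve (h12.trans h2)).mono_set ?_
    rw [uIcc_of_le h12, uIcc_of_le (h12.trans h2)]; exact Icc_subset_Icc le_rfl h2
  refine intervalIntegral.integral_eq_sub_of_hasDerivAt_of_le h12
    ((h.continuousOn_kern_curve t).mono fun s hs => hs.2.trans h2) (fun s hs => ?_) hi
  rw [mul_comm]
  exact h.hasDerivAt_kern_curve (hs.2.trans_le h2)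

theorem continuousOn_kern (h : AdmissibleCurve α μ) (s : ℝ) :
    ContinuousOn (fun t => kern α μ t (α s)) (Ioi s) := fun t ht => by
  have h1 : ContinuousAt (fun t : ℝ => (t, s)) t := by fun_prop
  exact (continuousAt_const.add (ContinuousAt.comp (f := fun t : ℝ => (t, s))
    (h.continuousAt_radical_curve ht) h1)).continuousWithinAt

theorem integrableOn_kern (h : AdmissibleCurve α μ) (s : ℝ) :
    IntegrableOn (fun t => kern α μ t (α s)) (Ioi s) := by
  obtain ⟨T, hT, C, hC, H⟩ := h.exists_dkern_bound (le_refl s)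
  obtain ⟨-, -, H3⟩ := H s ⟨le_rfl, le_rfl⟩
  have hm : ∀ S ⊆ Ioi s, MeasurableSet S →
      AEStronglyMeasurable (fun t => kern α μ t (α s)) (volume.restrict S) := fun S hS hSm =>
    ((h.continuousOn_kern s).mono hS).aestronglyMeasurable hSm
  rw [← Ioc_union_Ioi_eq_Ioi hT.le]
  refine IntegrableOn.union ?_ ?_
  · have hcα := h.continuous
    have hcα' := Complex.continuous_conj.comp hcα
    have hc : Continuous fun t => ‖α s - μ‖ + √(‖α s - α t‖ * ‖α s - conj (α t)‖) := by
      fun_prop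
    refine Integrable.mono' ((hc.intervalIntegrable s T).1) (hm _ Ioc_subset_Ioi_self measurableSet_Ioc)
      ((ae_restrict_mem measurableSet_Ioc).mono fun t ht => ?_)
    rw [kern]
    refine (norm_add_le _ _).trans (add_le_add le_rfl ?_)
    rw [← h.norm_radical_sq ht.1.le, Real.sqrt_sq (norm_nonneg _)]
  · exact Integrable.mono' ((h.integrableOn_norm T).const_mul 3)
      (hm _ (Ioi_subset_Ioi hT.le) measurableSet_Ioi)
      ((ae_restrict_mem measurableSet_Ioi).mono fun t ht => H3 t (le_of_lt ht))

/-- Dominated convergence. The singularity of the integrand moves with `s`, so up to a fixed `T` it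
is pinned at the origin, where the majorant `C u^{-1/2}` no longer depends on `s`. -/
theorem continuous_dkernIntegral (h : AdmissibleCurve α μ) : Continuous (dkernIntegral α μ) := by
  rw [continuous_iff_continuousAt]
  intro x
  obtain ⟨T, hT, C, hC, H⟩ := h.exists_dkern_bound (show x - 1 ≤ x + 1 by linarith)
  have hN : Ioo (x - 1) (x + 1) ∈ 𝓝 x := Ioo_mem_nhds (by linarith) (by linarith)
  -- the part over `(s, T]`, in the variable `u = t - s`
  set f : ℝ → ℝ → ℂ := fun s u => (Ioc 0 (T - s)).indicator (fun u => dkern α μ (u + s) (α s)) u with hf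
  have hc1 : ContinuousAt (fun s => ∫ u, f s u) x := by
    refine continuousAt_of_dominated (bound := (Ioc 0 (T - x + 1)).indicator
      fun u => C * (√|u|)⁻¹) ?_ ?_ ?_ ?_
    · filter_upwards [hN] with s hs
      refine (aestronglyMeasurable_indicator_iff measurableSet_Ioc).2
        (ContinuousOn.aestronglyMeasurable ?_ measurableSet_Ioc)
      exact (h.continuousOn_dkern s).comp (by fun_prop) fun u hu => by
        simp only [mem_Ioi]; linarith [hu.1]
    · filter_upwards [hN] with s hs
      refine ae_of_all _ fun u => ?_
      by_cases hu : u ∈ Ioc 0 (T - s)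
      · have hu' : u ∈ Ioc 0 (T - x + 1) := ⟨hu.1, by linarith [hu.2, hs.1]⟩
        simp only [hf, indicator_of_mem hu, indicator_of_mem hu']
        have := (H s (Ioo_subset_Icc_self hs)).1 (u + s) ⟨by linarith [hu.1], by linarith [hu.2]⟩
        rwa [add_sub_cancel_right] at this
      · simp only [hf, indicator_of_notMem hu, norm_zero]
        exact indicator_nonneg (fun u _ => mul_nonneg hC (inv_nonneg.2 (Real.sqrt_nonneg _))) _
    · rw [integrable_indicator_iff measurableSet_Ioc]
      have := (intervalIntegrable_inv_sqrt_abs 0 0 (T - x + 1)).const_mul C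
      simpa using this.1
    · have hne : ∀ᵐ u : ℝ, u ≠ T - x ∧ u ≠ 0 :=
        (Measure.ae_ne volume (T - x)).and (Measure.ae_ne volume 0)
      filter_upwards [hne] with u hu
      by_cases hu1 : u ∈ Ioc 0 (T - x)
      · have h1 : u < T - x := lt_of_le_of_ne hu1.2 hu.1
        have hev : ∀ᶠ s in 𝓝 x, dkern α μ (u + s) (α s) = f s u := by
          filter_upwards [gt_mem_nhds (show x < T - u by linarith)] with s hs
          simp only [hf]
          have hm : u ∈ Ioc 0 (T - s) := ⟨hu1.1, by linarith⟩
          rw [indicator_of_mem hm]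
        refine ContinuousAt.congr ?_ hev
        have h2 : ContinuousAt (fun s : ℝ => (u + s, s)) x := by fun_prop
        exact ContinuousAt.comp (f := fun s : ℝ => (u + s, s))
          (h.continuousAt_dkern (by simpa using hu1.1)) h2
      · have hev : ∀ᶠ s in 𝓝 x, (0 : ℂ) = f s u := by
          rcases le_or_gt u 0 with h1 | h1
          · refine Eventually.of_forall fun s => ?_
            simp only [hf]
            rw [indicator_of_notMem fun h2 => absurd h2.1 (not_lt.2 h1)]
          · have h3 : T - x < u := lt_of_not_ge fun h4 => hu1 ⟨h1, h4⟩
            filter_upwards [lt_mem_nhds (show T - u < x by linarith)] with s hs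
            simp only [hf]
            rw [indicator_of_notMem fun h2 => by linarith [h2.2]]
        exact continuousAt_const.congr hev
  have hc2 : ContinuousAt (fun s => ∫ t in Ioi T, dkern α μ t (α s)) x := by
    refine continuousAt_of_dominated (bound := fun t => C * ‖α t - μ‖) ?_ ?_ ?_ ?_
    · filter_upwards [hN] with s hs
      exact ((h.continuousOn_dkern s).mono (Ioi_subset_Ioi (by linarith [hs.2]))).aestronglyMeasurable
        measurableSet_Ioi
    · filter_upwards [hN] with s hs
      exact (ae_restrict_mem measurableSet_Ioi).mono fun t ht =>
        (H s (Ioo_subset_Icc_self hs)).2.1 t (le_of_lt ht)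
    · exact (h.integrableOn_norm T).const_mul C
    · refine (ae_restrict_mem measurableSet_Ioi).mono fun t ht => ?_
      have h1 : ContinuousAt (fun s : ℝ => (t, s)) x := by fun_prop
      refine ContinuousAt.comp (f := fun s : ℝ => (t, s)) (h.continuousAt_dkern ?_) h1
      have : T < t := ht
      linarith
  refine (hc1.add hc2).congr ?_
  filter_upwards [hN] with s hs
  have hsT : s ≤ T := by linarith [hs.2]
  have hI := h.integrableOn_dkern s
  rw [dkernIntegral, ← Ioc_union_Ioi_eq_Ioi hsT, setIntegral_union (Ioc_disjoint_Ioi le_rfl)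
    measurableSet_Ioi (hI.mono_set Ioc_subset_Ioi_self) (hI.mono_set (Ioi_subset_Ioi hsT))]
  simp only [Pi.add_apply]
  congr 1
  simp only [hf]
  rw [integral_indicator measurableSet_Ioc, ← intervalIntegral.integral_of_le (by linarith),
    ← intervalIntegral.integral_of_le hsT,
    intervalIntegral.integral_comp_add_right (fun t => dkern α μ t (α s))]
  simp

/-! ### The potential along the curve and its derivative. -/

/-- The function `f₀(α s)`, up to the additive constant. -/
noncomputable def potential (α : ℝ → ℂ) (μ : ℝ) (s : ℝ) : ℂ :=
  (∫ t in Ioi s, kern α μ t (α s)) + (α s - μ) * s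

/-- Fubini replaces differentiation under an integral with a moving singular end point. Along the
curve `dkern` integrates to differences of `kern`. The diagonal value `kern α μ t (α t) = α t - μ`
cancels the term `∫ (α s - μ) ds` that arises when `(α s - μ) s` is integrated by parts. -/
theorem potential_sub (h : AdmissibleCurve α μ) (h12 : x₁ ≤ x₂) :
    potential α μ x₂ - potential α μ x₁ =
      ∫ s in x₁..x₂, (dkernIntegral α μ s + s) * deriv α s := by
  have hd : Continuous (deriv α) := h.contDiff.continuous_deriv le_rfl
  have hcα := h.continuous
  have hφ := h.continuous_dkernIntegral
  obtain ⟨hI, hF⟩ := h.integral_mul_dkernIntegral h12 (hd.intervalIntegrable x₁ x₂)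
  have e1 : ∀ t ∈ Ioi x₁, ∫ s in x₁..min t x₂, deriv α s * dkern α μ t (α s) =
      kern α μ t (α (min t x₂)) - kern α μ t (α x₁) := fun t ht =>
    h.integral_dkern_curve (le_min (le_of_lt ht) h12) (min_le_left _ _)
  have hk1 := h.integrableOn_kern x₁
  have hk2 := h.integrableOn_kern x₂
  rw [setIntegral_congr_fun measurableSet_Ioi e1] at hF
  have hk3 : IntegrableOn (fun t => kern α μ t (α (min t x₂))) (Ioi x₁) := by
    have h1 : IntegrableOn (fun t => (kern α μ t (α (min t x₂)) - kern α μ t (α x₁)) +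
      kern α μ t (α x₁)) (Ioi x₁) := (hI.congr_fun e1 measurableSet_Ioi).add hk1
    simpa using h1
  rw [integral_sub hk3 hk1, ← Ioc_union_Ioi_eq_Ioi h12, setIntegral_union (Ioc_disjoint_Ioi le_rfl)
    measurableSet_Ioi (hk3.mono_set Ioc_subset_Ioi_self) (hk3.mono_set (Ioi_subset_Ioi h12)),
    Ioc_union_Ioi_eq_Ioi h12,
    setIntegral_congr_fun measurableSet_Ioc (g := fun t => α t - μ) (fun t ht => by
      simp only [min_eq_left ht.2, kern_self]),
    setIntegral_congr_fun measurableSet_Ioi (g := fun t => kern α μ t (α x₂)) (fun t ht => by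
      simp only [min_eq_right (mem_Ioi.1 ht).le]), ← intervalIntegral.integral_of_le h12] at hF
  have hparts : ∫ s in x₁..x₂, ((s : ℂ) * deriv α s + (α s - μ)) =
      (α x₂ - μ) * x₂ - (α x₁ - μ) * x₁ := by
    refine intervalIntegral.integral_eq_sub_of_hasDerivAt (f := fun s : ℝ => (α s - μ) * (s : ℂ))
      (fun s _ => ?_) ((by fun_prop : Continuous _).intervalIntegrable _ _)
    have h1 := ((h.contDiff.differentiable (by norm_num) s).hasDerivAt.sub_const (μ : ℂ)).mul
      (Complex.ofRealCLM.hasDerivAt (x := s))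
    refine h1.congr_deriv ?_
    simp; ring
  have hi1 : IntervalIntegrable (fun s : ℝ => (s : ℂ) * deriv α s) volume x₁ x₂ :=
    (by fun_prop : Continuous _).intervalIntegrable _ _
  have hi2 : IntervalIntegrable (fun s : ℝ => α s - μ) volume x₁ x₂ :=
    (by fun_prop : Continuous _).intervalIntegrable _ _
  have hi3 : IntervalIntegrable (fun s : ℝ => deriv α s * dkernIntegral α μ s) volume x₁ x₂ :=
    (by fun_prop : Continuous _).intervalIntegrable _ _
  rw [intervalIntegral.integral_add hi1 hi2] at hparts
  have hsplit : ∫ s in x₁..x₂, (dkernIntegral α μ s + s) * deriv α s =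
      (∫ s in x₁..x₂, deriv α s * dkernIntegral α μ s) + ∫ s in x₁..x₂, (s : ℂ) * deriv α s := by
    rw [← intervalIntegral.integral_add hi3 hi1]
    exact intervalIntegral.integral_congr fun s _ => by ring
  rw [hsplit, hF, potential, potential]
  linear_combination -hparts

theorem hasDerivAt_potential (h : AdmissibleCurve α μ) (s : ℝ) :
    HasDerivAt (potential α μ) ((dkernIntegral α μ s + s) * deriv α s) s := by
  have hd : Continuous (deriv α) := h.contDiff.continuous_deriv le_rfl
  have hφ := h.continuous_dkernIntegral
  have hc : Continuous fun s : ℝ => (dkernIntegral α μ s + s) * deriv α s := by fun_prop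
  have h1 : HasDerivAt (fun x => (∫ r in (s - 1)..x, (dkernIntegral α μ r + r) * deriv α r) +
      potential α μ (s - 1)) ((dkernIntegral α μ s + s) * deriv α s) s :=
    (intervalIntegral.integral_hasDerivAt_right (hc.intervalIntegrable _ _)
      hc.stronglyMeasurable.stronglyMeasurableAtFilter hc.continuousAt).add_const _
  refine h1.congr_of_eventuallyEq ?_
  filter_upwards [lt_mem_nhds (show s - 1 < s by linarith)] with x hx
  rw [← h.potential_sub hx.le, sub_add_cancel]

end AdmissibleCurve

/-! ### Derivatives along the curve. -/

namespace RegularArc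

variable {α : ℝ → ℂ}

/-- Both ends of the curve approach the real axis, so points with imaginary part above `(α x).im /
2` have parameters in a compact interval, and there injectivity suffices. -/
theorem isEmbedding (h : RegularArc α) (him : ∀ s, 0 < (α s).im)
    (hbot : Tendsto (fun s => (α s).im) atBot (𝓝 0)) (htop : Tendsto (fun s => (α s).im) atTop (𝓝 0)) :
    IsEmbedding α := by
  refine ⟨⟨TopologicalSpace.ext_nhds fun x => ?_⟩, h.inj⟩
  rw [nhds_induced]
  refine le_antisymm h.contDiff.continuous.continuousAt.le_comap ?_
  rw [Metric.nhds_basis_ball.ge_iff]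
  intro ε hε
  have hx := half_pos (him x)
  obtain ⟨a, ha⟩ := eventually_atBot.1 (hbot.eventually (gt_mem_nhds hx))
  obtain ⟨b, hb⟩ := eventually_atTop.1 (htop.eventually (gt_mem_nhds hx))
  set K := Icc a b \ Metric.ball x ε with hK
  have hKc : IsCompact K := isCompact_Icc.diff Metric.isOpen_ball
  have himg : IsClosed (α '' K) := (hKc.image h.contDiff.continuous).isClosed
  have hxK : α x ∉ α '' K := by
    rintro ⟨y, hy, hyx⟩
    rw [h.inj hyx] at hy
    exact hy.2 (Metric.mem_ball_self hε)
  have hN : (α '' K)ᶜ ∩ {z | (α x).im / 2 < z.im} ∈ 𝓝 (α x) :=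
    inter_mem (himg.isOpen_compl.mem_nhds hxK)
      ((isOpen_lt continuous_const Complex.continuous_im).mem_nhds (by
        show (α x).im / 2 < (α x).im
        linarith [him x]))
  refine ⟨_, hN, fun y hy => ?_⟩
  by_contra hyε
  refine hy.1 ⟨y, ⟨⟨?_, ?_⟩, hyε⟩, rfl⟩
  · by_contra h1
    exact absurd hy.2 (not_lt.2 (ha y (le_of_not_ge h1)).le)
  · by_contra h1
    exact absurd hy.2 (not_lt.2 (hb y (le_of_not_ge h1)).le)

/-- The difference quotient along the curve is the quotient of two difference quotients in the
parameter; the embedding property makes the punctured neighbourhoods correspond. -/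
theorem hasDerivWithinAt_of_comp (h : RegularArc α) (he : IsEmbedding α) {f : ℂ → ℂ} {d : ℂ} {x : ℝ}
    (hf : HasDerivAt (fun y => f (α y)) (d * deriv α x) x) :
    HasDerivWithinAt f d (range α) (α x) := by
  rw [hasDerivWithinAt_iff_tendsto_slope]
  have hα := (h.contDiff.differentiable (by norm_num) x).hasDerivAt
  have h1 := hf.tendsto_slope.div hα.tendsto_slope (h.deriv_ne x)
  rw [mul_div_cancel_right₀ _ (h.deriv_ne x)] at h1
  have hle : 𝓝[range α \ {α x}] (α x) ≤ map α (𝓝[≠] x) := by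
    rw [sdiff_eq, nhdsWithin_inter', ← he.map_nhds_eq]
    intro U hU
    rw [mem_map] at hU
    rw [mem_inf_principal', mem_map]
    filter_upwards [mem_nhdsWithin_iff_eventually.1 hU] with y hy
    by_cases hyx : y = x
    · left; simp [hyx]
    · right; exact hy hyx
  refine Tendsto.mono_left ?_ hle
  rw [tendsto_map'_iff]
  refine h1.congr' ?_
  filter_upwards [self_mem_nhdsWithin] with y hy
  have hyx : ((y - x : ℝ) : ℂ) ≠ 0 := Complex.ofReal_ne_zero.2 (sub_ne_zero.2 hy)
  have hyα : α y - α x ≠ 0 := sub_ne_zero.2 fun h0 => hy (h.inj h0)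
  simp only [Pi.div_apply, slope, vsub_eq_sub, Function.comp, Complex.real_smul, smul_eq_mul,
    Complex.ofReal_inv]
  field_simp

theorem uniqueDiffWithinAt_range (h : RegularArc α) (x : ℝ) :
    UniqueDiffWithinAt ℂ (range α) (α x) := by
  rw [uniqueDiffWithinAt_iff_accPt, accPt_principal_iff_nhdsWithin]
  have : Tendsto α (𝓝[≠] x) (𝓝[range α \ {α x}] (α x)) := by
    refine tendsto_nhdsWithin_iff.2 ⟨h.contDiff.continuous.continuousAt.mono_left nhdsWithin_le_nhds, ?_⟩
    filter_upwards [self_mem_nhdsWithin] with y hy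
    exact ⟨⟨y, rfl⟩, fun h0 => hy (h.inj h0)⟩
  exact this.neBot

theorem xinv_eq (h : RegularArc α) (x : ℝ) : xinv α (α x) = x := by
  rw [xinv, Function.leftInverse_invFun h.inj x]

/-- This is `x'(u) du = dy`, by which all integrals along `Σ` become integrals in the parameter. -/
theorem xinv'_mul_deriv (h : RegularArc α) (he : IsEmbedding α) (x : ℝ) :
    xinv' α (α x) * deriv α x = 1 := by
  have h1 : HasDerivAt (fun y => xinv α (α y)) ((deriv α x)⁻¹ * deriv α x) x := by
    rw [inv_mul_cancel₀ (h.deriv_ne x)]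
    simp only [h.xinv_eq]
    exact Complex.ofRealCLM.hasDerivAt
  rw [xinv', (h.hasDerivWithinAt_of_comp he h1).derivWithin (h.uniqueDiffWithinAt_range x),
    inv_mul_cancel₀ (h.deriv_ne x)]

end RegularArc

/-! ### The function `f₀` and the integrands of the transform on the symmetric curve. -/

theorem f0_conj (α : ℝ → ℂ) (μ c : ℝ) (z : ℂ) : f0 α μ c (conj z) = conj (f0 α μ c z) := by
  unfold f0
  rcases lt_trichotomy z.im 0 with h | h | h
  · simp [h, h.not_gt]
  · simp [h]
  · simp [h, h.not_gt]

theorem conj_mem_symCurve {α : ℝ → ℂ} {z : ℂ} (hz : z ∈ symCurve α) : conj z ∈ symCurve α := by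
  rcases hz with h | ⟨w, hw, rfl⟩
  · exact Or.inr ⟨z, h, rfl⟩
  · rw [Complex.conj_conj]; exact Or.inl hw

theorem hasDerivWithinAt_conj_conj {f : ℂ → ℂ} {S : Set ℂ} {z d : ℂ}
    (hf : HasDerivWithinAt f d S z) (hS : ∀ w ∈ S, conj w ∈ S) :
    HasDerivWithinAt (fun z => conj (f (conj z))) (conj d) S (conj z) := by
  rw [hasDerivWithinAt_iff_tendsto_slope] at hf ⊢
  have h1 : Tendsto (fun w : ℂ => conj w) (𝓝[S \ {conj z}] (conj z)) (𝓝[S \ {z}] z) := by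
    refine tendsto_nhdsWithin_iff.2 ⟨?_, ?_⟩
    · have := Complex.continuous_conj.tendsto (conj z)
      rw [Complex.conj_conj] at this
      exact this.mono_left nhdsWithin_le_nhds
    · filter_upwards [self_mem_nhdsWithin] with w hw
      refine ⟨hS w hw.1, fun h0 => hw.2 ?_⟩
      rw [mem_singleton_iff] at h0 ⊢
      rw [← h0, Complex.conj_conj]
  refine ((Complex.continuous_conj.tendsto d).comp (hf.comp h1)).congr fun w => ?_
  simp [slope, Function.comp]

namespace AdmissibleCurve

variable {α : ℝ → ℂ} {μ c ξ s : ℝ}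

theorem embedding (h : AdmissibleCurve α μ) : IsEmbedding α := by
  refine h.isEmbedding h.im_pos h.im_atBot ?_
  have := (Complex.continuous_im.tendsto _).comp h.tendsto
  rwa [Complex.ofReal_im] at this

theorem f0Integrand_eq (h : AdmissibleCurve α μ) (z : ℂ) (y : ℝ) :
    f0Integrand α μ z y = kern α μ y z := by
  rw [f0Integrand, mul_assoc, h.xinv'_mul_deriv h.embedding, mul_one, kern]

theorem df0Integrand_eq (h : AdmissibleCurve α μ) (z : ℂ) (y : ℝ) :
    df0Integrand α μ z y = dkern α μ y z := by
  rw [df0Integrand, mul_assoc, h.xinv'_mul_deriv h.embedding, mul_one, dkern]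

theorem f0_curve (h : AdmissibleCurve α μ) (c : ℝ) (s : ℝ) :
    f0 α μ c (α s) = potential α μ s + c := by
  rw [f0, if_pos (h.im_pos s), f0Up, h.xinv_eq, Function.leftInverse_invFun h.inj s]
  simp only [h.f0Integrand_eq, potential]

theorem range_mem_nhdsWithin (h : AdmissibleCurve α μ) (s : ℝ) :
    range α ∈ 𝓝[symCurve α] (α s) := by
  have hN : {z : ℂ | 0 < z.im} ∈ 𝓝 (α s) :=
    (isOpen_lt continuous_const Complex.continuous_im).mem_nhds (h.im_pos s)
  filter_upwards [mem_nhdsWithin_of_mem_nhds hN, self_mem_nhdsWithin] with z hz hzS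
  rcases hzS with h1 | ⟨_, ⟨t, rfl⟩, rfl⟩
  · exact h1
  · have h2 : 0 < (conj (α t)).im := hz
    rw [Complex.conj_im] at h2
    linarith [h.im_pos t]

theorem hasDerivWithinAt_f0 (h : AdmissibleCurve α μ) (c : ℝ) (s : ℝ) :
    HasDerivWithinAt (f0 α μ c) (dkernIntegral α μ s + s) (symCurve α) (α s) := by
  refine HasDerivWithinAt.mono_of_mem_nhdsWithin (h.hasDerivWithinAt_of_comp h.embedding ?_)
    (h.range_mem_nhdsWithin s)
  simp only [h.f0_curve]
  exact (h.hasDerivAt_potential s).add_const _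

theorem hasDerivWithinAt_f0_conj (h : AdmissibleCurve α μ) (c : ℝ) (s : ℝ) :
    HasDerivWithinAt (f0 α μ c) (conj (dkernIntegral α μ s + s)) (symCurve α) (conj (α s)) := by
  have h1 := hasDerivWithinAt_conj_conj (h.hasDerivWithinAt_f0 c s) fun w hw => conj_mem_symCurve hw
  simpa only [f0_conj, Complex.conj_conj] using h1

theorem uniqueDiffWithinAt_symCurve (h : AdmissibleCurve α μ) (s : ℝ) :
    UniqueDiffWithinAt ℂ (symCurve α) (α s) :=
  (h.uniqueDiffWithinAt_range s).mono subset_union_left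

theorem f0'_curve (h : AdmissibleCurve α μ) (c : ℝ) (s : ℝ) :
    f0' α μ c (α s) = dkernIntegral α μ s + s :=
  (h.hasDerivWithinAt_f0 c s).derivWithin (h.uniqueDiffWithinAt_symCurve s)

theorem f0'_conj_curve (h : AdmissibleCurve α μ) (c : ℝ) (s : ℝ) :
    f0' α μ c (conj (α s)) = conj (dkernIntegral α μ s + s) := by
  refine (h.hasDerivWithinAt_f0_conj c s).derivWithin ?_
  have h1 := h.uniqueDiffWithinAt_symCurve s
  rw [uniqueDiffWithinAt_iff_accPt, accPt_principal_iff_nhdsWithin] at h1 ⊢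
  have h2 : Tendsto (fun w : ℂ => conj w) (𝓝[symCurve α \ {α s}] (α s))
      (𝓝[symCurve α \ {conj (α s)}] (conj (α s))) := by
    refine tendsto_nhdsWithin_iff.2
      ⟨(Complex.continuous_conj.tendsto _).mono_left nhdsWithin_le_nhds, ?_⟩
    filter_upwards [self_mem_nhdsWithin] with w hw
    exact ⟨conj_mem_symCurve hw.1, fun h0 => hw.2 ((starRingEnd ℂ).injective h0)⟩
  exact h2.neBot

theorem upperIntegrand_eq (h : AdmissibleCurve α μ) (c ξ s : ℝ) :
    upperIntegrand α μ (f0' α μ c) ξ s =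
      (dkernIntegral α μ s + s) / edgeRadical α μ ξ s * deriv α s := by
  rw [upperIntegrand, h.f0'_curve, edgeRadical]

/-- Both `f₀'` and the left boundary values are Schwarz symmetric. Since the two halves run in
opposite parameter directions, only the imaginary part of the upper integral matters. -/
theorem lowerIntegrand_eq (h : AdmissibleCurve α μ) (c : ℝ) (hξ : ξ < s) :
    lowerIntegrand α μ (f0' α μ c) ξ s = conj (upperIntegrand α μ (f0' α μ c) ξ s) := by
  rw [h.upperIntegrand_eq, lowerIntegrand, h.f0'_conj_curve, h.leftValue_conj hξ]
  simp only [map_mul, map_div₀]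

theorem intervalIntegrable_upperIntegrand (h : AdmissibleCurve α μ) (c : ℝ) {T : ℝ} (hT : ξ ≤ T) :
    IntervalIntegrable (upperIntegrand α μ (f0' α μ c) ξ) volume ξ T := by
  have hd : Continuous (deriv α) := h.contDiff.continuous_deriv le_rfl
  have hφ := h.continuous_dkernIntegral
  have hc : Continuous fun s : ℝ => (dkernIntegral α μ s + s) * deriv α s := by fun_prop
  refine ((h.intervalIntegrable_inv_edgeRadical hT).mul_continuousOn hc.continuousOn).congr
    fun s _ => ?_
  rw [h.upperIntegrand_eq]; ring

end AdmissibleCurve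

/-! ### Estimates in a logarithmic Joukowski coordinate. -/

/-- The set of logarithms of points `v` with `|v| + b² / |v| < d`. -/
def logStrip (b d : ℝ) : Set ℂ := {l | Real.exp l.re + b ^ 2 * Real.exp (-l.re) < d}

theorem convex_logStrip (b d : ℝ) : Convex ℝ (logStrip b d) := by
  have h1 : ConvexOn ℝ univ fun l : ℂ => Real.exp l.re :=
    convexOn_exp.comp_linearMap Complex.reLm
  have h2 : ConvexOn ℝ univ fun l : ℂ => Real.exp (-l.re) :=
    convexOn_exp.comp_linearMap (-Complex.reLm)
  have h3 := (h1.add (h2.smul (sq_nonneg b))).convex_lt d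
  simpa [logStrip] using h3

theorem isOpen_logStrip (b d : ℝ) : IsOpen (logStrip b d) := by
  have : Continuous fun l : ℂ => Real.exp l.re + b ^ 2 * Real.exp (-l.re) := by fun_prop
  exact isOpen_lt this continuous_const

/-- Go vertically from `l₁`, over a length at most `π` and with constant majorant `M e^{Re l₁}`, and
horizontally to `l₂`, where `∫ e^x dx` is explicit. The possibly huge difference of the real parts,
`log |v₂/v₁|`, does not enter the bound. -/
theorem norm_sub_le_of_deriv_exp {b d M : ℝ} {P f : ℂ → ℂ} (hM : 0 ≤ M)
    (hf : ContinuousOn f (logStrip b d)) (hP : ∀ l ∈ logStrip b d, HasDerivAt P (f l) l)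
    (hb : ∀ l ∈ logStrip b d, ‖f l‖ ≤ M * Real.exp l.re) {l₁ l₂ : ℂ} (h₁ : l₁ ∈ logStrip b d)
    (h₂ : l₂ ∈ logStrip b d) (him : |l₁.im - l₂.im| ≤ Real.pi) :
    ‖P l₂ - P l₁‖ ≤ M * (Real.pi + 1) * (Real.exp l₁.re + Real.exp l₂.re) := by
  set lm : ℂ := ⟨l₁.re, l₂.im⟩ with hlm
  -- Membership depends on the real part alone.
  have hm : lm ∈ logStrip b d := h₁
  have e1 : ‖P lm - P l₁‖ ≤ M * Real.exp l₁.re * ‖lm - l₁‖ := by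
    have hsub : segment ℝ l₁ lm ⊆ logStrip b d := (convex_logStrip b d).segment_subset h₁ hm
    refine (convex_segment l₁ lm).norm_image_sub_le_of_norm_hasDerivWithin_le (f' := f)
      (fun l hl => (hP l (hsub hl)).hasDerivWithinAt) (fun l hl => ?_)
      (left_mem_segment ℝ _ _) (right_mem_segment ℝ _ _)
    have hre : l.re = l₁.re := by
      obtain ⟨s, t, -, -, hst, rfl⟩ := hl
      simp only [Complex.add_re, Complex.real_smul, Complex.re_ofReal_mul, hlm]
      rw [← add_mul, hst, one_mul]
    rw [← hre]
    exact hb l (hsub hl)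
  have hn : ‖lm - l₁‖ ≤ Real.pi := by
    rw [show lm - l₁ = ((l₂.im - l₁.im : ℝ) : ℂ) * Complex.I by
      apply Complex.ext <;> simp [hlm], norm_mul, Complex.norm_I, mul_one, Complex.norm_real,
      Real.norm_eq_abs, abs_sub_comm]
    exact him
  set L : ℝ → ℂ := fun x => x + l₂.im * Complex.I with hL
  have hLre : ∀ x, (L x).re = x := fun x => by simp [hL]
  have hLm : L l₁.re = lm := by apply Complex.ext <;> simp [hL, hlm]
  have hL2 : L l₂.re = l₂ := by apply Complex.ext <;> simp [hL]
  have hseg : ∀ x ∈ uIcc l₁.re l₂.re, L x ∈ logStrip b d := fun x hx => by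
    rw [← segment_eq_uIcc] at hx
    obtain ⟨s, t, hs, ht, hst, rfl⟩ := hx
    have h3 := convex_logStrip b d hm h₂ hs ht hst
    have h4 : L (s • l₁.re + t • l₂.re) = s • lm + t • l₂ := by
      apply Complex.ext
      · simp [hL, hlm]
      · simp only [hL, hlm, smul_eq_mul, Complex.add_im, Complex.ofReal_im, Complex.mul_im,
          Complex.I_im, mul_one, Complex.I_re, mul_zero, add_zero, zero_add, Complex.real_smul,
          Complex.ofReal_re, zero_mul]
        rw [← add_mul, hst, one_mul]
    rw [h4]; exact h3
  have hLc : Continuous L := by fun_prop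
  have hLd : ∀ x, HasDerivAt L 1 x := fun x => by
    exact (Complex.ofRealCLM.hasDerivAt (x := x)).add_const ((l₂.im : ℂ) * Complex.I)
  have e2 : ‖P l₂ - P lm‖ ≤ M * (Real.exp l₁.re + Real.exp l₂.re) := by
    have hint : ∫ x in l₁.re..l₂.re, f (L x) = P (L l₂.re) - P (L l₁.re) := by
      refine intervalIntegral.integral_eq_sub_of_hasDerivAt (f := fun x => P (L x)) (fun x hx => ?_)
        ((hf.comp hLc.continuousOn hseg).intervalIntegrable)
      have := (hP _ (hseg x hx)).scomp x (hLd x)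
      simpa [Function.comp_def] using this
    rw [hLm, hL2] at hint
    rw [← hint]
    have hbd : ∀ᵐ x ∂volume.restrict (uIoc l₁.re l₂.re), ‖f (L x)‖ ≤ M * Real.exp x :=
      (ae_restrict_mem measurableSet_uIoc).mono fun x hx => by
        have := hb _ (hseg x (uIoc_subset_uIcc hx))
        rwa [hLre] at this
    refine (intervalIntegral.norm_integral_le_abs_of_norm_le hbd
      ((Real.continuous_exp.const_mul M).intervalIntegrable _ _)).trans ?_
    rw [intervalIntegral.integral_const_mul, integral_exp, abs_mul, abs_of_nonneg hM]
    gcongr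
    rw [abs_le]
    constructor <;> linarith [Real.exp_pos l₁.re, Real.exp_pos l₂.re]
  have hE := Real.exp_pos l₁.re
  have hE2 := Real.exp_pos l₂.re
  calc ‖P l₂ - P l₁‖ ≤ ‖P l₂ - P lm‖ + ‖P lm - P l₁‖ := norm_sub_le_norm_sub_add_norm_sub _ _ _
    _ ≤ M * (Real.exp l₁.re + Real.exp l₂.re) + M * Real.exp l₁.re * Real.pi :=
      add_le_add e2 (e1.trans (by gcongr))
    _ ≤ _ := by
      have := mul_nonneg hM (mul_nonneg Real.pi_pos.le hE2.le)
      nlinarith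

/-- The substitution `z - a = (b² / v - v) / 2` with `v = exp l`, for which
`√((z - a)² + b²) = -(b² / v + v) / 2`. -/
noncomputable def joukowski (a b : ℝ) (l : ℂ) : ℂ :=
  a + (b ^ 2 * Complex.exp (-l) - Complex.exp l) / 2

theorem norm_joukowski_sub_le (a b μ : ℝ) {d : ℝ} {l : ℂ} (hl : l ∈ logStrip b d) :
    ‖joukowski a b l - μ‖ ≤ |a - μ| + d / 2 := by
  have h1 : ‖((b : ℂ) ^ 2 * Complex.exp (-l) - Complex.exp l) / 2‖ ≤ d / 2 := by
    rw [norm_div, Complex.norm_ofNat]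
    have h2 : ‖(b : ℂ) ^ 2 * Complex.exp (-l) - Complex.exp l‖ ≤
        b ^ 2 * Real.exp (-l.re) + Real.exp l.re := by
      refine (norm_sub_le _ _).trans (le_of_eq ?_)
      rw [norm_mul, Complex.norm_exp, Complex.norm_exp, Complex.neg_re, norm_pow, Complex.norm_real,
        Real.norm_eq_abs, sq_abs]
    have h3 : Real.exp l.re + b ^ 2 * Real.exp (-l.re) < d := hl
    gcongr
    linarith
  rw [joukowski, show (a : ℂ) + ((b : ℂ) ^ 2 * Complex.exp (-l) - Complex.exp l) / 2 - μ =
    ((a - μ : ℝ) : ℂ) + ((b : ℂ) ^ 2 * Complex.exp (-l) - Complex.exp l) / 2 by push_cast; ring]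
  refine (norm_add_le _ _).trans (add_le_add (le_of_eq ?_) h1)
  rw [Complex.norm_real, Real.norm_eq_abs]

/-- In the variable `v` the domain is an annulus and `q(z(v)) dv` need not have a single-valued
primitive. In `l = log v` the domain is convex, and the primitive exists. -/
theorem exists_primitive_joukowski {q : ℂ → ℂ} {μ r M : ℝ}
    (hq : DifferentiableOn ℂ q (Metric.ball μ r)) (hM : ∀ z ∈ Metric.ball (μ : ℂ) r, ‖q z‖ ≤ M)
    (hM0 : 0 ≤ M) {a b d : ℝ} (had : |a - μ| + d / 2 < r) :
    ∃ P : ℂ → ℂ, (∀ l ∈ logStrip b d, HasDerivAt P (q (joukowski a b l) * Complex.exp l) l) ∧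
      ∀ l₁ ∈ logStrip b d, ∀ l₂ ∈ logStrip b d, |l₁.im - l₂.im| ≤ Real.pi →
        ‖P l₂ - P l₁‖ ≤ M * (Real.pi + 1) * (Real.exp l₁.re + Real.exp l₂.re) := by
  have hmem : ∀ l ∈ logStrip b d, joukowski a b l ∈ Metric.ball (μ : ℂ) r := fun l hl => by
    rw [Metric.mem_ball, dist_eq_norm]
    exact (norm_joukowski_sub_le a b μ hl).trans_lt had
  have hj : Differentiable ℂ (joukowski a b) := by
    unfold joukowski; fun_prop
  have hf : DifferentiableOn ℂ (fun l => q (joukowski a b l) * Complex.exp l) (logStrip b d) :=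
    (hq.comp hj.differentiableOn hmem).mul Complex.differentiable_exp.differentiableOn
  obtain ⟨P, hP⟩ := (convex_logStrip b d).exists_forall_hasDerivWithinAt hf
  have hP' : ∀ l ∈ logStrip b d, HasDerivAt P (q (joukowski a b l) * Complex.exp l) l :=
    fun l hl => (hP l hl).hasDerivAt ((isOpen_logStrip b d).mem_nhds hl)
  refine ⟨P, hP', fun l₁ h₁ l₂ h₂ him =>
    norm_sub_le_of_deriv_exp hM0 hf.continuousOn hP' (fun l hl => ?_) h₁ h₂ him⟩
  rw [norm_mul, Complex.norm_exp]
  gcongr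
  exact hM _ (hmem l hl)

namespace AdmissibleCurve

variable {α : ℝ → ℂ} {μ : ℝ} {s t : ℝ}

/-- The variable in which the integral of `dkern` becomes elementary. -/
noncomputable def zhukVar (α : ℝ → ℂ) (μ : ℝ) (t s : ℝ) : ℂ :=
  ((α t).re - μ : ℝ) - kern α μ t (α s)

theorem radical_sq_curve (h : AdmissibleCurve α μ) (hst : s ≤ t) :
    radical α μ t (α s) ^ 2 = (α s - α t) * (α s - conj (α t)) := by
  rcases hst.eq_or_lt with rfl | hst
  · rw [radical_self]; simp
  · exact h.radical_sq (h.notMem_cut_of_lt hst)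

theorem quad_eq (z w : ℂ) : (z - w) * (z - conj w) = (z - w.re) ^ 2 + (w.im : ℂ) ^ 2 := by
  have h1 : w = w.re + w.im * Complex.I := (Complex.re_add_im w).symm
  have h2 : conj w = w.re - w.im * Complex.I := by
    apply Complex.ext <;> simp
  rw [h2]
  nth_rewrite 1 [h1]
  ring_nf
  rw [Complex.I_sq]; ring

theorem zhukVar_eq (α : ℝ → ℂ) (μ t s : ℝ) :
    zhukVar α μ t s = -((α s - (α t).re) + radical α μ t (α s)) := by
  rw [zhukVar, kern]; push_cast; ring

theorem zhukVar_mul (h : AdmissibleCurve α μ) (hst : s ≤ t) :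
    zhukVar α μ t s * ((α s - (α t).re) - radical α μ t (α s)) = ((α t).im : ℂ) ^ 2 := by
  have h1 := h.radical_sq_curve hst
  rw [quad_eq] at h1
  rw [zhukVar_eq]
  linear_combination h1

theorem zhukVar_ne_zero (h : AdmissibleCurve α μ) (hst : s ≤ t) : zhukVar α μ t s ≠ 0 := fun h0 => by
  have h1 := h.zhukVar_mul hst
  rw [h0, zero_mul] at h1
  have h2 : ((α t).im : ℂ) ≠ 0 := Complex.ofReal_ne_zero.2 (h.im_pos t).ne'
  exact pow_ne_zero 2 h2 h1.symm

theorem curve_eq (h : AdmissibleCurve α μ) (hst : s ≤ t) :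
    α s = (α t).re + (((α t).im : ℂ) ^ 2 * (zhukVar α μ t s)⁻¹ - zhukVar α μ t s) / 2 := by
  have h0 := h.zhukVar_ne_zero hst
  have h1 := h.zhukVar_mul hst
  rw [← h1, mul_comm, inv_mul_cancel_left₀ h0, zhukVar_eq]; ring

/-- The imaginary part of `(b²/v - v)/2` has the sign opposite to that of `v.im`, and the curve lies
in the upper half-plane. So the principal logarithm of `v` is smooth along the curve and its
imaginary part varies by less than `π`. -/
theorem zhukVar_im_neg (h : AdmissibleCurve α μ) (hst : s ≤ t) : (zhukVar α μ t s).im < 0 := by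
  have h0 := h.zhukVar_ne_zero hst
  have h1 := congrArg Complex.im (h.curve_eq hst)
  have h2 := h.im_pos s
  set v := zhukVar α μ t s
  have hn : 0 < Complex.normSq v := Complex.normSq_pos.2 h0
  have h3 : (α s).im = -(1 / 2 * v.im * ((α t).im ^ 2 / Complex.normSq v + 1)) := by
    rw [h1, show (((α t).re : ℂ) + (((α t).im : ℂ) ^ 2 * v⁻¹ - v) / 2) =
      ((α t).re : ℂ) + (((α t).im ^ 2 : ℝ) * v⁻¹ - v) / 2 by push_cast; rfl]
    simp only [Complex.add_im, Complex.ofReal_im, zero_add, Complex.div_ofNat_im, Complex.sub_im,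
      Complex.im_ofReal_mul, Complex.inv_im]
    field_simp
    ring
  rw [h3] at h2
  by_contra hv
  have : 0 ≤ 1 / 2 * v.im * ((α t).im ^ 2 / Complex.normSq v + 1) := by
    have := not_lt.1 hv
    positivity
  linarith

theorem re_sub_le (α : ℝ → ℂ) (μ t : ℝ) : |(α t).re - μ| ≤ ‖α t - μ‖ := by
  have := Complex.abs_re_le_norm (α t - μ)
  simpa using this

theorem norm_zhukVar_le (α : ℝ → ℂ) (μ t s : ℝ) :
    ‖zhukVar α μ t s‖ ≤ ‖α t - μ‖ + ‖kern α μ t (α s)‖ := by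
  rw [zhukVar]
  refine (norm_sub_le _ _).trans (add_le_add ?_ le_rfl)
  rw [Complex.norm_real, Real.norm_eq_abs]
  exact re_sub_le α μ t

/-- With `v = -(z - a + R)` one has `b²/v = z - a - R`, and both are small when `α s` and `α t` are
near `μ`. This places `log v` in `logStrip`. -/
theorem zhukVar_add_le (h : AdmissibleCurve α μ) (hst : s ≤ t) {η : ℝ} (hs : ‖α s - μ‖ ≤ η)
    (ht : ‖α t - μ‖ ≤ η) :
    ‖zhukVar α μ t s‖ + (α t).im ^ 2 * ‖zhukVar α μ t s‖⁻¹ ≤ 8 * η := by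
  have hη : 0 ≤ η := (norm_nonneg _).trans hs
  have hR : ‖radical α μ t (α s)‖ ≤ 2 * η := by
    refine (abs_le_of_sq_le_sq' ?_ (by positivity)).2
    rw [h.norm_radical_sq hst, sq]
    have e1 : ‖α s - α t‖ ≤ 2 * η := by
      calc ‖α s - α t‖ = ‖(α s - μ) - (α t - μ)‖ := by rw [sub_sub_sub_cancel_right]
        _ ≤ _ := norm_sub_le _ _
        _ ≤ _ := by linarith
    have e2 : ‖α s - conj (α t)‖ ≤ 2 * η := by
      calc ‖α s - conj (α t)‖ = ‖(α s - μ) - (conj (α t) - μ)‖ := by rw [sub_sub_sub_cancel_right]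
        _ ≤ _ := norm_sub_le _ _
        _ ≤ _ := by rw [norm_conj_sub_ofReal]; linarith
    gcongr
  have hz : ‖α s - (α t).re‖ ≤ 2 * η := by
    calc ‖α s - (α t).re‖ = ‖(α s - μ) - ((α t).re - μ : ℝ)‖ := by
          push_cast; rw [sub_sub_sub_cancel_right]
      _ ≤ _ := norm_sub_le _ _
      _ ≤ _ := by
        rw [Complex.norm_real, Real.norm_eq_abs]
        linarith [re_sub_le α μ t]
  have h0 := norm_pos_iff.2 (h.zhukVar_ne_zero hst)
  have h1 : (α t).im ^ 2 * ‖zhukVar α μ t s‖⁻¹ = ‖(α s - (α t).re) - radical α μ t (α s)‖ := by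
    have h2 := congrArg norm (h.zhukVar_mul hst)
    rw [norm_mul, norm_pow, Complex.norm_real, Real.norm_eq_abs, sq_abs] at h2
    rw [← h2]; field_simp
  rw [h1, zhukVar_eq, norm_neg]
  have e1 := norm_add_le (α s - (α t).re) (radical α μ t (α s))
  have e2 := norm_sub_le (α s - (α t).re) (radical α μ t (α s))
  linarith

/-- Integrals of `dkern` times an analytic function along the curve are controlled by the boundary
values of `kern`. -/
theorem exists_dkern_integral_bound (h : AdmissibleCurve α μ) {q : ℂ → ℂ} {r M : ℝ} (hr : 0 < r)
    (hq : DifferentiableOn ℂ q (Metric.ball μ r)) (hM : ∀ z ∈ Metric.ball (μ : ℂ) r, ‖q z‖ ≤ M)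
    {s₀ : ℝ} (hs₀ : ∀ s ≥ s₀, ‖α s - μ‖ ≤ r / 8) {T : ℝ} (hT : s₀ ≤ T) (hTt : T ≤ t) :
    ‖∫ s in s₀..T, q (α s) * deriv α s * dkern α μ t (α s)‖ ≤
      M * (Real.pi + 1) * (2 * ‖α t - μ‖ + ‖kern α μ t (α s₀)‖ + ‖kern α μ t (α T)‖) := by
  have hM0 : 0 ≤ M := (norm_nonneg _).trans (hM μ (Metric.mem_ball_self hr))
  set a := (α t).re
  set b := (α t).im
  set v := zhukVar α μ t with hv
  have hat : |a - μ| ≤ r / 8 := (re_sub_le α μ t).trans (hs₀ t (hT.trans hTt))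
  -- The bound `8 · r/8 = r` of `zhukVar_add_le` is below `3r/2`, while `r/8 + 3r/4 < r` keeps the
  -- image in the disc of analyticity of `q`.
  obtain ⟨P, hP, hPb⟩ := exists_primitive_joukowski (b := b) hq hM hM0 (a := a) (d := 3 / 2 * r)
    (by linarith)
  have him : ∀ s ≤ t, (v s).im < 0 := fun s hs => h.zhukVar_im_neg hs
  have hslit : ∀ s ≤ t, v s ∈ Complex.slitPlane := fun s hs => Or.inr (him s hs).ne
  have hv0 : ∀ s ≤ t, v s ≠ 0 := fun s hs => h.zhukVar_ne_zero hs
  have hexp : ∀ s ≤ t, Real.exp (Complex.log (v s)).re = ‖v s‖ := fun s hs => by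
    rw [Complex.log_re, Real.exp_log (norm_pos_iff.2 (hv0 s hs))]
  have hstrip : ∀ s ∈ Icc s₀ T, Complex.log (v s) ∈ logStrip b (3 / 2 * r) := fun s hs => by
    have hst := hs.2.trans hTt
    have h1 := h.zhukVar_add_le hst (hs₀ s hs.1) (hs₀ t (hT.trans hTt))
    show Real.exp (Complex.log (v s)).re + b ^ 2 * Real.exp (-(Complex.log (v s)).re) < _
    rw [Real.exp_neg, hexp s hst]
    linarith
  have hj : ∀ s ≤ t, joukowski a b (Complex.log (v s)) = α s := fun s hs => by
    rw [joukowski, Complex.exp_neg, Complex.exp_log (hv0 s hs), h.curve_eq hs]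
  have hvc : ContinuousOn v (Icc s₀ T) := continuousOn_const.sub
    ((h.continuousOn_kern_curve t).mono fun s hs => hs.2.trans hTt)
  have hball : ∀ s ∈ Icc s₀ T, α s ∈ Metric.ball (μ : ℂ) r := fun s hs => by
    rw [Metric.mem_ball, dist_eq_norm]
    linarith [hs₀ s hs.1]
  have hd : Continuous (deriv α) := h.contDiff.continuous_deriv le_rfl
  -- Since `v` is a constant minus `kern`, one has `dkern dz = -dv`, and the integrand is the
  -- derivative of `-P(log v)`.
  have hint : ∫ s in s₀..T, q (α s) * deriv α s * dkern α μ t (α s) =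
      -P (Complex.log (v T)) - -P (Complex.log (v s₀)) := by
    refine intervalIntegral.integral_eq_sub_of_hasDerivAt_of_le
      (f := fun s => -P (Complex.log (v s))) hT ?_ (fun s hs => ?_) ?_
    · refine ContinuousOn.neg ?_
      refine ContinuousOn.comp (t := logStrip b (3 / 2 * r))
        (fun l hl => (hP l hl).continuousAt.continuousWithinAt)
        (hvc.clog fun s hs => hslit s (hs.2.trans hTt)) hstrip
    · have hsI := Ioo_subset_Icc_self hs
      have hst : s < t := hs.2.trans_le hTt
      have hv' : HasDerivAt v (-(dkern α μ t (α s) * deriv α s)) s :=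
        (h.hasDerivAt_kern_curve hst).const_sub _
      have h1 := ((hP _ (hstrip s hsI)).scomp s (hv'.clog_real (hslit s hst.le))).neg
      refine h1.congr_deriv ?_
      rw [hj s hst.le, Complex.exp_log (hv0 s hst.le)]
      have := hv0 s hst.le
      simp only [smul_eq_mul]
      field_simp
      try ring
    · refine IntervalIntegrable.continuousOn_mul
        ((h.intervalIntegrable_dkern_curve (hT.trans hTt)).mono_set ?_) ?_
      · rw [uIcc_of_le hT, uIcc_of_le (hT.trans hTt)]; exact Icc_subset_Icc le_rfl hTt
      · rw [uIcc_of_le hT]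
        exact (hq.continuousOn.comp h.continuous.continuousOn hball).mul hd.continuousOn
  have harg : |(Complex.log (v T)).im - (Complex.log (v s₀)).im| ≤ Real.pi := by
    rw [Complex.log_im, Complex.log_im]
    have h1 := Complex.arg_neg_iff.2 (him T hTt)
    have h2 := Complex.arg_neg_iff.2 (him s₀ (hT.trans hTt))
    have h3 := Complex.neg_pi_lt_arg (v T)
    have h4 := Complex.neg_pi_lt_arg (v s₀)
    rw [abs_le]; constructor <;> linarith
  have h5 := hPb _ (hstrip T (right_mem_Icc.2 hT)) _ (hstrip s₀ (left_mem_Icc.2 hT)) harg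
  rw [hint, neg_sub_neg]
  refine h5.trans ?_
  rw [hexp T hTt, hexp s₀ (hT.trans hTt)]
  have h6 : ‖v T‖ ≤ _ := norm_zhukVar_le α μ t T
  have h7 : ‖v s₀‖ ≤ _ := norm_zhukVar_le α μ t s₀
  have := Real.pi_pos
  refine mul_le_mul_of_nonneg_left ?_ (by positivity)
  linarith

end AdmissibleCurve

namespace AdmissibleCurve

variable {α : ℝ → ℂ} {μ : ℝ} {s t ξ T : ℝ} {z : ℂ}

/-! ### Boundary values and the kernel near the end point of the curve. -/

/-- Near the end point `μ` the boundary values of the radical are those of an analytic function. -/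
theorem exists_local_inv (h : AdmissibleCurve α μ) (ξ : ℝ) :
    ∃ r > 0, ∃ M, ∃ q : ℂ → ℂ, DifferentiableOn ℂ q (Metric.ball μ r) ∧
      (∀ z ∈ Metric.ball (μ : ℂ) r, ‖q z‖ ≤ M) ∧
      ∃ s₀ > ξ, ∀ s ≥ s₀, ‖α s - μ‖ ≤ r / 8 ∧ q (α s) = (edgeRadical α μ ξ s)⁻¹ := by
  set Q : ℂ → ℂ := fun z => (z - α ξ) * (z - conj (α ξ)) with hQ
  have hQ0 : Q μ ≠ 0 := by
    refine mul_ne_zero (sub_ne_zero.2 (h.ne_end ξ).symm) (sub_ne_zero.2 fun h0 => h.ne_end ξ ?_)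
    rw [← Complex.conj_conj (α ξ), ← h0, Complex.conj_ofReal]
  obtain ⟨c, hc⟩ := IsAlgClosed.exists_pow_nat_eq (Q μ) two_pos
  have hc0 : c ≠ 0 := by rintro rfl; simp at hc; exact hQ0 hc.symm
  have hQd : Differentiable ℂ fun z => Q z / Q μ := by fun_prop
  obtain ⟨r₁, hr₁, H₁⟩ := Metric.eventually_nhds_iff.1
    ((hQd.continuous.sub continuous_const).norm.continuousAt.eventually
      (gt_mem_nhds (show ‖Q μ / Q μ - 1‖ < 1 by simp [div_self hQ0])))
  set N : ℂ → ℂ := fun z => c * sqrtOne (Q z / Q μ) with hN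
  have hslit : ∀ z ∈ Metric.ball (μ : ℂ) r₁, Q z / Q μ ∈ Complex.slitPlane := fun z hz =>
    mem_slitPlane_of_norm_sub_one_lt (H₁ hz)
  have hNs : ∀ z ∈ Metric.ball (μ : ℂ) r₁, N z ^ 2 = Q z := fun z hz => by
    simp only [hN, mul_pow]
    rw [sqrtOne_sq (Complex.slitPlane_ne_zero (hslit z hz)), hc, mul_div_cancel₀ _ hQ0]
  have hN0 : ∀ z ∈ Metric.ball (μ : ℂ) r₁, N z ≠ 0 := fun z hz =>
    mul_ne_zero hc0 (Complex.exp_ne_zero _)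
  have hNd : DifferentiableOn ℂ N (Metric.ball μ r₁) := fun z hz =>
    ((DifferentiableAt.comp (f := fun z => Q z / Q μ) z (differentiableAt_sqrtOne (hslit z hz))
      (hQd z)).const_mul c).differentiableWithinAt
  have hinv : DifferentiableOn ℂ (fun z => (N z)⁻¹) (Metric.ball μ r₁) := hNd.inv hN0
  have hself := Metric.mem_ball_self (x := (μ : ℂ)) hr₁
  obtain ⟨r₂, hr₂, H₂⟩ := Metric.eventually_nhds_iff.1
    ((hinv.continuousOn.continuousAt (Metric.isOpen_ball.mem_nhds hself)).norm.eventually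
      (gt_mem_nhds (lt_add_one _)))
  set r := min r₁ r₂ with hr
  have hr0 : 0 < r := lt_min hr₁ hr₂
  obtain ⟨s₀, hs₀, Hs⟩ := h.eventually_norm_le (show 0 < r / 8 by positivity) (ξ + 1)
  have hball : ∀ s ∈ Ici s₀, α s ∈ Metric.ball (μ : ℂ) r₁ := fun s hs => by
    rw [Metric.mem_ball, dist_eq_norm]
    have := Hs s hs
    have := min_le_left r₁ r₂
    linarith
  have hedge : ∃ κ : ℂ, κ ^ 2 = 1 ∧ ∀ s ∈ Ici s₀, edgeRadical α μ ξ s = κ * N (α s) := by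
    have hsub : Ici s₀ ⊆ Ioi ξ := fun s hs => by
      have : s₀ ≤ s := hs
      simp only [mem_Ioi]; linarith
    rcases isPreconnected_Ici.eq_or_eq_neg_of_sq_eq ((h.continuousOn_edgeRadical ξ).mono hsub)
      (hNd.continuousOn.comp h.continuous.continuousOn hball)
      (fun s hs => by
        simp only [Pi.pow_apply, Function.comp]
        rw [hNs _ (hball s hs), h.edgeRadical_sq (hsub hs)])
      (fun hs => hN0 _ (hball _ hs)) with h1 | h1
    · exact ⟨1, by norm_num, fun s hs => by rw [one_mul]; exact h1 hs⟩
    · exact ⟨-1, by norm_num, fun s hs => by rw [h1 hs]; simp⟩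
  obtain ⟨κ, hκ, hedge⟩ := hedge
  have hκn : ‖κ⁻¹‖ = 1 := by
    rw [norm_inv]
    have : ‖κ‖ ^ 2 = 1 := by rw [← norm_pow, hκ, norm_one]
    rw [(pow_eq_one_iff_of_nonneg (norm_nonneg _) two_ne_zero).1 this, inv_one]
  refine ⟨r, hr0, ‖(N μ)⁻¹‖ + 1, fun z => κ⁻¹ * (N z)⁻¹,
    (hinv.mono (Metric.ball_subset_ball (min_le_left _ _))).const_mul _, fun z hz => ?_, s₀,
    by linarith, fun s hs => ⟨Hs s hs, ?_⟩⟩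
  · rw [norm_mul, hκn, one_mul]
    exact (H₂ (Metric.ball_subset_ball (min_le_right _ _) hz)).le
  · rw [hedge s hs, mul_inv]

/-- `kern` is close to one of the two values at the end of the arc. -/
theorem kern_near (h : AdmissibleCurve α μ) (hz : z ∉ cut α μ t) :
    ‖kern α μ t z‖ ≤ 4 * ‖α t - μ‖ ∨ ‖kern α μ t z - 2 * (z - μ)‖ ≤ 4 * ‖α t - μ‖ := by
  by_contra! hcon
  obtain ⟨h1, h2⟩ := hcon
  set r := ‖α t - μ‖ with hr
  have hr0 : 0 < r := norm_pos_iff.2 (sub_ne_zero.2 (h.ne_end t))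
  set d := ‖z - μ‖ with hd
  have hsq := h.radical_sq hz
  -- So `kern` solves a quadratic equation that degenerates to `x (x - 2 (z - μ)) = 0` as `α t → μ`.
  have h3 : kern α μ t z * (kern α μ t z - 2 * (z - μ)) =
      (α t - μ) * (conj (α t) - μ) - (z - μ) * ((α t - μ) + (conj (α t) - μ)) := by
    rw [kern]; linear_combination hsq
  have hconj : ‖conj (α t) - (μ : ℂ)‖ = r := norm_conj_sub_ofReal _ _
  have h4 : ‖kern α μ t z‖ * ‖kern α μ t z - 2 * (z - μ)‖ ≤ r * r + d * (r + r) := by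
    calc ‖kern α μ t z‖ * ‖kern α μ t z - 2 * (z - μ)‖
        = ‖(α t - μ) * (conj (α t) - μ) - (z - μ) * ((α t - μ) + (conj (α t) - μ))‖ := by
          rw [← norm_mul, h3]
      _ ≤ ‖α t - μ‖ * ‖conj (α t) - μ‖ + ‖z - μ‖ * (‖α t - μ‖ + ‖conj (α t) - μ‖) := by
        refine (norm_sub_le _ _).trans ?_
        rw [norm_mul, norm_mul]
        gcongr
        exact norm_add_le _ _
      _ = _ := by rw [hconj]
  have h5 : 2 * d ≤ ‖kern α μ t z‖ + ‖kern α μ t z - 2 * (z - μ)‖ := by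
    calc 2 * d = ‖kern α μ t z - (kern α μ t z - 2 * (z - μ))‖ := by
          rw [sub_sub_cancel, norm_mul, Complex.norm_ofNat]
      _ ≤ _ := norm_sub_le _ _
  set x := ‖kern α μ t z‖
  set y := ‖kern α μ t z - 2 * (z - μ)‖
  nlinarith [mul_pos (sub_pos.2 h1) (sub_pos.2 h2)]

/-- For each `t` the kernel at `α T` is close to `0` or to `2 (α T - μ)`. After a rotation `u`
making `α T - μ` positive, `|kern| ≤ Re (u kern) + 8 |α t - μ|` in both cases, so the integral
cannot be small by cancellation. -/
theorem integral_norm_kern_le (h : AdmissibleCurve α μ) (T : ℝ) :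
    ∫ t in Ioi T, ‖kern α μ t (α T)‖ ≤
      ‖∫ t in Ioi T, kern α μ t (α T)‖ + 8 * ∫ t in Ioi T, ‖α t - μ‖ := by
  have hI := h.integrableOn_kern T
  have hr := h.integrableOn_norm T
  have hz0 : (0 : ℝ) < ‖α T - μ‖ := norm_pos_iff.2 (sub_ne_zero.2 (h.ne_end T))
  set d := ‖α T - μ‖ with hd
  set u : ℂ := conj (α T - μ) / d with hu
  have hdC : (d : ℂ) ≠ 0 := Complex.ofReal_ne_zero.2 hz0.ne'
  have hun : ‖u‖ = 1 := by
    rw [hu, norm_div, Complex.norm_conj, Complex.norm_real, Real.norm_of_nonneg hz0.le, div_self hz0.ne']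
  have huz : u * (α T - μ) = d := by
    rw [hu, div_mul_eq_mul_div, mul_comm, Complex.mul_conj, Complex.normSq_eq_norm_sq, ← hd]
    push_cast; field_simp
  have hpt : ∀ t ∈ Ioi T, ‖kern α μ t (α T)‖ ≤ (u * kern α μ t (α T)).re + 8 * ‖α t - μ‖ := fun t ht => by
    rcases h.kern_near (h.notMem_cut_of_lt (s := T) ht) with h1 | h1
    · have h2 := (abs_le.1 (Complex.abs_re_le_norm (u * kern α μ t (α T)))).1
      rw [norm_mul, hun, one_mul] at h2
      linarith
    · have h2 := (abs_le.1 (Complex.abs_re_le_norm (u * (kern α μ t (α T) - 2 * (α T - μ))))).1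
      rw [norm_mul, hun, one_mul, show u * (kern α μ t (α T) - 2 * (α T - μ)) =
        u * kern α μ t (α T) - ((2 * d : ℝ) : ℂ) by
        push_cast; linear_combination -2 * huz, Complex.sub_re, Complex.ofReal_re] at h2
      have h3 : ‖kern α μ t (α T)‖ ≤ ‖kern α μ t (α T) - 2 * (α T - μ)‖ + 2 * d := by
        have := norm_sub_norm_le (kern α μ t (α T)) (2 * (α T - μ))
        rw [norm_mul, Complex.norm_ofNat, ← hd] at this
        linarith
      linarith
  have hre : IntegrableOn (fun t => (u * kern α μ t (α T)).re) (Ioi T) := (hI.const_mul u).re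
  calc ∫ t in Ioi T, ‖kern α μ t (α T)‖
      ≤ ∫ t in Ioi T, ((u * kern α μ t (α T)).re + 8 * ‖α t - μ‖) :=
        setIntegral_mono_on hI.norm (hre.add (hr.const_mul 8)) measurableSet_Ioi hpt
    _ = (u * ∫ t in Ioi T, kern α μ t (α T)).re + 8 * ∫ t in Ioi T, ‖α t - μ‖ := by
        have h1 : ∫ t in Ioi T, (u * kern α μ t (α T)).re =
            (∫ t in Ioi T, u * kern α μ t (α T)).re := integral_re (hI.const_mul u)
        rw [integral_add hre (hr.const_mul 8), h1, integral_const_mul, integral_const_mul]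
    _ ≤ _ := by
        gcongr
        refine (Complex.re_le_norm _).trans ?_
        rw [norm_mul, hun, one_mul]

/-- After a last entrance the remaining arc stays in the disc through `α T`, so beyond `α T` the
outward ray avoids the cut. Far out on the ray the kernel is near `0`, and it cannot pass
continuously to the other alternative of `kern_near` while the two are well separated. -/
theorem kern_le_of_lastEntrance (h : AdmissibleCurve α μ) (hT : ∀ s ≥ T, ‖α s - μ‖ ≤ ‖α T - μ‖)
    (ht : T < t) : ‖kern α μ t (α T)‖ ≤ 12 * ‖α t - μ‖ := by
  have hd : 0 < ‖α T - μ‖ := norm_pos_iff.2 (sub_ne_zero.2 (h.ne_end T))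
  have hcut := h.notMem_cut_of_lt ht
  rcases h.kern_near hcut with h1 | h1
  · linarith [norm_nonneg (α t - μ)]
  rcases le_or_gt (2 * ‖α T - μ‖) (8 * ‖α t - μ‖) with h2 | h2
  · have h3 := norm_sub_norm_le (kern α μ t (α T)) (2 * (α T - μ))
    rw [norm_mul, Complex.norm_ofNat] at h3
    linarith
  -- continue along the ray from `μ` through `α T`
  exfalso
  set w : ℝ → ℂ := fun l => μ + l * (α T - μ) with hw
  have hwn : ∀ l, w l - μ = l * (α T - μ) := fun l => by simp [hw]
  have hwN : ∀ l ≥ 1, ‖w l - μ‖ = l * ‖α T - μ‖ := fun l hl => by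
    rw [hwn, norm_mul, Complex.norm_real, Real.norm_of_nonneg (by linarith)]
  have hwcut : ∀ l ∈ Icc (1 : ℝ) 4, w l ∉ cut α μ t := fun l hl => by
    rcases hl.1.eq_or_lt with rfl | hl1
    · have : w 1 = α T := by simp [hw]
      rwa [this]
    · have hbig : ‖α T - μ‖ < ‖w l - μ‖ := by
        rw [hwN l hl.1]; nlinarith
      refine notMem_cut (fun h0 => ?_) fun s hs => ⟨fun h0 => ?_, fun h0 => ?_⟩
      · rw [h0, sub_self, norm_zero] at hbig; linarith
      · rw [h0] at hbig; linarith [hT s (ht.le.trans hs)]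
      · rw [h0, norm_conj_sub_ofReal] at hbig; linarith [hT s (ht.le.trans hs)]
  have hwc : Continuous w := by fun_prop
  have hkc : ContinuousOn (fun l => kern α μ t (w l)) (Icc 1 4) := fun l hl =>
    (ContinuousAt.comp (f := w) (h.hasDerivAt_kern (hwcut l hl)).continuousAt
      hwc.continuousAt).continuousWithinAt
  have hfar : ‖kern α μ t (w 4)‖ ≤ 3 * ‖α t - μ‖ := by
    refine (h.far_bounds (fun h0 => ?_) fun s hs => ?_).1
    · have := hwN 4 (by norm_num)
      rw [h0, sub_self, norm_zero] at this; linarith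
    · rw [hwN 4 (by norm_num)]
      linarith [hT s (ht.le.trans hs)]
  -- `A` compares the distances to the two alternatives. At a zero of `A` both are at least `‖α T -
  -- μ‖ > 4 ‖α t - μ‖`, contradicting `kern_near`. The right end `l = 4` is where the hypothesis of
  -- `far_bounds` becomes available.
  set A : ℝ → ℝ := fun l => ‖kern α μ t (w l)‖ - ‖kern α μ t (w l) - 2 * (w l - μ)‖ with hA
  have hAc : ContinuousOn A (Icc 1 4) := by
    refine hkc.norm.sub (hkc.sub ?_).norm
    fun_prop
  have hsum : ∀ l ≥ 1, 2 * ‖α T - μ‖ ≤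
      ‖kern α μ t (w l)‖ + ‖kern α μ t (w l) - 2 * (w l - μ)‖ := fun l hl => by
    calc 2 * ‖α T - μ‖ ≤ 2 * ‖w l - μ‖ := by rw [hwN l hl]; nlinarith
      _ = ‖kern α μ t (w l) - (kern α μ t (w l) - 2 * (w l - μ))‖ := by
          rw [sub_sub_cancel, norm_mul, Complex.norm_ofNat]
      _ ≤ _ := norm_sub_le _ _
  have hw1 : w 1 = α T := by simp [hw]
  have hA1 : 0 ≤ A 1 := by
    have := hsum 1 le_rfl
    simp only [hA, hw1] at this ⊢
    linarith
  have hA4 : A 4 ≤ 0 := by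
    have := hsum 4 (by norm_num)
    simp only [hA]
    linarith [norm_nonneg (α t - μ)]
  obtain ⟨l, hl, hl0⟩ := intermediate_value_Icc' (by norm_num : (1 : ℝ) ≤ 4) hAc ⟨hA4, hA1⟩
  have h6 := hsum l hl.1
  simp only [hA] at hl0
  rcases h.kern_near (hwcut l hl) with h7 | h7 <;> linarith

end AdmissibleCurve

/-! ### The truncated transform and its limit. -/

/-- The density of `dζ / √((ζ - α ξ)(ζ - conj (α ξ)))₊` in the parameter of the curve. -/
noncomputable def edgeWeight (α : ℝ → ℂ) (μ ξ s : ℝ) : ℂ := (edgeRadical α μ ξ s)⁻¹ * deriv α s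

namespace AdmissibleCurve

variable {α : ℝ → ℂ} {μ : ℝ} {s t ξ T : ℝ} {z : ℂ}

theorem continuous_deriv (h : AdmissibleCurve α μ) : Continuous (deriv α) :=
  h.contDiff.continuous_deriv le_rfl

theorem intervalIntegrable_edgeWeight (h : AdmissibleCurve α μ) (hT : ξ ≤ T) :
    IntervalIntegrable (edgeWeight α μ ξ) volume ξ T :=
  (h.intervalIntegrable_inv_edgeRadical hT).mul_continuousOn h.continuous_deriv.continuousOn

theorem continuousOn_edgeWeight (h : AdmissibleCurve α μ) (ξ : ℝ) :
    ContinuousOn (edgeWeight α μ ξ) (Ioi ξ) :=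
  ((h.continuousOn_edgeRadical ξ).inv₀ fun _ hs => h.edgeRadical_ne_zero hs).mul
    h.continuous_deriv.continuousOn

theorem continuousOn_dkern_curve (h : AdmissibleCurve α μ) (t : ℝ) :
    ContinuousOn (fun s => dkern α μ t (α s)) (Iio t) := fun s hs => by
  have h1 : ContinuousAt (fun r : ℝ => (t, r)) s := by fun_prop
  exact (ContinuousAt.comp (f := fun r : ℝ => (t, r)) (h.continuousAt_dkern hs) h1).continuousWithinAt

theorem intervalIntegrable_edgeWeight_mul_dkern (h : AdmissibleCurve α μ) (hT : ξ ≤ T)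
    (hTt : T ≤ t) :
    IntervalIntegrable (fun s => edgeWeight α μ ξ s * dkern α μ t (α s)) volume ξ T := by
  rcases (hT.trans hTt).eq_or_lt with rfl | hlt
  · rw [le_antisymm hTt hT]
  have hm1 : ξ < (ξ + t) / 2 := by linarith
  have hm2 : (ξ + t) / 2 < t := by linarith
  set m := (ξ + t) / 2
  have h1 : IntervalIntegrable (fun s => edgeWeight α μ ξ s * dkern α μ t (α s)) volume ξ m := by
    refine (h.intervalIntegrable_edgeWeight hm1.le).mul_continuousOn
      ((h.continuousOn_dkern_curve t).mono ?_)
    rw [uIcc_of_le hm1.le]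
    exact fun s hs => hs.2.trans_lt hm2
  have h2 : IntervalIntegrable (fun s => edgeWeight α μ ξ s * dkern α μ t (α s)) volume m t := by
    refine (h.intervalIntegrable_dkern_curve hm2.le).continuousOn_mul
      ((h.continuousOn_edgeWeight ξ).mono ?_)
    rw [uIcc_of_le hm2.le]
    exact fun s hs => hm1.trans_le hs.1
  refine (h1.trans h2).mono_set ?_
  rw [uIcc_of_le hT, uIcc_of_le hlt.le]
  exact Icc_subset_Icc le_rfl hTt

/-- The summand `1` of `dkern` gives the integral of the weight, and the other summand gives the
interaction identity with `c = Re (α t)`. -/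
theorem im_integral_edgeWeight_mul_dkern (h : AdmissibleCurve α μ) (hξ : ξ < t) :
    (∫ s in ξ..t, edgeWeight α μ ξ s * dkern α μ t (α s)).im =
      (∫ s in ξ..t, edgeWeight α μ ξ s).im + Real.pi / 2 := by
  obtain ⟨h1, h2⟩ := h.im_interaction hξ (α t).re
  rw [← h2, ← Complex.add_im, ← intervalIntegral.integral_add (h.intervalIntegrable_edgeWeight hξ.le) h1]
  congr 1
  refine intervalIntegral.integral_congr fun s _ => ?_
  simp only [edgeWeight, dkern, div_eq_mul_inv, mul_inv]
  ring

/-- Beyond some `s₀` the weight is `q(α s) α'(s)` with `q` analytic near `μ`. A primitive of `q`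
gives convergence with Lipschitz error, and the Joukowski estimate handles `dkern`. On the fixed
piece up to `s₀` the far bounds suffice. -/
theorem exists_integral_edgeWeight_bound (h : AdmissibleCurve α μ) (ξ : ℝ) :
    ∃ D : ℂ, ∃ s₁ > ξ, ∃ C ≥ 0,
      (∀ T ≥ s₁, ‖(∫ s in ξ..T, edgeWeight α μ ξ s) - D‖ ≤ C * ‖α T - μ‖) ∧
      ∀ T t, s₁ ≤ T → T ≤ t → ‖∫ s in ξ..T, edgeWeight α μ ξ s * dkern α μ t (α s)‖ ≤
        C * (‖α t - μ‖ + ‖kern α μ t (α T)‖) := by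
  obtain ⟨r, hr, M, q, hqd, hqM, s₀, hs₀, hq⟩ := h.exists_local_inv ξ
  have hM0 : 0 ≤ M := (norm_nonneg _).trans (hqM μ (Metric.mem_ball_self hr))
  obtain ⟨s₁, hs₁, C₁, hC₁, H⟩ := h.exists_dkern_bound hs₀.le
  have hball : ∀ s ≥ s₀, α s ∈ Metric.ball (μ : ℂ) r := fun s hs => by
    rw [Metric.mem_ball, dist_eq_norm]
    linarith [(hq s hs).1]
  have hψ : ∀ s ≥ s₀, edgeWeight α μ ξ s = q (α s) * deriv α s := fun s hs => by
    rw [edgeWeight, (hq s hs).2]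
  obtain ⟨P, hP⟩ := hqd.isExactOn_ball
  have hD : ∀ T ≥ s₀, ∫ s in s₀..T, edgeWeight α μ ξ s = P (α T) - P (α s₀) := fun T hT => by
    refine intervalIntegral.integral_eq_sub_of_hasDerivAt (f := fun s => P (α s)) (fun s hs => ?_) ?_
    · rw [uIcc_of_le hT] at hs
      rw [hψ s hs.1]
      exact (hP _ (hball s hs.1)).comp_of_eq s
        (h.contDiff.differentiable (by norm_num) s).hasDerivAt rfl
    · refine ((h.continuousOn_edgeWeight ξ).mono ?_).intervalIntegrable
      rw [uIcc_of_le hT]; exact fun s hs => hs₀.trans_le hs.1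
  have hint : ∀ T ≥ s₀, IntervalIntegrable (edgeWeight α μ ξ) volume s₀ T := fun T hT => by
    refine ((h.continuousOn_edgeWeight ξ).mono ?_).intervalIntegrable
    rw [uIcc_of_le hT]; exact fun s hs => hs₀.trans_le hs.1
  set B := ∫ s in ξ..s₀, ‖edgeWeight α μ ξ s‖
  have hB0 : 0 ≤ B := intervalIntegral.integral_nonneg hs₀.le fun _ _ => norm_nonneg _
  have hπ := Real.pi_pos
  refine ⟨(∫ s in ξ..s₀, edgeWeight α μ ξ s) + (P μ - P (α s₀)), s₁, hs₀.trans hs₁,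
    M + B * C₁ + 5 * (M * (Real.pi + 1)), by positivity, fun T hT => ?_, fun T t hT hTt => ?_⟩
  · have hT0 : s₀ ≤ T := hs₁.le.trans hT
    rw [← intervalIntegral.integral_add_adjacent_intervals (h.intervalIntegrable_edgeWeight hs₀.le)
      (hint T hT0), hD T hT0, show ∀ a b c d : ℂ, a + (b - c) - (a + (d - c)) = b - d by
      intros; ring]
    refine (Convex.norm_image_sub_le_of_norm_hasDerivWithin_le
      (fun z hz => (hP z hz).hasDerivWithinAt) hqM (convex_ball _ _) (Metric.mem_ball_self hr)
      (hball T hT0)).trans ?_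
    refine mul_le_mul_of_nonneg_right ?_ (norm_nonneg _)
    have : 0 ≤ B * C₁ + 5 * (M * (Real.pi + 1)) := by positivity
    linarith
  · have hT0 : s₀ ≤ T := hs₁.le.trans hT
    have hi := h.intervalIntegrable_edgeWeight_mul_dkern (hs₀.le.trans hT0) hTt
    have hi1 := hi.mono_set (c := ξ) (d := s₀) (by
      rw [uIcc_of_le hs₀.le, uIcc_of_le (hs₀.le.trans hT0)]; exact Icc_subset_Icc le_rfl hT0)
    have hi2 := hi.mono_set (c := s₀) (d := T) (by
      rw [uIcc_of_le hT0, uIcc_of_le (hs₀.le.trans hT0)]; exact Icc_subset_Icc hs₀.le le_rfl)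
    rw [← intervalIntegral.integral_add_adjacent_intervals hi1 hi2]
    have hk := (H s₀ ⟨hs₀.le, le_rfl⟩).2.2 t (hT.trans hTt)
    have e1 : ‖∫ s in ξ..s₀, edgeWeight α μ ξ s * dkern α μ t (α s)‖ ≤ B * (C₁ * ‖α t - μ‖) := by
      rw [← intervalIntegral.integral_mul_const]
      refine intervalIntegral.norm_integral_le_of_norm_le hs₀.le (ae_of_all _ fun s hs => ?_)
        ((h.intervalIntegrable_edgeWeight hs₀.le).norm.mul_const _)
      rw [norm_mul]
      exact mul_le_mul_of_nonneg_left ((H s (Ioc_subset_Icc_self hs)).2.1 t (hT.trans hTt))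
        (norm_nonneg _)
    have e2 : ‖∫ s in s₀..T, edgeWeight α μ ξ s * dkern α μ t (α s)‖ ≤
        M * (Real.pi + 1) * (2 * ‖α t - μ‖ + ‖kern α μ t (α s₀)‖ + ‖kern α μ t (α T)‖) := by
      rw [intervalIntegral.integral_congr (g := fun s => q (α s) * deriv α s * dkern α μ t (α s))
        fun s hs => by
          rw [uIcc_of_le hT0] at hs
          simp only [hψ s hs.1]]
      exact h.exists_dkern_integral_bound hr hqd hqM (fun s hs => (hq s hs).1) hT0 hTt
    have hM1 : 0 ≤ M * (Real.pi + 1) := by positivity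
    have e3 := mul_le_mul_of_nonneg_left hk hM1
    have n1 := norm_nonneg (α t - μ)
    have n2 := norm_nonneg (kern α μ t (α T))
    have e4 := mul_nonneg hM1 n2
    have e5 := mul_nonneg hM0 (add_nonneg n1 n2)
    have e6 := mul_nonneg (mul_nonneg hB0 hC₁) n2
    refine (norm_add_le _ _).trans ((add_le_add e1 e2).trans ?_)
    generalize M * (Real.pi + 1) = K at *
    nlinarith

/-- For `T = t` the second bound is `O(|α t - μ|)`, because `kern` at its own end point is `α t -
μ`. By the interaction identity this small integral has imaginary part `Im ∫ w + π/2`, and `t → ∞`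
fixes the imaginary part of the limit. -/
theorem exists_edgeWeight_bound (h : AdmissibleCurve α μ) (ξ : ℝ) :
    ∃ D : ℂ, D.im = -(Real.pi / 2) ∧ ∃ s₁ > ξ, ∃ C ≥ 0,
      (∀ T ≥ s₁, ‖(∫ s in ξ..T, edgeWeight α μ ξ s) - D‖ ≤ C * ‖α T - μ‖) ∧
      ∀ T t, s₁ ≤ T → T ≤ t → ‖∫ s in ξ..T, edgeWeight α μ ξ s * dkern α μ t (α s)‖ ≤
        C * (‖α t - μ‖ + ‖kern α μ t (α T)‖) := by
  obtain ⟨D, s₁, hs₁, C, hC, h1, h2⟩ := h.exists_integral_edgeWeight_bound ξ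
  refine ⟨D, ?_, s₁, hs₁, C, hC, h1, h2⟩
  have h3 : Tendsto (fun t => 3 * C * ‖α t - μ‖) atTop (𝓝 0) := by
    have := (h.tendsto.sub_const (μ : ℂ)).norm.const_mul (3 * C)
    simpa using this
  have h4 : ∀ᶠ t in atTop, |D.im + Real.pi / 2| ≤ 3 * C * ‖α t - μ‖ := by
    filter_upwards [eventually_ge_atTop s₁] with t ht
    have e1 := h1 t ht
    have e2 := h2 t t ht le_rfl
    rw [kern_self] at e2
    have e3 := h.im_integral_edgeWeight_mul_dkern (hs₁.trans_le ht)
    have e4 := (Complex.abs_im_le_norm _).trans e1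
    have e5 := (Complex.abs_im_le_norm _).trans e2
    rw [Complex.sub_im] at e4
    rw [e3] at e5
    rw [abs_le] at *
    constructor <;> linarith [e4.1, e4.2, e5.1, e5.2]
  have h5 := ge_of_tendsto h3 h4
  have := abs_nonpos_iff.1 h5
  linarith

end AdmissibleCurve

/-- The integral of `dkern` along the arc from `α ξ` to `α T`, with the weight `edgeWeight`. -/
noncomputable def weightedKern (α : ℝ → ℂ) (μ ξ t T : ℝ) : ℂ :=
  ∫ s in ξ..T, edgeWeight α μ ξ s * dkern α μ t (α s)

/-- The density left over from the truncated transform after summation by parts. -/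
noncomputable def residualDensity (α : ℝ → ℂ) (μ ξ : ℝ) (D : ℂ) (t : ℝ) : ℂ :=
  weightedKern α μ ξ t t - ((∫ s in ξ..t, edgeWeight α μ ξ s) - D)

namespace AdmissibleCurve

variable {α : ℝ → ℂ} {μ : ℝ} {s t ξ T : ℝ} {z : ℂ}

theorem integral_mul_edgeWeight (h : AdmissibleCurve α μ) (hT : ξ ≤ T) :
    ∫ s in ξ..T, (s : ℂ) * edgeWeight α μ ξ s =
      T * (∫ s in ξ..T, edgeWeight α μ ξ s) - ∫ t in ξ..T, ∫ s in ξ..t, edgeWeight α μ ξ s := by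
  have hw := h.intervalIntegrable_edgeWeight hT
  have hcD : ContinuousOn (fun t => ∫ s in ξ..t, edgeWeight α μ ξ s) (uIcc ξ T) :=
    intervalIntegral.continuousOn_primitive_interval' hw left_mem_uIcc
  have hDi : IntervalIntegrable (fun t => ∫ s in ξ..t, edgeWeight α μ ξ s) volume ξ T :=
    hcD.intervalIntegrable
  have hsw : IntervalIntegrable (fun s : ℝ => (s : ℂ) * edgeWeight α μ ξ s) volume ξ T :=
    hw.continuousOn_mul (by fun_prop)
  have key := intervalIntegral.integral_eq_sub_of_hasDerivAt_of_le hT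
    (f := fun t : ℝ => (t : ℂ) * ∫ s in ξ..t, edgeWeight α μ ξ s)
    (f' := fun t : ℝ => (∫ s in ξ..t, edgeWeight α μ ξ s) + t * edgeWeight α μ ξ t)
    (by rw [uIcc_of_le hT] at hcD; exact Complex.continuous_ofReal.continuousOn.mul hcD)
    (fun t ht => by
      have hN : Ioi ξ ∈ 𝓝 t := Ioi_mem_nhds ht.1
      have h1 := intervalIntegral.integral_hasDerivAt_right
        (h.intervalIntegrable_edgeWeight ht.1.le)
        ((h.continuousOn_edgeWeight ξ).stronglyMeasurableAtFilter isOpen_Ioi _ ht.1)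
        ((h.continuousOn_edgeWeight ξ).continuousAt hN)
      have h2 : HasDerivAt (fun t : ℝ => (t : ℂ) * ∫ s in ξ..t, edgeWeight α μ ξ s)
          (1 * (∫ s in ξ..t, edgeWeight α μ ξ s) + t * edgeWeight α μ ξ t) t :=
        HasDerivAt.mul (Complex.ofRealCLM.hasDerivAt (x := t)) h1
      rwa [one_mul] at h2)
    (hDi.add hsw)
  rw [intervalIntegral.integral_add hDi hsw] at key
  simp only [intervalIntegral.integral_same, mul_zero, sub_zero] at key
  rw [← key]; ring

theorem intervalIntegrable_residualDensity (h : AdmissibleCurve α μ) (D : ℂ) (hT : ξ ≤ T) :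
    IntervalIntegrable (residualDensity α μ ξ D) volume ξ T := by
  have hw := h.intervalIntegrable_edgeWeight hT
  have hcD : ContinuousOn (fun t => ∫ s in ξ..t, edgeWeight α μ ξ s) (uIcc ξ T) :=
    intervalIntegral.continuousOn_primitive_interval' hw left_mem_uIcc
  refine IntervalIntegrable.sub ?_ (hcD.intervalIntegrable.sub intervalIntegrable_const)
  have h1 := (h.integral_mul_dkernIntegral hT hw).1
  rw [intervalIntegrable_iff_integrableOn_Ioc_of_le hT]
  refine (h1.mono_set Ioc_subset_Ioi_self).congr_fun (fun t ht => ?_) measurableSet_Ioc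
  simp only [weightedKern, min_eq_left ht.2]

/-- The truncated transform of the derivative of the potential. -/
theorem integral_upperIntegrand (h : AdmissibleCurve α μ) (c : ℝ) (D : ℂ) (hT : ξ ≤ T) :
    ∫ s in ξ..T, upperIntegrand α μ (f0' α μ c) ξ s =
      T * ((∫ s in ξ..T, edgeWeight α μ ξ s) - D) + ξ * D +
        (∫ t in ξ..T, residualDensity α μ ξ D t) + ∫ t in Ioi T, weightedKern α μ ξ t T := by
  have hw := h.intervalIntegrable_edgeWeight hT
  have hcD : ContinuousOn (fun t => ∫ s in ξ..t, edgeWeight α μ ξ s) (uIcc ξ T) :=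
    intervalIntegral.continuousOn_primitive_interval' hw left_mem_uIcc
  obtain ⟨hF1, hF2⟩ := h.integral_mul_dkernIntegral hT hw
  have hsw : IntervalIntegrable (fun s : ℝ => (s : ℂ) * edgeWeight α μ ξ s) volume ξ T :=
    hw.continuousOn_mul (by fun_prop)
  have hφw : IntervalIntegrable (fun s => edgeWeight α μ ξ s * dkernIntegral α μ s) volume ξ T :=
    hw.mul_continuousOn h.continuous_dkernIntegral.continuousOn
  have h1 : ∫ s in ξ..T, upperIntegrand α μ (f0' α μ c) ξ s =
      (∫ s in ξ..T, edgeWeight α μ ξ s * dkernIntegral α μ s) +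
        ∫ s in ξ..T, (s : ℂ) * edgeWeight α μ ξ s := by
    rw [← intervalIntegral.integral_add hφw hsw]
    refine intervalIntegral.integral_congr fun s _ => ?_
    simp only [h.upperIntegrand_eq, edgeWeight, div_eq_mul_inv]
    ring
  have hV : IntervalIntegrable (fun t => weightedKern α μ ξ t t) volume ξ T := by
    rw [intervalIntegrable_iff_integrableOn_Ioc_of_le hT]
    refine (hF1.mono_set Ioc_subset_Ioi_self).congr_fun (fun t ht => ?_) measurableSet_Ioc
    simp only [weightedKern, min_eq_left ht.2]
  -- After Fubini the parameters `t ≤ T` see the arc only up to `α t`, while those beyond `T` see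
  -- all of it up to `α T`.
  have h2 : ∫ s in ξ..T, edgeWeight α μ ξ s * dkernIntegral α μ s =
      (∫ t in ξ..T, weightedKern α μ ξ t t) + ∫ t in Ioi T, weightedKern α μ ξ t T := by
    rw [hF2, ← Ioc_union_Ioi_eq_Ioi hT, setIntegral_union (Ioc_disjoint_Ioi le_rfl) measurableSet_Ioi
      (hF1.mono_set Ioc_subset_Ioi_self) (hF1.mono_set (Ioi_subset_Ioi hT)),
      intervalIntegral.integral_of_le hT]
    congr 1
    · refine setIntegral_congr_fun measurableSet_Ioc fun t ht => ?_
      simp only [weightedKern, min_eq_left ht.2]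
    · refine setIntegral_congr_fun measurableSet_Ioi fun t ht => ?_
      simp only [weightedKern, min_eq_right (le_of_lt (mem_Ioi.1 ht))]
  have h3 : ∫ t in ξ..T, residualDensity α μ ξ D t = (∫ t in ξ..T, weightedKern α μ ξ t t) -
      ((∫ t in ξ..T, ∫ s in ξ..t, edgeWeight α μ ξ s) - (T - ξ : ℝ) * D) := by
    unfold residualDensity
    rw [intervalIntegral.integral_sub hV (hcD.intervalIntegrable.sub intervalIntegrable_const),
      intervalIntegral.integral_sub hcD.intervalIntegrable intervalIntegrable_const,
      intervalIntegral.integral_const, Complex.real_smul]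
  rw [h1, h2, h.integral_mul_edgeWeight hT, h3]
  push_cast
  ring

/-- `residualDensity` is real, by the interaction identity and the value of `Im D`, and integrable,
being `O(|α t - μ|)`. Hence `K` has the imaginary part of `ξ D`, and its real part need not be
known. The tail is kept as a hypothesis on the filter, since the two ways of truncating differ only
there. -/
theorem exists_limit_upperIntegrand (h : AdmissibleCurve α μ) (c ξ : ℝ) :
    ∃ K : ℂ, K.im = -(ξ * (Real.pi / 2)) ∧ ∃ s₁, ∃ C ≥ 0,
      (∀ T ≥ s₁, ‖∫ t in Ioi T, weightedKern α μ ξ t T‖ ≤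
        C * ((∫ t in Ioi T, ‖α t - μ‖) + ∫ t in Ioi T, ‖kern α μ t (α T)‖)) ∧
      ∀ l ≤ atTop, Tendsto (fun T => ∫ t in Ioi T, weightedKern α μ ξ t T) l (𝓝 0) →
        Tendsto (fun T => ∫ s in ξ..T, upperIntegrand α μ (f0' α μ c) ξ s) l (𝓝 K) := by
  obtain ⟨D, hDim, s₁, hs₁, C, hC, H1, H2⟩ := h.exists_edgeWeight_bound ξ
  have hGi : ∀ T ≥ ξ, IntervalIntegrable (residualDensity α μ ξ D) volume ξ T := fun T hT =>
    h.intervalIntegrable_residualDensity D hT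
  have hGim : ∀ t ∈ Ioi ξ, (residualDensity α μ ξ D t).im = 0 := fun t ht => by
    have := h.im_integral_edgeWeight_mul_dkern (mem_Ioi.1 ht)
    rw [residualDensity, weightedKern, Complex.sub_im, Complex.sub_im, this, hDim]
    ring
  have hGb : ∀ t ≥ s₁, ‖residualDensity α μ ξ D t‖ ≤ 3 * C * ‖α t - μ‖ := fun t ht => by
    have e1 := H1 t ht
    have e2 := H2 t t ht le_rfl
    rw [kern_self] at e2
    refine (norm_sub_le _ _).trans ?_
    rw [weightedKern]
    linarith
  have hG : IntegrableOn (residualDensity α μ ξ D) (Ioi ξ) := by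
    have hIoi : IntegrableOn (residualDensity α μ ξ D) (Ioi s₁) := by
      refine integrableOn_Ioi_of_intervalIntegral_norm_bounded (l := atTop)
        (b := fun n : ℝ => max n s₁) (3 * C * ∫ t in Ioi s₁, ‖α t - μ‖) s₁ (fun n => ?_)
        (tendsto_atTop_mono (fun n => le_max_left n s₁) tendsto_id) ?_
      · have := hGi (max n s₁) (hs₁.le.trans (le_max_right _ _))
        rw [intervalIntegrable_iff_integrableOn_Ioc_of_le (hs₁.le.trans (le_max_right _ _))] at this
        exact this.mono_set (Ioc_subset_Ioc_left hs₁.le)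
      · refine Eventually.of_forall fun n => ?_
        rw [intervalIntegral.integral_of_le (le_max_right _ _), ← integral_const_mul]
        have hb : IntegrableOn (fun t => 3 * C * ‖α t - μ‖) (Ioi s₁) :=
          (h.integrableOn_norm s₁).const_mul (3 * C)
        have hf := hGi (max n s₁) (hs₁.le.trans (le_max_right _ _))
        rw [intervalIntegrable_iff_integrableOn_Ioc_of_le (hs₁.le.trans (le_max_right _ _))] at hf
        calc ∫ t in Ioc s₁ (max n s₁), ‖residualDensity α μ ξ D t‖
            ≤ ∫ t in Ioc s₁ (max n s₁), 3 * C * ‖α t - μ‖ :=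
              setIntegral_mono_on (hf.mono_set (Ioc_subset_Ioc_left hs₁.le)).norm
                (hb.mono_set Ioc_subset_Ioi_self) measurableSet_Ioc fun t ht => hGb t ht.1.le
          _ ≤ ∫ t in Ioi s₁, 3 * C * ‖α t - μ‖ :=
              setIntegral_mono_set hb (ae_of_all _ fun t => by positivity)
                Ioc_subset_Ioi_self.eventuallyLE
    rw [← Ioc_union_Ioi_eq_Ioi hs₁.le]
    exact ((intervalIntegrable_iff_integrableOn_Ioc_of_le hs₁.le).1 (hGi s₁ hs₁.le)).union hIoi
  have hGim' : (∫ t in Ioi ξ, residualDensity α μ ξ D t).im = 0 := by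
    have h1 : (∫ t in Ioi ξ, residualDensity α μ ξ D t).im =
        ∫ t in Ioi ξ, (residualDensity α μ ξ D t).im := (integral_im hG).symm
    rw [h1, setIntegral_congr_fun measurableSet_Ioi hGim, integral_zero]
  refine ⟨0 + ξ * D + (∫ t in Ioi ξ, residualDensity α μ ξ D t) + 0, ?_, s₁, C, hC,
    fun T hT => ?_, fun l hl hE => ?_⟩
  · rw [add_zero, zero_add, Complex.add_im, hGim', Complex.im_ofReal_mul, hDim]
    ring
  · have hn := h.integrableOn_norm T
    have hk := (h.integrableOn_kern T).norm
    rw [← integral_add hn hk, ← integral_const_mul]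
    refine norm_integral_le_of_norm_le ((hn.add hk).const_mul C) ?_
    filter_upwards [self_mem_ae_restrict measurableSet_Ioi] with t ht
    exact H2 T t hT (le_of_lt ht)
  · have h1 : Tendsto (fun T : ℝ => (T : ℂ) * ((∫ s in ξ..T, edgeWeight α μ ξ s) - D)) l (𝓝 0) := by
      refine squeeze_zero_norm' (a := fun T : ℝ => C * ‖(α T - μ) * T‖) ?_ ?_
      · filter_upwards [hl (eventually_ge_atTop s₁)] with T hT
        rw [norm_mul, norm_mul, mul_left_comm C, mul_comm ‖α T - μ‖]
        calc ‖(T : ℂ)‖ * ‖(∫ s in ξ..T, edgeWeight α μ ξ s) - D‖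
            ≤ ‖(T : ℂ)‖ * (C * ‖α T - μ‖) :=
              mul_le_mul_of_nonneg_left (H1 T hT) (norm_nonneg _)
          _ = _ := by ring
      · have := (h.tendsto_mul.mono_left hl).norm.const_mul C
        simpa using this
    have h2 : Tendsto (fun T => ∫ t in ξ..T, residualDensity α μ ξ D t) l
        (𝓝 (∫ t in Ioi ξ, residualDensity α μ ξ D t)) :=
      (intervalIntegral_tendsto_integral_Ioi ξ hG tendsto_id).mono_left hl
    refine (((h1.add_const (ξ * D)).add h2).add hE).congr' ?_
    filter_upwards [hl (eventually_ge_atTop ξ)] with T hT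
    rw [h.integral_upperIntegrand c D hT]

end AdmissibleCurve

/-! ### The two modes of truncation and the inversion formula. -/

namespace AdmissibleCurve

variable {α : ℝ → ℂ} {μ : ℝ}

/-- Given `N`, take `M` beyond which the distance to `μ` is at most half of that at `N`; a maximum
point of the distance on `[N, M]` is a last entrance. -/
theorem lastEntrance_neBot (h : AdmissibleCurve α μ) : (lastEntrance α μ).NeBot := by
  rw [lastEntrance, ← frequently_mem_iff_neBot, frequently_atTop]
  intro N
  have hN : 0 < ‖α N - μ‖ := norm_pos_iff.2 (sub_ne_zero.2 (h.ne_end N))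
  obtain ⟨M, hM, H⟩ := h.eventually_norm_le (half_pos hN) N
  have hc : Continuous fun s => ‖α s - μ‖ := (h.continuous.sub continuous_const).norm
  obtain ⟨T, hT, hmax⟩ := isCompact_Icc.exists_isMaxOn (nonempty_Icc.2 hM) hc.continuousOn
  refine ⟨T, hT.1, fun s hs => ?_⟩
  rcases le_total s M with h1 | h1
  · exact hmax ⟨hT.1.trans hs, h1⟩
  · have h2 : ‖α N - μ‖ ≤ ‖α T - μ‖ := hmax ⟨le_rfl, hM⟩
    linarith [H s h1]

/-- The upper half, run backwards, gives `-K`, and the lower half gives `conj K`. Their sum is `-2i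
Im K = πiξ`. -/
theorem hasTransform (h : AdmissibleCurve α μ) (c ξ : ℝ) {l : Filter ℝ} (hl : l ≤ atTop)
    (hk : Tendsto (fun T => ∫ t in Ioi T, ‖kern α μ t (α T)‖) l (𝓝 0)) :
    HasTransform α μ (f0' α μ c) ξ l (xinv α (α ξ)) := by
  obtain ⟨K, hK, s₁, C, hC, hE, hlim⟩ := h.exists_limit_upperIntegrand c ξ
  have hconj : ∀ T ≥ ξ, ∀ s ∈ Ioc ξ T, lowerIntegrand α μ (f0' α μ c) ξ s =
      conj (upperIntegrand α μ (f0' α μ c) ξ s) := fun T _ s hs => h.lowerIntegrand_eq c hs.1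
  have hup := hlim l hl (by
    refine squeeze_zero_norm' (a := fun T => C * ((∫ t in Ioi T, ‖α t - μ‖) +
      ∫ t in Ioi T, ‖kern α μ t (α T)‖)) ?_ ?_
    · filter_upwards [hl (eventually_ge_atTop s₁)] with T hT using hE T hT
    · have h1 : Tendsto (fun T : ℝ => ∫ t in Ioi T, ‖α t - μ‖) l (𝓝 0) :=
        (tendsto_integral_Ioi_zero tendsto_id).mono_left hl
      simpa using (h1.add hk).const_mul C)
  refine ⟨fun T hT => ⟨h.intervalIntegrable_upperIntegrand c hT.le, ?_⟩, -K, conj K, ?_, ?_, ?_⟩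
  · have h1 := h.intervalIntegrable_upperIntegrand c hT.le
    rw [intervalIntegrable_iff_integrableOn_Ioc_of_le hT.le] at h1 ⊢
    refine IntegrableOn.congr_fun (f := fun s => conj (upperIntegrand α μ (f0' α μ c) ξ s)) ?_
      (fun s hs => (hconj T hT.le s hs).symm) measurableSet_Ioc
    exact Complex.conjCLE.toContinuousLinearMap.integrable_comp h1
  · refine hup.neg.congr fun T => ?_
    rw [intervalIntegral.integral_symm T ξ, neg_neg]
  · refine ((Complex.continuous_conj.tendsto K).comp hup).congr' ?_
    filter_upwards [hl (eventually_ge_atTop ξ)] with T hT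
    rw [Function.comp, intervalIntegral.integral_of_le hT, intervalIntegral.integral_of_le hT,
      ← integral_conj]
    exact (setIntegral_congr_fun measurableSet_Ioc (hconj T hT)).symm
  · have h1 : conj K + -K = -((2 * K.im : ℝ) * Complex.I) := by
      rw [← sub_eq_add_neg, ← neg_sub, Complex.sub_conj]
    have hπ : (Real.pi : ℂ) ≠ 0 := Complex.ofReal_ne_zero.2 Real.pi_ne_zero
    rw [h.xinv_eq, h1, hK]
    push_cast
    field_simp

theorem tendsto_integral_norm_kern_lastEntrance (h : AdmissibleCurve α μ) :
    Tendsto (fun T => ∫ t in Ioi T, ‖kern α μ t (α T)‖) (lastEntrance α μ) (𝓝 0) := by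
  have h1 : Tendsto (fun T : ℝ => 12 * ∫ t in Ioi T, ‖α t - μ‖) (lastEntrance α μ) (𝓝 0) := by
    have h2 : Tendsto (fun T : ℝ => ∫ t in Ioi T, ‖α t - μ‖) atTop (𝓝 0) :=
      tendsto_integral_Ioi_zero tendsto_id
    have h3 : lastEntrance α μ ≤ atTop := inf_le_left
    simpa using (h2.mono_left h3).const_mul 12
  refine squeeze_zero' (Eventually.of_forall fun T => integral_nonneg fun t => norm_nonneg _) ?_ h1
  have h3 : {T | ∀ s ≥ T, ‖α s - μ‖ ≤ ‖α T - μ‖} ∈ lastEntrance α μ :=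
    mem_inf_of_right (mem_principal_self _)
  filter_upwards [h3] with T hT
  rw [← integral_const_mul]
  exact setIntegral_mono_on (h.integrableOn_kern T).norm ((h.integrableOn_norm T).const_mul 12)
    measurableSet_Ioi fun t ht => h.kern_le_of_lastEntrance hT ht

/-- The integral of `kern` itself is `f₀(α T) - c - (α T - μ) T`, which tends to zero;
`integral_norm_kern_le` passes to absolute values. -/
theorem tendsto_integral_norm_kern (h : AdmissibleCurve α μ) {c : ℝ}
    (hc : Tendsto (fun s => f0 α μ c (α s)) atTop (𝓝 (c : ℂ))) :
    Tendsto (fun T => ∫ t in Ioi T, ‖kern α μ t (α T)‖) atTop (𝓝 0) := by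
  have h1 : Tendsto (fun T : ℝ => ∫ t in Ioi T, ‖α t - μ‖) atTop (𝓝 0) :=
    tendsto_integral_Ioi_zero tendsto_id
  have h2 : Tendsto (fun T => ∫ t in Ioi T, kern α μ t (α T)) atTop (𝓝 0) := by
    have h3 := (hc.sub_const (c : ℂ)).sub h.tendsto_mul
    rw [sub_self, sub_zero] at h3
    refine h3.congr fun T => ?_
    rw [h.f0_curve, potential]
    ring
  refine squeeze_zero (fun T => integral_nonneg fun t => norm_nonneg _) h.integral_norm_kern_le ?_
  simpa using h2.norm.add (h1.const_mul 8)

/-- The assumptions on `x(u)` and `x'(u)`, read in the parameter, say that `(α y - μ) y → 0` and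
that `α y - μ` is integrable at `+∞`. -/
theorem of_spectralCurve {S A : ℝ → ℝ}
    (hαdef : ∀ x, α x = ((-(1 / 2) * deriv S x : ℝ) : ℂ) + Complex.I * (A x : ℂ))
    (hα : ContDiff ℝ 1 α) (hApos : ∀ x, 0 < A x)
    (hAbot : Tendsto A atBot (𝓝 0)) (hAtop : Tendsto A atTop (𝓝 0))
    (hStop : Tendsto (fun x => -(1 / 2) * deriv S x) atTop (𝓝 μ))
    (hloc : ∀ x, deriv α x ≠ 0) (hinj : Function.Injective α)
    (hlim : Tendsto (fun y => (α y - μ) * xinv α (α y)) atTop (𝓝 0))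
    (hL1 : ∀ y₀ : ℝ, IntegrableOn (fun y => (α y - μ) * xinv' α (α y) * deriv α y) (Ioi y₀)) :
    AdmissibleCurve α μ := by
  have him : ∀ x, (α x).im = A x := fun x => by rw [hαdef]; simp
  have himf : (fun x => (α x).im) = A := funext him
  have hr : RegularArc α := ⟨hα, hinj, hloc⟩
  have hpos : ∀ x, 0 < (α x).im := fun x => by rw [him]; exact hApos x
  have he : IsEmbedding α := hr.isEmbedding hpos (by rwa [himf]) (by rwa [himf])
  refine ⟨hr, hpos, ?_, by rwa [himf], fun y => ?_, ?_⟩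
  · have h1 := ((Complex.continuous_ofReal.tendsto _).comp hStop).add
      (((Complex.continuous_ofReal.tendsto _).comp hAtop).const_mul Complex.I)
    rw [Complex.ofReal_zero, mul_zero, add_zero] at h1
    exact h1.congr fun x => (hαdef x).symm
  · refine (hL1 y).congr_fun (fun x _ => ?_) measurableSet_Ioi
    simp only [mul_assoc, hr.xinv'_mul_deriv he, mul_one]
  · simpa only [hr.xinv_eq] using hlim

end AdmissibleCurve

end AbelHilbert
theorem theorem1 (S A : ℝ → ℝ) (α : ℝ → ℂ) (μm μp c : ℝ)
    (hS : Differentiable ℝ S)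
    (hαdef : ∀ x, α x = ((-(1 / 2) * deriv S x : ℝ) : ℂ) + Complex.I * (A x : ℂ))
    (hα : ContDiff ℝ 1 α)
    (hApos : ∀ x, 0 < A x)
    (hAbot : Tendsto A atBot (𝓝 0)) (hAtop : Tendsto A atTop (𝓝 0))
    (hSbot : Tendsto (fun x => -(1 / 2) * deriv S x) atBot (𝓝 μm))
    (hStop : Tendsto (fun x => -(1 / 2) * deriv S x) atTop (𝓝 μp))
    (hloc : ∀ x, deriv α x ≠ 0)
    (hinj : Function.Injective α)
    (hlim : Tendsto (fun y => (α y - μp) * AbelHilbert.xinv α (α y)) atTop (𝓝 0))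
    (hL1 : ∀ y₀ : ℝ, IntegrableOn
      (fun y => (α y - μp) * AbelHilbert.xinv' α (α y) * deriv α y) (Ioi y₀)) :
    -- the radical is the branch analytic off the cut with the prescribed behaviour at infinity
    (∀ y, AbelHilbert.IsRadicalBranch α μp y (AbelHilbert.radical α μp y)) ∧
    -- the integrals defining `f₀` and its derivative converge
    (∀ z ∈ range α,
      IntegrableOn (AbelHilbert.f0Integrand α μp z) (Ioi (Function.invFun α z)) ∧
      IntegrableOn (AbelHilbert.df0Integrand α μp z) (Ioi (Function.invFun α z)) ∧
      HasDerivWithinAt (AbelHilbert.f0 α μp c)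
        ((∫ y in Ioi (Function.invFun α z), AbelHilbert.df0Integrand α μp z y)
          + AbelHilbert.xinv α z) (AbelHilbert.symCurve α) z) ∧
    (∀ z ∈ AbelHilbert.symCurve α,
      DifferentiableWithinAt ℂ (AbelHilbert.f0 α μp c) (AbelHilbert.symCurve α) z) ∧
    -- the boundary values of the radical on the left side of the contour exist
    (∀ ξ s, ξ < s →
      AbelHilbert.HasLeftValue (AbelHilbert.radical α μp ξ) (α s) (-deriv α s) ∧
      AbelHilbert.HasLeftValue (AbelHilbert.radical α μp ξ) (conj (α s)) (conj (deriv α s))) ∧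
    -- the inversion formula
    (AbelHilbert.lastEntrance α μp).NeBot ∧
    (∀ ξ, AbelHilbert.HasTransform α μp (AbelHilbert.f0' α μp c) ξ
      (AbelHilbert.lastEntrance α μp) (AbelHilbert.xinv α (α ξ))) ∧
    -- the inversion formula with unrestricted truncation, if `f₀` is continuous at `μp` along `Σ`
    (Tendsto (fun s => AbelHilbert.f0 α μp c (α s)) atTop (𝓝 (c : ℂ)) →
      ∀ ξ, AbelHilbert.HasTransform α μp (AbelHilbert.f0' α μp c) ξ atTop
        (AbelHilbert.xinv α (α ξ))) := by
  have h : AbelHilbert.AdmissibleCurve α μp :=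
    .of_spectralCurve hαdef hα hApos hAbot hAtop hStop hloc hinj hlim hL1
  refine ⟨h.isRadicalBranch, ?_, ?_, fun ξ s hs => ⟨h.hasLeftValue hs, h.hasLeftValue_conj hs⟩,
    h.lastEntrance_neBot, fun ξ => ?_, fun hc ξ => ?_⟩
  · rintro _ ⟨s, rfl⟩
    rw [Function.leftInverse_invFun h.inj s, h.xinv_eq]
    simp only [funext (h.f0Integrand_eq (α s)), funext (h.df0Integrand_eq (α s))]
    exact ⟨h.integrableOn_kern s, h.integrableOn_dkern s, h.hasDerivWithinAt_f0 c s⟩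
  · rintro _ (⟨s, rfl⟩ | ⟨_, ⟨s, rfl⟩, rfl⟩)
    · exact (h.hasDerivWithinAt_f0 c s).differentiableWithinAt
    · exact (h.hasDerivWithinAt_f0_conj c s).differentiableWithinAt
  · exact h.hasTransform c ξ inf_le_left h.tendsto_integral_norm_kern_lastEntrance
  · exact h.hasTransform c ξ le_rfl (h.tendsto_integral_norm_kern hc)
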